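/- **Setting.** Fix $\epsilon,\gamma>0$ and a smooth $V:\mathbb R^2\to\mathbb R$ all of whose derivatives (including $V$) grow at most polynomially. A (spinorial) Wigner function is a Hermitian-matrix-valued $w=\sum_{s=0}^3 w_s\sigma_s$ on $\mathbb R^2_r\times\mathbb R^2_p$ with real Pauli components $w_s$; put $\vec w=(w_1,w_2,w_3)$, $\vec p=(p_1,p_2,0)$, $\vec\nabla=(\partial_{r_1},\partial_{r_2},0)$, $w_\pm=w_0\pm\frac{\vec p}{|p|}\cdot\vec w$ and $\langle f\rangle(r)=\int_{\mathbb R^2} f(r,p)\,dp$. Let $Tw=\sum_{s=0}^3T_s(w)\sigma_s$, where $$T_0(w)=\frac{\vec p\cdot\vec\nabla}{2\gamma}w_0+\frac\epsilon2\vec\nabla\cdot\vec w+\Theta_\epsilon[V]w_0,\qquad T_s(w)=\frac{\vec p\cdot\vec\nabla}{2\gamma}w_s+\frac\epsilon2\partial_sw_0+\Theta_\epsilon[V]w_s+(\vec w\wedge\vec p)_s\quad(s=1,2,3),$$ $\partial_s$ is the $s$-th component of $\vec\nabla$, and $$(\Theta_\epsilon[V]f)(r,p)=\frac i\epsilon(2\pi)^{-2}\int_{\mathbb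 R^2}\int_{\mathbb R^2}\Big[V\big(r+\tfrac\epsilon2\xi\big)-V\big(r-\tfrac\epsilon2\xi\big)\Big]f(r,p')\,e^{-i(p-p')\cdot\xi}\,dp'\,d\xi .$$ **Equilibria.** For a symbol $a$, let $(\mathrm{Op}_\epsilon(a)\psi)(x)=(2\pi\epsilon)^{-2}\int\!\int a\big(\tfrac{x+y}2,p\big)\psi(y)e^{i(x-y)\cdot p/\epsilon}\,dy\,dp$ be its Weyl quantization. Given $n_+,n_-:\mathbb R^2\to\mathbb R$, a Wigner function $g$ with Schwartz components is called the equilibrium $g[n_+,n_-]$ with multipliers $A,B$ if $A,B:\mathbb R^2\to\mathbb R$ are smooth, with all derivatives of at most polynomial growth, $$g=\mathcal E\mathrm{xp}_\epsilon(-h_\xi)=\mathrm{Op}_\epsilon^{-1}\big(\exp(\mathrm{Op}_\epsilon(-h_\xi))\big),\qquad h_\xi=\Big(\frac{|p|^2}2+A(r)\Big)\sigma_0+\big(\epsilon\gamma|p|+B(r)\big)\frac{\vec p}{|p|}\cdot\vec\sigma,$$ where $\mathrm{Op}_\epsilon(h_\xi)$ maps Schwartz functions into $L^2(\mathbb R^2;\mathbb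 C^2)$ and has an orthonormal basis of Schwartz eigenfunctions, in which its exponential is computed, and if $\langle g_\pm\rangle=n_\pm$. **Theorem.** Let $\tau_0>0$. For $0<\tau<\tau_0$ let $w^\tau(t)$, $t>0$, be Wigner functions with Schwartz components, differentiable in $t$ at every $(r,p)$, that solve the diffusively scaled Wigner–BGK system $$\tau\,\partial_tw^\tau+Tw^\tau=\frac{g^\tau-w^\tau}\tau\qquad(t>0),$$ where $g^\tau(t)=g[n_+^\tau(t),n_-^\tau(t)]$, with multipliers $A^\tau(t),B^\tau(t)$, is the equilibrium for the band densities $n_\pm^\tau=\langle w_\pm^\tau\rangle$ of $w^\tau$ itself. Assume that, uniformly in $\tau\in(0,\tau_0)$ and in $t$ in compact subsets of $(0,\infty)$, every Schwartz seminorm of $w^\tau(t)$ and of $g^\tau(t)$ is bounded, and $|A^\tau(t,r)|+|B^\tau(t,r)|\le C(1+|r|)^k$ for some $C,k$. Suppose that $n_\pm^\tau(t,r)\to n_\pm(t,r)$ as $\tau\to0$ for all $t>0$ and $r\in\mathbb R^2$, and that for every $t>0$ the limit densities $n_\pm(t)$ possess an equilibrium $g[n_+(t),n_-(t)]$. Then,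 for all $t>0$ and $r\in\mathbb R^2$, the function $(TTg[n_+(t),n_-(t)])_\pm(r,\cdot)$ is integrable, $n_\pm(\cdot,r)$ is differentiable at $t$, and $$\partial_tn_\pm=\big\langle(TT\,g[n_+,n_-])_\pm\big\rangle .$$ -/

import Mathlib

open MeasureTheory Filter Topology
open scoped SchwartzMap Matrix

noncomputable section

namespace Graphene

/-- The position space (and the momentum space) `ℝ²`. -/
abbrev Plane : Type := EuclideanSpace ℝ (Fin 2)

/-- Phase space: pairs `(r, p)` of a position and a momentum. -/
abbrev Phase : Type := Plane × Plane

/-- Two-component spinors. -/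
abbrev Spinor : Type := EuclideanSpace ℂ (Fin 2)

/-- A Hermitian-matrix-valued function `∑ₛ wₛ σₛ` on phase space, given by its four real Pauli
components `w₀, w₁, w₂, w₃`. -/
abbrev Symbol : Type := Fin 4 → Phase → ℝ

/-- Symbols whose Pauli components are Schwartz functions of `(r, p)`. -/
abbrev WignerFun : Type := Fin 4 → 𝓢(Phase, ℝ)

/-- A Schwartz symbol seen as a symbol. -/
def WignerFun.toSymbol (w : WignerFun) : Symbol := fun s z => w s z

/-- The vector `(p₁, p₂, 0)`. -/
def vec3 (p : Plane) : Fin 3 → ℝ := ![p 0, p 1, 0]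

/-- The spatial gradient `(∂f/∂r₁, ∂f/∂r₂, 0)` at a point of phase space. -/
def grad3 (f : Phase → ℝ) (z : Phase) : Fin 3 → ℝ :=
  ![lineDeriv ℝ f z (EuclideanSpace.single 0 1, 0),
    lineDeriv ℝ f z (EuclideanSpace.single 1 1, 0), 0]

/-- The vector part `(w₁, w₂, w₃)` of a symbol. -/
def vecPart (w : Symbol) (z : Phase) : Fin 3 → ℝ := fun s => w s.succ z

/-- `V(r + ε ξ / 2) - V(r - ε ξ / 2)`. -/
def deltaV (ε : ℝ) (V : Plane → ℝ) (r ξ : Plane) : ℝ :=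
  V (r + (ε / 2) • ξ) - V (r - (ε / 2) • ξ)

/-- `(i/ε) (2π)⁻² ∫ (∫ δV(r, ξ) f(r, p') exp(-i (p - p')·ξ) dp') dξ`, as a complex number. -/
def thetaC (ε : ℝ) (V : Plane → ℝ) (f : Phase → ℝ) (z : Phase) : ℂ :=
  (Complex.I / ε) * ((2 * Real.pi : ℂ) ^ 2)⁻¹ *
    ∫ ξ : Plane, ∫ p' : Plane,
      (deltaV ε V z.1 ξ : ℂ) * (f (z.1, p') : ℂ) *
        Complex.exp (-Complex.I * (inner ℝ (z.2 - p') ξ : ℝ))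

/-- The integral `thetaC` is real for a real function `f`. -/
lemma thetaC_im (ε : ℝ) (V : Plane → ℝ) (f : Phase → ℝ) (z : Phase) :
    (thetaC ε V f z).im = 0 := by
  rw [← Complex.conj_eq_iff_im]
  unfold thetaC
  rw [map_mul, ← integral_conj, ← integral_neg_eq_self]
  simp_rw [← integral_conj]
  have h : ∀ ξ p' : Plane,
      (starRingEnd ℂ) ((deltaV ε V z.1 (-ξ) : ℂ) * (f (z.1, p') : ℂ) *
        Complex.exp (-Complex.I * (inner ℝ (z.2 - p') (-ξ) : ℝ))) =
      -((deltaV ε V z.1 ξ : ℂ) * (f (z.1, p') : ℂ) *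
        Complex.exp (-Complex.I * (inner ℝ (z.2 - p') ξ : ℝ))) := by
    intro ξ p'
    have h1 : deltaV ε V z.1 (-ξ) = -deltaV ε V z.1 ξ := by
      simp [deltaV, sub_eq_add_neg, add_comm]
    rw [h1, inner_neg_right]
    simp only [map_mul, ← Complex.exp_conj, Complex.conj_ofReal, map_neg, Complex.conj_I]
    push_cast
    ring_nf
  simp_rw [h, integral_neg]
  simp only [map_mul, map_div₀, map_inv₀, map_pow, Complex.conj_I, Complex.conj_ofReal,
    map_ofNat]
  ring

/-- The pseudo-differential operator `Θ_ε[V]`, acting on real functions of `(r, p)`. -/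
def theta (ε : ℝ) (V : Plane → ℝ) (f : Phase → ℝ) (z : Phase) : ℝ := (thetaC ε V f z).re

/-- The transport operator `T w = σ₀ T₀(w) + σₛ Tₛ(w)`, in Pauli components. -/
def transport (ε γ : ℝ) (V : Plane → ℝ) (w : Symbol) : Symbol :=
  Fin.cons
    (fun z =>
      (vec3 z.2 ⬝ᵥ grad3 (w 0) z) / (2 * γ)
        + ε / 2 * ∑ s : Fin 3, grad3 (fun z' => vecPart w z' s) z s
        + theta ε V (w 0) z)
    (fun (s : Fin 3) z =>
      (vec3 z.2 ⬝ᵥ grad3 (w s.succ) z) / (2 * γ)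
        + ε / 2 * grad3 (w 0) z s
        + theta ε V (w s.succ) z
        + (crossProduct (vecPart w z) (vec3 z.2)) s)

/-- The band component `w_± = w₀ ± (p/|p|)·(w₁, w₂, w₃)`; the sign is `σ = 1` or `σ = -1`. -/
def band (σ : ℤˣ) (w : Symbol) (z : Phase) : ℝ :=
  w 0 z + ((σ : ℤ) : ℝ) * ((vec3 z.2 ⬝ᵥ vecPart w z) / ‖z.2‖)

/-- The moment `⟨w_±⟩(r) = ∫ w_±(r, p) dp`. -/
def bandMoment (σ : ℤˣ) (w : Symbol) (r : Plane) : ℝ := ∫ p : Plane, band σ w (r, p)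

/-- The matrices `σ₀ = 1, σ₁, σ₂, σ₃`. -/
def pauli : Fin 4 → Matrix (Fin 2) (Fin 2) ℂ :=
  ![1, !![0, 1; 1, 0], !![0, -Complex.I; Complex.I, 0], !![1, 0; 0, -1]]

/-- The Hermitian matrix with given Pauli components, at a point of phase space. -/
def Symbol.toMatrix (a : Symbol) (z : Phase) : Matrix (Fin 2) (Fin 2) ℂ :=
  ∑ s, (a s z : ℂ) • pauli s

/-- Weyl quantization:
`(Op_ε(a) ψ)(x) = (2πε)⁻² ∫ (∫ a((x + y)/2, p) ψ(y) exp(i (x - y)·p/ε) dy) dp`. -/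
def weylOp (ε : ℝ) (a : Symbol) (ψ : Plane → Spinor) (x : Plane) : Spinor :=
  ((2 * Real.pi * ε : ℂ) ^ 2)⁻¹ •
    ∫ p : Plane, ∫ y : Plane,
      Complex.exp (Complex.I * (inner ℝ (x - y) p / ε : ℝ)) •
        WithLp.toLp 2 (a.toMatrix ((1 / 2 : ℝ) • (x + y), p) *ᵥ (ψ y).ofLp)

/-- `g = Op_ε⁻¹ (exp (Op_ε a))`, the quantum exponential of `a`.  First, `Op_ε(a)` is an operator
in `L²(ℝ²; ℂ²)` whose domain contains the Schwartz functions.  Second, the operator exponential is the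
one of the functional calculus: in an orthonormal basis of `L²(ℝ²; ℂ²)` of eigenfunctions of
`Op_ε(a)` with eigenvalues `μᵢ`, the operator `Op_ε(g)` is diagonal with eigenvalues `exp μᵢ`.
(As `g` is a Schwartz symbol, `Op_ε(g)` is Hilbert-Schmidt and maps `L²` to Schwartz functions, so
an exponential of this form always has such a basis, and the basis consists of Schwartz
functions.) -/
def IsQuantumExp (ε : ℝ) (a : Symbol) (g : WignerFun) : Prop :=
  (∀ ψ : 𝓢(Plane, Spinor), MemLp (weylOp ε a ψ) 2 volume) ∧
  ∃ (φ : ℕ → 𝓢(Plane, Spinor)) (μ : ℕ → ℝ)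
    (b : HilbertBasis ℕ ℂ (Lp Spinor 2 (volume : Measure Plane))),
    (∀ i, b i = (φ i).toLp 2 volume) ∧
    (∀ i x, weylOp ε a (φ i) x = (μ i : ℂ) • φ i x) ∧
    (∀ i x, weylOp ε g.toSymbol (φ i) x = (Real.exp (μ i) : ℂ) • φ i x)

/-- The modified Hamiltonian
`h_ξ = (|p|²/2 + A(r)) σ₀ + (c |p| + B(r)) (p/|p|)·(σ₁, σ₂, σ₃)`. -/
def modHamiltonian (c : ℝ) (A B : Plane → ℝ) : Symbol :=
  Fin.cons
    (fun z => ‖z.2‖ ^ 2 / 2 + A z.1)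
    (fun (s : Fin 3) z => (c * ‖z.2‖ + B z.1) * (vec3 z.2 s / ‖z.2‖))

/-- `g = g[n₊, n₋]` is the local equilibrium with band densities `n₊ = n 1` and `n₋ = n (-1)`:
it is the quantum exponential of `-h_ξ`, where the multipliers `A`, `B` are adjusted to the
constraints `⟨g_±⟩ = n_±`. -/
structure IsEquilibrium (ε c : ℝ) (n : ℤˣ → Plane → ℝ) (A B : Plane → ℝ) (g : WignerFun) :
    Prop where
  temperate_A : Function.HasTemperateGrowth A
  temperate_B : Function.HasTemperateGrowth B
  exp_eq : IsQuantumExp ε (-modHamiltonian c A B) g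
  moments : ∀ σ r, bandMoment σ g.toSymbol r = n σ r

/-- `w` solves, for positive times, the scaled Wigner-BGK system
`τ ∂ₜ w + T w = (g[n₊, n₋] - w) / τ`, where `n_± = ⟨w_±⟩` are the band densities of `w` itself,
`g t = g[n₊(t), n₋(t)]`, and `A t`, `B t` are the multipliers of `g t`.
The scaled Fermi speed is `c = ε γ`. -/
structure IsSolution (ε γ : ℝ) (V : Plane → ℝ) (τ : ℝ) (A B : ℝ → Plane → ℝ)
    (g w : ℝ → WignerFun) : Prop where
  equilibrium : ∀ t, 0 < t →
    IsEquilibrium ε (ε * γ) (fun σ => bandMoment σ (w t).toSymbol) (A t) (B t) (g t)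
  differentiable : ∀ t, 0 < t → ∀ s z, DifferentiableAt ℝ (fun t' => w t' s z) t
  equation : ∀ t, 0 < t → ∀ s z,
    τ * deriv (fun t' => w t' s z) t + transport ε γ V (w t).toSymbol s z
      = (g t s z - w t s z) / τ

end Graphene

end

/-! Write `m` for a band moment at a fixed point `r`. The system says `w' = τ⁻²(g - w) - τ⁻¹ T w`,
so `(m w)'` contains the singular term `-τ⁻¹ m(T w)`. It is removed by following `m w - τ m(T w) +
τ² m(T T w)` instead. Two identities, `m g = m w` and `m(T g) = 0`, make all negative powers of `τ`
cancel in the derivative of this corrected density, which is exactly `m(T T g) - τ m(T T T w)`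
(`IsSolution.hasDerivAt_correctedDensity`). The corrections vanish with `τ` by the Schwartz bounds.
What remains is to prove `m(T g) = 0` and to identify the limit of `g`.

Both rest on one estimate for quantum exponentials, `hsNorm_sub_le`. Let `H₁`, `H₂` have eigenvalues
`μ i`, `ν j` bounded above by `l`. Expanding in the two eigenbases, the trace of `(exp H₁ - exp
H₂)(H₁ - H₂)` is the sum of `(exp μ - exp ν)(μ - ν) |⟨φ i, ψ j⟩|²`, and this dominates `exp (-l)`
times the squared Hilbert-Schmidt norm of `exp H₁ - exp H₂`. The trace is also, up to a constant,
the phase space integral of the product of the symbols (`hasSum_trace`). The operators are unbounded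
and `p/|p|` is not smooth at the origin, so this formula is not obtained from a symbol calculus. The
kernel of `exp H` is expanded in eigenfunctions with convergence in every weighted `L²` norm, for
position and momentum weights, and such convergence passes through the Wigner transform.

With equal exponents the estimate gives uniqueness of the exponential. Since `h_ξ` is invariant
under time reversal `(a₀, a)(r, p) ↦ (a₀, -a)(r, -p)`, so is `g`. Transport anticommutes with time
reversal while band moments are invariant, hence `m(T g) = 0`.

With different multipliers the kinetic parts of `h_ξ` cancel, so that the trace only pairs the
differences of `A`, `B` with the differences of the band moments
(`sum_integral_modHamiltonian_sub`). Polynomial bounds on the multipliers and convergence of the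
moments then give convergence of the equilibria in `L²`; boundedness in the Schwartz space upgrades
this to Schwartz convergence (`tendsto_of_tendsto_bandMoment`).

The derivative of the corrected density is bounded uniformly in `τ`, so pointwise convergence of the
densities becomes joint convergence in `(τ, t)`. Hence `g` converges jointly to the limit
equilibrium, and the theorem on limits of derivatives concludes. -/

noncomputable section

set_option linter.unusedSectionVars false

/-! ### Bounded families and pointwise differentiable curves in the Schwartz space -/

namespace SchwartzMap

open LineDeriv

variable {ι : Type*} {E F G : Type} [NormedAddCommGroup E] [NormedSpace ℝ E]
  [NormedAddCommGroup F] [NormedSpace ℝ F] [NormedAddCommGroup G] [NormedSpace ℝ G]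

/-- A family of Schwartz functions that is bounded in every Schwartz seminorm over an index set. -/
def BoundedOn (f : ι → 𝓢(E, F)) (S : Set ι) : Prop :=
  ∀ k l : ℕ, ∃ C : ℝ, ∀ i ∈ S, SchwartzMap.seminorm ℝ k l (f i) ≤ C

/-- Links the explicit seminorm bounds with the topological notion of boundedness, which every
continuous linear map preserves. -/
lemma boundedOn_iff {f : ι → 𝓢(E, F)} {S : Set ι} :
    BoundedOn f S ↔ Bornology.IsVonNBounded ℝ (f '' S) := by
  rw [(schwartz_withSeminorms ℝ E F).image_isVonNBounded_iff_seminorm_bounded]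
  constructor
  · rintro h ⟨k, l⟩
    obtain ⟨C, hC⟩ := h k l
    exact ⟨max C 0 + 1, by positivity, fun i hi =>
      ((hC i hi).trans (le_max_left _ _)).trans_lt (lt_add_one _)⟩
  · intro h k l
    obtain ⟨r, -, hr⟩ := h (k, l)
    exact ⟨r, fun i hi => (hr i hi).le⟩

lemma BoundedOn.map {E' F' : Type} [NormedAddCommGroup E'] [NormedSpace ℝ E']
    [NormedAddCommGroup F'] [NormedSpace ℝ F'] {f : ι → 𝓢(E, F)} {S : Set ι} (h : BoundedOn f S)
    (L : 𝓢(E, F) →L[ℝ] 𝓢(E', F')) : BoundedOn (fun i => L (f i)) S := by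
  rw [boundedOn_iff] at h ⊢
  have := h.image L
  rwa [Set.image_image] at this

lemma BoundedOn.sub {f g : ι → 𝓢(E, F)} {S : Set ι} (hf : BoundedOn f S) (hg : BoundedOn g S) :
    BoundedOn (fun i => f i - g i) S := fun k l => by
  obtain ⟨C, hC⟩ := hf k l
  obtain ⟨D, hD⟩ := hg k l
  exact ⟨C + D, fun i hi => (map_sub_le_add _ _ _).trans (add_le_add (hC i hi) (hD i hi))⟩

lemma boundedOn_const (f : 𝓢(E, F)) (S : Set ι) : BoundedOn (fun _ => f) S :=
  fun k l => ⟨_, fun _ _ => le_rfl⟩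

lemma BoundedOn.exists_nonneg {f : ι → 𝓢(E, F)} {S : Set ι} (h : BoundedOn f S) (k l : ℕ) :
    ∃ C : ℝ, 0 ≤ C ∧ ∀ i ∈ S, SchwartzMap.seminorm ℝ k l (f i) ≤ C := by
  obtain ⟨C, hC⟩ := h k l
  exact ⟨max C 0, le_max_right _ _, fun i hi => (hC i hi).trans (le_max_left _ _)⟩

lemma norm_fderiv_le_seminorm (f : 𝓢(E, F)) (z : E) :
    ‖fderiv ℝ f z‖ ≤ SchwartzMap.seminorm ℝ 0 1 f := by
  simpa [← norm_iteratedFDeriv_fderiv (n := 0)] using f.norm_iteratedFDeriv_le_seminorm ℝ 1 z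

lemma norm_sub_le_seminorm_mul (f : 𝓢(E, F)) (y z : E) :
    ‖f y - f z‖ ≤ SchwartzMap.seminorm ℝ 0 1 f * ‖y - z‖ :=
  convex_univ.norm_image_sub_le_of_norm_fderiv_le (fun _ _ => f.differentiableAt)
    (fun x _ => f.norm_fderiv_le_seminorm x) (Set.mem_univ _) (Set.mem_univ _)

lemma norm_fderiv_sub_le_seminorm_mul (f : 𝓢(E, F)) (y z : E) :
    ‖fderiv ℝ f y - fderiv ℝ f z‖ ≤ SchwartzMap.seminorm ℝ 0 2 f * ‖y - z‖ := by
  have h := norm_sub_le_seminorm_mul (fderivCLM ℝ E F f) y z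
  simp only [fderivCLM_apply] at h
  refine h.trans ?_
  gcongr
  refine seminorm_le_bound ℝ _ _ _ (apply_nonneg _ _) fun x => ?_
  have := f.le_seminorm ℝ 0 2 x
  rwa [← norm_iteratedFDeriv_fderiv (n := 1)] at this

lemma norm_taylor_le_seminorm_mul (f : 𝓢(E, F)) (z v : E) :
    ‖f (z + v) - f z - fderiv ℝ f z v‖ ≤ SchwartzMap.seminorm ℝ 0 2 f * ‖v‖ ^ 2 := by
  have h := (convex_closedBall z ‖v‖).norm_image_sub_le_of_norm_fderiv_le' (𝕜 := ℝ) (f := f)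
    (φ := fderiv ℝ f z) (C := SchwartzMap.seminorm ℝ 0 2 f * ‖v‖) (x := z) (y := z + v)
    (fun x _ => f.differentiableAt)
    (fun x hx => (f.norm_fderiv_sub_le_seminorm_mul x z).trans (by
      gcongr
      simpa [dist_eq_norm] using hx)) (by simp) (by simp)
  simpa [pow_two, mul_assoc] using h

/-- Far from the origin the next seminorm makes the weighted function uniformly small. On the
remaining ball the family is uniformly Lipschitz, so convergence on a finite net controls it
everywhere. -/
lemma eventually_forall_norm_pow_mul_le [ProperSpace E] {𝓁 : Filter ι} {f : ι → 𝓢(E, F)}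
    {S : Set ι} (hS : ∀ᶠ i in 𝓁, i ∈ S) (hf : BoundedOn f S)
    (h0 : ∀ z, Tendsto (fun i => f i z) 𝓁 (𝓝 0)) (k : ℕ) {η : ℝ} (hη : 0 < η) :
    ∀ᶠ i in 𝓁, ∀ z, ‖z‖ ^ k * ‖f i z‖ ≤ η := by
  obtain ⟨C, hC0, hC⟩ := hf.exists_nonneg (k + 1) 0
  obtain ⟨D, hD0, hD⟩ := hf.exists_nonneg 0 1
  -- Chosen so that `C ≤ R * η`: outside radius `R`, the bound on the weight `k + 1` already gives
  -- `η` for the weight `k`. The net below is so fine that its Lipschitz error uses only half of the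
  -- allowance.
  set R : ℝ := C / η + 1 with hR
  have hR0 : 0 < R := by positivity
  set δ : ℝ := η / (2 * R ^ k * (D + 1)) with hδ
  have hδ0 : 0 < δ := by positivity
  obtain ⟨t, -, htf, ht⟩ := (isCompact_closedBall (0 : E) R).finite_cover_balls hδ0
  have hev : ∀ᶠ i in 𝓁, ∀ c ∈ t, ‖f i c‖ < η / (2 * R ^ k) := by
    rw [htf.eventually_all]
    intro c _
    have := (h0 c).norm
    rw [norm_zero] at this
    exact this.eventually_lt_const (by positivity)
  filter_upwards [hS, hev] with i hi hit z
  rcases le_total ‖z‖ R with hz | hz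
  · have hz' : z ∈ ⋃ x ∈ t, Metric.ball x δ := ht (by simpa using hz)
    simp only [Set.mem_iUnion, Metric.mem_ball, exists_prop] at hz'
    obtain ⟨c, hc, hzc⟩ := hz'
    have h1 : ‖f i z‖ ≤ ‖f i c‖ + D * δ := by
      have h2 := (f i).norm_sub_le_seminorm_mul z c
      have h3 : ‖f i z‖ ≤ ‖f i c‖ + ‖f i z - f i c‖ := by
        simpa using norm_add_le (f i c) (f i z - f i c)
      rw [dist_eq_norm] at hzc
      have h4 : SchwartzMap.seminorm ℝ 0 1 (f i) * ‖z - c‖ ≤ D * δ := by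
        gcongr
        exact hD i hi
      linarith
    have h2 : D * δ ≤ η / (2 * R ^ k) := by
      rw [hδ, mul_div_assoc', div_le_div_iff₀ (by positivity) (by positivity)]
      have : 0 ≤ η * (2 * R ^ k) := by positivity
      nlinarith
    calc ‖z‖ ^ k * ‖f i z‖ ≤ R ^ k * (η / (2 * R ^ k) + η / (2 * R ^ k)) := by
          gcongr
          exact h1.trans (add_le_add (hit c hc).le h2)
      _ = η := by field_simp; ring
  · have h1 := (f i).norm_pow_mul_le_seminorm ℝ (k + 1) z
    have h2 : ‖z‖ ^ (k + 1) * ‖f i z‖ ≤ C := h1.trans (hC i hi)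
    have h3 : R * (‖z‖ ^ k * ‖f i z‖) ≤ C := by
      refine le_trans ?_ h2
      rw [pow_succ']
      rw [mul_assoc]
      gcongr
    have h4 : C ≤ R * η := by
      rw [hR, add_mul, div_mul_cancel₀ _ hη.ne']
      linarith
    exact le_of_mul_le_mul_left (h3.trans h4) hR0

/-- Interpolation: Taylor's formula with step `h` bounds the first derivative by `2 sup ‖f‖ / h + C
h`, where `C` bounds the second derivative. First `h` is taken small, then the supremum. -/
lemma tendsto_fderiv_of_boundedOn [ProperSpace E] {𝓁 : Filter ι} {f : ι → 𝓢(E, F)}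
    {S : Set ι} (hS : ∀ᶠ i in 𝓁, i ∈ S) (hf : BoundedOn f S)
    (h0 : ∀ z, Tendsto (fun i => f i z) 𝓁 (𝓝 0)) (z : E) :
    Tendsto (fun i => fderiv ℝ (f i) z) 𝓁 (𝓝 0) := by
  rw [tendsto_zero_iff_norm_tendsto_zero]
  obtain ⟨C, hC0, hC⟩ := hf.exists_nonneg 0 2
  refine tendsto_order.2 ⟨fun a ha => Eventually.of_forall fun i => ha.trans_le (norm_nonneg _),
    fun η hη => ?_⟩
  set h : ℝ := η / (2 * (C + 1)) with hh
  have hh0 : 0 < h := by positivity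
  filter_upwards [hS, eventually_forall_norm_pow_mul_le hS hf h0 0
    (show 0 < h * η / 8 by positivity)] with i hi hsup
  simp only [pow_zero, one_mul] at hsup
  refine lt_of_le_of_lt (b := 3 / 4 * η) ?_ (by linarith)
  refine ContinuousLinearMap.opNorm_le_of_unit_norm (by positivity) fun v hv => ?_
  have h1 := (f i).norm_taylor_le_seminorm_mul z (h • v)
  have h2 : ‖fderiv ℝ (f i) z (h • v)‖ ≤
      ‖f i (z + h • v)‖ + ‖f i z‖ + ‖f i (z + h • v) - f i z - fderiv ℝ (f i) z (h • v)‖ := by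
    have := norm_sub_le (f i (z + h • v) - f i z)
      (f i (z + h • v) - f i z - fderiv ℝ (f i) z (h • v))
    rw [sub_sub_cancel] at this
    exact this.trans (by gcongr; exact norm_sub_le _ _)
  rw [norm_smul, hv, mul_one, Real.norm_of_nonneg hh0.le] at h1
  rw [map_smul, norm_smul, Real.norm_of_nonneg hh0.le] at h2
  have h3 : SchwartzMap.seminorm ℝ 0 2 (f i) * h ^ 2 ≤ h * (η / 2) := by
    calc SchwartzMap.seminorm ℝ 0 2 (f i) * h ^ 2 ≤ C * h ^ 2 := by gcongr; exact hC i hi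
      _ = h * (C * h) := by ring
      _ ≤ h * (η / 2) := by
        gcongr
        rw [hh, mul_div_assoc', div_le_div_iff₀ (by positivity) (by positivity)]
        nlinarith
  rw [map_smul] at h1
  have h4 := hsup z
  have h5 := hsup (z + h • v)
  refine le_of_mul_le_mul_left (a := h) ?_ hh0
  linarith

/-- Pointwise convergence of a bounded family of Schwartz functions is convergence in the Schwartz
space. -/
theorem tendsto_of_boundedOn [ProperSpace E] {𝓁 : Filter ι} {f : ι → 𝓢(E, F)} {f₀ : 𝓢(E, F)}
    {S : Set ι} (hS : ∀ᶠ i in 𝓁, i ∈ S) (hf : BoundedOn f S)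
    (h0 : ∀ z, Tendsto (fun i => f i z) 𝓁 (𝓝 (f₀ z))) : Tendsto f 𝓁 (𝓝 f₀) := by
  rw [(schwartz_withSeminorms ℝ E F).tendsto_nhds]
  rintro ⟨k, l⟩ η hη
  have hb := hf.sub (boundedOn_const f₀ S)
  have h1 : ∀ z, Tendsto (fun i => (f i - f₀) z) 𝓁 (𝓝 0) := fun z => by
    simpa using (h0 z).sub_const (f₀ z)
  -- Raising the order by one replaces `f` by its derivative, whose values lie in another space; the
  -- induction therefore runs over all target spaces at once.
  suffices H : ∀ (l : ℕ) {F : Type} [NormedAddCommGroup F] [NormedSpace ℝ F] (f : ι → 𝓢(E, F)),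
      BoundedOn f S → (∀ z, Tendsto (fun i => f i z) 𝓁 (𝓝 0)) → ∀ η : ℝ, 0 < η →
      ∀ᶠ i in 𝓁, ∀ z, ‖z‖ ^ k * ‖iteratedFDeriv ℝ l (f i) z‖ ≤ η by
    filter_upwards [H l _ hb h1 (η / 2) (by positivity)] with i hi
    exact lt_of_le_of_lt (seminorm_le_bound ℝ _ _ _ (by positivity) hi) (by linarith)
  intro l
  induction l with
  | zero =>
    intro F _ _ f hf h0 η hη
    simpa using eventually_forall_norm_pow_mul_le hS hf h0 k hη
  | succ l ih =>
    intro F _ _ f hf h0 η hη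
    have := ih (fun i => fderivCLM ℝ E F (f i)) (hf.map (fderivCLM ℝ E F))
      (tendsto_fderiv_of_boundedOn hS hf h0) η hη
    filter_upwards [this] with i hi z
    rw [← norm_iteratedFDeriv_fderiv]
    exact hi z

/-- A curve in the Schwartz space that is differentiable at every point, with a derivative that
takes values in the Schwartz space and is bounded there. -/
structure PointwiseDeriv (f f' : ℝ → 𝓢(E, F)) (U : Set ℝ) : Prop where
  hasDerivAt : ∀ s ∈ U, ∀ z, HasDerivAt (fun s => f s z) (f' s z) s
  bounded : BoundedOn f' U

/-- Time and space derivatives commute because the spatial difference quotients of `f'` converge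
uniformly in time: their Taylor remainder is governed by the second-order seminorm of `f'`, which is
bounded on `U`. -/
lemma PointwiseDeriv.lineDerivOp {f f' : ℝ → 𝓢(E, F)} {U : Set ℝ} (hU : IsOpen U)
    (h : PointwiseDeriv f f' U) (v : E) :
    PointwiseDeriv (fun s => ∂_{v} (f s)) (fun s => ∂_{v} (f' s)) U := by
  refine ⟨fun s hs z => ?_, h.bounded.map (lineDerivOpCLM ℝ 𝓢(E, F) v)⟩
  obtain ⟨C, hC0, hC⟩ := h.bounded.exists_nonneg 0 2
  refine hasDerivAt_of_tendstoUniformlyOnFilter (l := 𝓝[≠] (0 : ℝ))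
    (f := fun h s => h⁻¹ • (f s (z + h • v) - f s z))
    (f' := fun h s => h⁻¹ • (f' s (z + h • v) - f' s z))
    (g' := fun s => (∂_{v} (f' s)) z) ?_ ?_ ?_
  · rw [Metric.tendstoUniformlyOnFilter_iff]
    intro η hη
    have h1 : ∀ᶠ h : ℝ in 𝓝[≠] 0, h ≠ 0 ∧ C * |h| * ‖v‖ ^ 2 < η := by
      refine Filter.inter_mem self_mem_nhdsWithin (nhdsWithin_le_nhds ?_)
      have : Tendsto (fun h : ℝ => C * |h| * ‖v‖ ^ 2) (𝓝 0) (𝓝 (C * |0| * ‖v‖ ^ 2)) :=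
        Continuous.tendsto (by fun_prop) 0
      simp only [abs_zero, mul_zero, zero_mul] at this
      exact this.eventually_lt_const hη
    filter_upwards [h1.prod_mk (hU.mem_nhds hs)] with ⟨h, s⟩ ⟨⟨hh, hlt⟩, hs⟩
    refine lt_of_le_of_lt ?_ hlt
    have h2 := (f' s).norm_taylor_le_seminorm_mul z (h • v)
    rw [dist_comm, dist_eq_norm, lineDerivOp_apply_eq_fderiv]
    have h3 : h⁻¹ • (f' s (z + h • v) - f' s z) - fderiv ℝ (f' s) z v =
        h⁻¹ • (f' s (z + h • v) - f' s z - fderiv ℝ (f' s) z (h • v)) := by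
      rw [smul_sub _ _ (fderiv ℝ (f' s) z (h • v)), map_smul, smul_smul, inv_mul_cancel₀ hh,
        one_smul]
    rw [h3, norm_smul, norm_inv, Real.norm_eq_abs, inv_mul_le_iff₀ (abs_pos.2 hh)]
    refine h2.trans ?_
    rw [norm_smul, Real.norm_eq_abs, mul_pow]
    calc SchwartzMap.seminorm ℝ 0 2 (f' s) * (|h| ^ 2 * ‖v‖ ^ 2)
        ≤ C * (|h| ^ 2 * ‖v‖ ^ 2) := by gcongr; exact hC s hs
      _ = _ := by ring
  · filter_upwards [prod_mem_prod univ_mem (hU.mem_nhds hs)] with ⟨h', s⟩ ⟨_, hs⟩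
    exact (((h.hasDerivAt s hs _).sub (h.hasDerivAt s hs _)).const_smul _)
  · refine Eventually.of_forall fun s => ?_
    have := ((f s).hasFDerivAt z).hasLineDerivAt v
    rw [lineDerivOp_apply_eq_fderiv]
    exact this.tendsto_slope_zero

/-- The mean value inequality in time, applied at each fixed point to each iterated directional
derivative. Operator norms are recovered from the values on tuples of directions. -/
lemma PointwiseDeriv.norm_iteratedFDeriv_sub_le {f f' : ℝ → 𝓢(E, F)} {U : Set ℝ} (hU : IsOpen U)
    (hc : Convex ℝ U) (h : PointwiseDeriv f f' U) (k l : ℕ) :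
    ∃ C : ℝ, 0 ≤ C ∧ ∀ s ∈ U, ∀ t ∈ U,
      SchwartzMap.seminorm ℝ k l (f s - f t) ≤ C * |s - t| := by
  obtain ⟨C, hC0, hC⟩ := h.bounded.exists_nonneg k l
  refine ⟨C, hC0, fun s hs t ht => seminorm_le_bound ℝ _ _ _ (by positivity) fun z => ?_⟩
  -- Where the weight vanishes there is nothing to prove; elsewhere it can be divided out, which
  -- leaves an unweighted estimate at the point `z`.
  rcases eq_or_ne (‖z‖ ^ k) 0 with hz | hz
  · rw [hz, zero_mul]; positivity
  have hz0 : 0 < ‖z‖ ^ k := lt_of_le_of_ne (by positivity) hz.symm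
  rw [← le_div_iff₀' hz0]
  refine ContinuousMultilinearMap.opNorm_le_bound (by positivity) fun m => ?_
  rw [← iteratedLineDerivOp_eq_iteratedFDeriv]
  have key : ∀ (l : ℕ) (m : Fin l → E),
      PointwiseDeriv (fun s => ∂^{m} (f s)) (fun s => ∂^{m} (f' s)) U := by
    intro l
    induction l with
    | zero => intro m; simpa using h
    | succ l ih =>
      intro m
      simp only [iteratedLineDerivOp_succ_left]
      exact (ih _).lineDerivOp hU _
  have h1 : ‖(∂^{m} (f s)) z - (∂^{m} (f t)) z‖ ≤ (C / ‖z‖ ^ k * ∏ i, ‖m i‖) * ‖s - t‖ := by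
    refine hc.norm_image_sub_le_of_norm_hasDerivWithin_le
      (f := fun s => (∂^{m} (f s)) z) (f' := fun s => (∂^{m} (f' s)) z)
      (fun x hx => ((key l m).hasDerivAt x hx z).hasDerivWithinAt) (fun x hx => ?_) ht hs
    rw [iteratedLineDerivOp_eq_iteratedFDeriv]
    refine (ContinuousMultilinearMap.le_opNorm _ _).trans ?_
    gcongr
    rw [le_div_iff₀' hz0]
    exact ((f' x).le_seminorm ℝ k l z).trans (hC x hx)
  have h2 : (∂^{m} (f s - f t)) z = (∂^{m} (f s)) z - (∂^{m} (f t)) z := by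
    have : (∂^{m} (f s - f t)) = ∂^{m} (f s) - ∂^{m} (f t) :=
      map_sub (iteratedLineDerivOpCLM ℝ 𝓢(E, F) m) _ _
    rw [this]; rfl
  rw [h2]
  refine h1.trans (le_of_eq ?_)
  rw [Real.norm_eq_abs]
  ring

/-- Along a pointwise differentiable curve with bounded derivative the difference quotients
converge in the Schwartz space. -/
theorem PointwiseDeriv.tendsto_slope [ProperSpace E] {f f' : ℝ → 𝓢(E, F)} {U : Set ℝ}
    (hU : IsOpen U) (hc : Convex ℝ U) (h : PointwiseDeriv f f' U) {t : ℝ} (ht : t ∈ U) :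
    Tendsto (fun s => (s - t)⁻¹ • (f s - f t)) (𝓝[≠] t) (𝓝 (f' t)) := by
  -- The Lipschitz bound makes the difference quotients bounded in every seminorm away from `t`, so
  -- their pointwise convergence suffices.
  refine tendsto_of_boundedOn (S := U \ {t}) ?_ ?_ ?_
  · exact inter_mem (nhdsWithin_le_nhds (hU.mem_nhds ht)) self_mem_nhdsWithin
  · intro k l
    obtain ⟨C, hC0, hC⟩ := h.norm_iteratedFDeriv_sub_le hU hc k l
    refine ⟨C, fun s hs => ?_⟩
    rw [map_smul_eq_mul, norm_inv, Real.norm_eq_abs, inv_mul_le_iff₀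
      (abs_pos.2 (sub_ne_zero.2 hs.2)), mul_comm]
    exact hC s hs.1 t ht
  · intro z
    exact hasDerivAt_iff_tendsto_slope.1 (h.hasDerivAt t ht z)

end SchwartzMap

/-! ### The Fourier transform in one of two variables, as an operator on the Schwartz space -/

namespace SchwartzMap

open LineDeriv FourierTransform

section PartialFourier

variable {X V : Type} [NormedAddCommGroup X] [NormedSpace ℝ X]
  [NormedAddCommGroup V] [InnerProductSpace ℝ V] [FiniteDimensional ℝ V]
  [MeasurableSpace V] [BorelSpace V]

/-- A bound for Schwartz functions by an integrable power that is explicit in the seminorms. -/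
lemma norm_le_one_add_rpow {E F : Type} [NormedAddCommGroup E] [NormedSpace ℝ E]
    [NormedAddCommGroup F] [NormedSpace ℝ F] (f : 𝓢(E, F)) (l : ℕ) (z : E) {t : ℝ} (h0 : 0 ≤ t)
    (ht : t ≤ ‖z‖) :
    ‖f z‖ ≤ 2 ^ l * (SchwartzMap.seminorm ℝ 0 0 f + SchwartzMap.seminorm ℝ l 0 f) *
      (1 + t) ^ (-(l : ℝ)) := by
  have := pow_mul_le_of_le_of_pow_mul_le (k := 0) (l := l) h0 (norm_nonneg (f z))
    (f.norm_le_seminorm ℝ z) (C₂ := SchwartzMap.seminorm ℝ l 0 f)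
    (le_trans (by rw [zero_add]; gcongr) (f.norm_pow_mul_le_seminorm ℝ l z))
  simpa using this

section Restrict

variable {E : Type} [NormedAddCommGroup E] [NormedSpace ℝ E]

lemma iteratedFDeriv_comp_prodMk (f : 𝓢(X × V, E)) (x : X) (l : ℕ) (y : V) :
    ‖iteratedFDeriv ℝ l (fun y => f (x, y)) y‖ ≤ ‖iteratedFDeriv ℝ l f (x, y)‖ := by
  have h1 : (fun y => f (x, y)) =
      (fun z => f (z + (x, 0))) ∘ (ContinuousLinearMap.inr ℝ X V) := by
    ext y; simp
  have hsm : ContDiff ℝ l (fun z => f (z + (x, 0))) :=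
    (f.smooth l).comp (contDiff_id.add contDiff_const)
  rw [h1, ContinuousLinearMap.iteratedFDeriv_comp_right _ hsm _ le_rfl, iteratedFDeriv_comp_add_right]
  refine (ContinuousMultilinearMap.norm_compContinuousLinearMap_le _ _).trans ?_
  simp only [ContinuousLinearMap.inr_apply, Prod.mk_add_mk, zero_add, add_zero]
  refine mul_le_of_le_one_right (norm_nonneg _) ?_
  exact Finset.prod_le_one (fun _ _ => norm_nonneg _)
    (fun _ _ => ContinuousLinearMap.norm_inr_le_one ℝ X V)

/-- The restriction of a Schwartz function of two variables to a slice `{x} × V`. -/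
def slice (f : 𝓢(X × V, E)) (x : X) : 𝓢(V, E) where
  toFun y := f (x, y)
  smooth' := (f.smooth ⊤).comp (contDiff_prodMk_right x)
  decay' k l := by
    refine ⟨SchwartzMap.seminorm ℝ k l f, fun y => le_trans ?_ (f.le_seminorm ℝ k l (x, y))⟩
    gcongr
    · exact le_max_right _ _
    · exact iteratedFDeriv_comp_prodMk f x l y

@[simp] lemma slice_apply (f : 𝓢(X × V, E)) (x : X) (y : V) : f.slice x y = f (x, y) := rfl

/-- The norm of a pair is the maximum of the two norms, so a weight in `x` and a weight in `y` are
both absorbed by weights in `(x, y)`. -/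
lemma seminorm_slice_le (f : 𝓢(X × V, E)) (x : X) (j k l : ℕ) :
    ‖x‖ ^ j * SchwartzMap.seminorm ℝ k l (f.slice x) ≤ SchwartzMap.seminorm ℝ (j + k) l f := by
  have : ‖x‖ ^ j * SchwartzMap.seminorm ℝ k l (f.slice x) =
      SchwartzMap.seminorm ℝ k l ((‖x‖ ^ j) • f.slice x) := by
    rw [map_smul_eq_mul, norm_pow, norm_norm]
  rw [this]
  refine seminorm_le_bound ℝ _ _ _ (apply_nonneg _ _) fun y => ?_
  have h1 : iteratedFDeriv ℝ l ((‖x‖ ^ j • f.slice x : 𝓢(V, E)) : V → E) y =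
      ‖x‖ ^ j • iteratedFDeriv ℝ l (f.slice x) y :=
    iteratedFDeriv_const_smul_apply ((f.slice x).smooth l).contDiffAt
  rw [h1, norm_smul, norm_pow, norm_norm]
  refine le_trans ?_ (f.le_seminorm ℝ (j + k) l (x, y))
  calc ‖y‖ ^ k * (‖x‖ ^ j * ‖iteratedFDeriv ℝ l (f.slice x) y‖)
      = ‖x‖ ^ j * ‖y‖ ^ k * ‖iteratedFDeriv ℝ l (f.slice x) y‖ := by ring
    _ ≤ ‖(x, y)‖ ^ j * ‖(x, y)‖ ^ k * ‖iteratedFDeriv ℝ l f (x, y)‖ := by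
      gcongr
      · exact le_max_left _ _
      · exact le_max_right _ _
      · exact iteratedFDeriv_comp_prodMk f x l y
    _ = _ := by rw [pow_add]

lemma exists_sup_seminorm_slice_le (s : Finset (ℕ × ℕ)) (j : ℕ) :
    ∃ s' : Finset (ℕ × ℕ), ∀ (f : 𝓢(X × V, E)) (x : X),
      ‖x‖ ^ j * s.sup (schwartzSeminormFamily ℝ V E) (f.slice x) ≤
        s'.sup (schwartzSeminormFamily ℝ (X × V) E) f := by
  classical
  refine ⟨s.image fun m => (j + m.1, m.2), fun f x => ?_⟩
  obtain hs | hs := s.eq_empty_or_nonempty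
  · subst hs
    simp
  obtain ⟨m, hm, h⟩ := Finset.exists_mem_eq_sup' hs
    fun m => schwartzSeminormFamily ℝ V E m (f.slice x)
  have h1 : s.sup (schwartzSeminormFamily ℝ V E) (f.slice x) ≤
      schwartzSeminormFamily ℝ V E m (f.slice x) :=
    Seminorm.finset_sup_apply_le (apply_nonneg _ _) fun i hi =>
      (Finset.le_sup' (fun m => schwartzSeminormFamily ℝ V E m (f.slice x)) hi).trans h.le
  have h2 : ‖x‖ ^ j * schwartzSeminormFamily ℝ V E m (f.slice x) ≤
      schwartzSeminormFamily ℝ (X × V) E (j + m.1, m.2) f := seminorm_slice_le f x j m.1 m.2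
  have h3 : (j + m.1, m.2) ∈ s.image fun m => (j + m.1, m.2) :=
    Finset.mem_image_of_mem (fun m : ℕ × ℕ => (j + m.1, m.2)) hm
  have h4 := Seminorm.le_finset_sup_apply (p := schwartzSeminormFamily ℝ (X × V) E) (x := f) h3
  exact (mul_le_mul_of_nonneg_left h1 (by positivity)).trans (h2.trans h4)

end Restrict

/-- The weight splits into a power of `z.1`, which is a parameter and passes onto the slice, and a
power of `z.2`, which is handled by continuity of the Fourier transform on `V`. Linear dependence on
a finite supremum of seminorms is the form needed to build a continuous operator. -/
lemma fourier_slice_decay (k : ℕ) : ∃ (s : Finset (ℕ × ℕ)) (C : ℝ), 0 ≤ C ∧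
    ∀ (f : 𝓢(X × V, ℂ)) (z : X × V),
      ‖z‖ ^ k * ‖𝓕 (f.slice z.1) z.2‖ ≤ C * s.sup (schwartzSeminormFamily ℝ (X × V) ℂ) f := by
  have hF : ∀ k : ℕ, ∃ (s : Finset (ℕ × ℕ)) (C : ℝ), 0 ≤ C ∧ ∀ u : 𝓢(V, ℂ),
      SchwartzMap.seminorm ℝ k 0 (𝓕 u) ≤ C * s.sup (schwartzSeminormFamily ℝ V ℂ) u := by
    intro k
    have hc : Continuous ((SchwartzMap.seminorm ℝ k 0).comp
        (fourierTransformCLM ℝ : 𝓢(V, ℂ) →L[ℝ] 𝓢(V, ℂ)).toLinearMap) := by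
      change Continuous fun u => schwartzSeminormFamily ℝ V ℂ (k, 0) (fourierTransformCLM ℝ u)
      exact ((schwartz_withSeminorms ℝ V ℂ).continuous_seminorm (k, 0)).comp
        (fourierTransformCLM ℝ).continuous
    obtain ⟨s, C, -, h⟩ := Seminorm.bound_of_continuous (schwartz_withSeminorms ℝ V ℂ) _ hc
    exact ⟨s, C, C.2, fun u => h u⟩
  obtain ⟨s₁, C₁, hC₁, h₁⟩ := hF 0
  obtain ⟨s₂, C₂, hC₂, h₂⟩ := hF k
  obtain ⟨t₁, ht₁⟩ := exists_sup_seminorm_slice_le (X := X) (V := V) (E := ℂ) s₁ k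
  obtain ⟨t₂, ht₂⟩ := exists_sup_seminorm_slice_le (X := X) (V := V) (E := ℂ) s₂ 0
  refine ⟨t₁ ∪ t₂, C₁ + C₂, by positivity, fun f z => ?_⟩
  have e1 : ‖z‖ ^ k ≤ ‖z.1‖ ^ k + ‖z.2‖ ^ k := by
    rcases max_choice ‖z.1‖ ‖z.2‖ with h | h
    · rw [Prod.norm_def, h]; exact le_add_of_nonneg_right (by positivity)
    · rw [Prod.norm_def, h]; exact le_add_of_nonneg_left (by positivity)
  have e2 : ‖𝓕 (f.slice z.1) z.2‖ ≤ C₁ * s₁.sup (schwartzSeminormFamily ℝ V ℂ) (f.slice z.1) :=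
    (norm_le_seminorm ℝ (𝓕 (f.slice z.1)) z.2).trans (h₁ _)
  have e3 : ‖z.2‖ ^ k * ‖𝓕 (f.slice z.1) z.2‖ ≤
      C₂ * s₂.sup (schwartzSeminormFamily ℝ V ℂ) (f.slice z.1) :=
    (norm_pow_mul_le_seminorm ℝ (𝓕 (f.slice z.1)) k z.2).trans (h₂ _)
  have e4 := ht₁ f z.1
  have e5 := ht₂ f z.1
  rw [pow_zero, one_mul] at e5
  have e6 : t₁.sup (schwartzSeminormFamily ℝ (X × V) ℂ) f ≤
      (t₁ ∪ t₂).sup (schwartzSeminormFamily ℝ (X × V) ℂ) f :=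
    Finset.sup_mono (f := schwartzSeminormFamily ℝ (X × V) ℂ) Finset.subset_union_left f
  have e7 : t₂.sup (schwartzSeminormFamily ℝ (X × V) ℂ) f ≤
      (t₁ ∪ t₂).sup (schwartzSeminormFamily ℝ (X × V) ℂ) f :=
    Finset.sup_mono (f := schwartzSeminormFamily ℝ (X × V) ℂ) Finset.subset_union_right f
  calc ‖z‖ ^ k * ‖𝓕 (f.slice z.1) z.2‖
      ≤ (‖z.1‖ ^ k + ‖z.2‖ ^ k) * ‖𝓕 (f.slice z.1) z.2‖ := by gcongr
    _ = ‖z.1‖ ^ k * ‖𝓕 (f.slice z.1) z.2‖ + ‖z.2‖ ^ k * ‖𝓕 (f.slice z.1) z.2‖ := by ring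
    _ ≤ ‖z.1‖ ^ k * (C₁ * s₁.sup (schwartzSeminormFamily ℝ V ℂ) (f.slice z.1)) +
        C₂ * s₂.sup (schwartzSeminormFamily ℝ V ℂ) (f.slice z.1) := by gcongr
    _ = C₁ * (‖z.1‖ ^ k * s₁.sup (schwartzSeminormFamily ℝ V ℂ) (f.slice z.1)) +
        C₂ * s₂.sup (schwartzSeminormFamily ℝ V ℂ) (f.slice z.1) := by ring
    _ ≤ C₁ * (t₁ ∪ t₂).sup (schwartzSeminormFamily ℝ (X × V) ℂ) f +
        C₂ * (t₁ ∪ t₂).sup (schwartzSeminormFamily ℝ (X × V) ℂ) f := by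
      gcongr
      · exact e4.trans e6
      · exact e5.trans e7
    _ = _ := by ring

variable (X V) in
/-- The operator on Schwartz functions that the derivative of a partial Fourier transform induces
under the integral sign. -/
def partialFourierDeriv : 𝓢(X × V, ℂ) →L[ℝ] 𝓢(X × V, X × V →L[ℝ] ℂ) :=
  postcompCLM (((ContinuousLinearMap.compL ℝ (X × V) (X × V) ℂ).flip
      ((ContinuousLinearMap.inl ℝ X V).comp (ContinuousLinearMap.fst ℝ X V)))) ∘L
      fderivCLM ℝ (X × V) ℂ -
    ((2 * Real.pi * Complex.I) • (smulRightCLM ℝ ℂ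
      (((ContinuousLinearMap.compL ℝ (X × V) V ℝ).flip (ContinuousLinearMap.snd ℝ X V)) ∘L
        (innerSL ℝ) ∘L ContinuousLinearMap.snd ℝ X V)))

lemma partialFourierDeriv_apply (f : 𝓢(X × V, ℂ)) (z v : X × V) :
    partialFourierDeriv X V f z v =
      fderiv ℝ f z (v.1, 0) - (2 * Real.pi * Complex.I) • (inner ℝ z.2 v.2 : ℝ) • f z := by
  simp [partialFourierDeriv, innerSL_apply_apply ℝ]

/-- Differentiation under the integral sign. A Schwartz function on the product decays in `y`
uniformly in the first variable, which provides a dominating function independent of `z`. -/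
lemma hasFDerivAt_fourier_slice (f : 𝓢(X × V, ℂ)) (z : X × V) :
    HasFDerivAt (fun z : X × V => 𝓕 (f.slice z.1) z.2)
      (∫ y, Complex.exp (↑(-2 * Real.pi * inner ℝ y z.2) * Complex.I) •
        partialFourierDeriv X V f (z.1, y)) z := by
  simp only [fourier_coe, Real.fourier_eq']
  set l := (volume : Measure V).integrablePower
  set M := partialFourierDeriv X V f with hM
  refine hasFDerivAt_integral_of_dominated_of_fderiv_le (s := Set.univ)
    (bound := fun y => 2 ^ l * (SchwartzMap.seminorm ℝ 0 0 M + SchwartzMap.seminorm ℝ l 0 M) *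
      (1 + ‖y‖) ^ (-(l : ℝ)))
    (F' := fun z y => Complex.exp (↑(-2 * Real.pi * inner ℝ y z.2) * Complex.I) • M (z.1, y))
    univ_mem ?_ ?_ ?_ ?_ ?_ ?_
  · refine Eventually.of_forall fun z => Continuous.aestronglyMeasurable ?_
    have := (f.slice z.1).continuous
    fun_prop
  · have h1 := (Real.fourierIntegral_convergent_iff z.2).2
      ((f.slice z.1).integrable (μ := volume))
    simpa only [Circle.smul_def, Real.fourierChar_apply, mul_neg, neg_mul] using h1
  · have := (M.slice z.1).continuous
    change Continuous fun y => M (z.1, y) at this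
    exact Continuous.aestronglyMeasurable (by fun_prop)
  · refine Eventually.of_forall fun y z _ => ?_
    rw [norm_smul, Complex.norm_exp_ofReal_mul_I, one_mul]
    exact norm_le_one_add_rpow M l (z.1, y) (norm_nonneg _) (le_max_right _ _)
  · exact (Measure.integrable_pow_neg_integrablePower volume).const_mul _
  · refine Eventually.of_forall fun y z _ => ?_
    have h1 : HasFDerivAt (fun z : X × V => Complex.exp (↑(-2 * Real.pi * inner ℝ y z.2) * Complex.I))
        (Complex.exp (↑(-2 * Real.pi * inner ℝ y z.2) * Complex.I) •
          (Complex.ofRealCLM.comp ((-2 * Real.pi) • ((innerSL ℝ y).comp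
            (ContinuousLinearMap.snd ℝ X V)))).smulRight Complex.I) z := by
      have h2 : HasFDerivAt (fun z : X × V => ((-2 * Real.pi * inner ℝ y z.2 : ℝ) : ℂ) * Complex.I)
          ((Complex.ofRealCLM.comp ((-2 * Real.pi) • ((innerSL ℝ y).comp
            (ContinuousLinearMap.snd ℝ X V)))).smulRight Complex.I) z := by
        have := ((Complex.ofRealCLM.comp ((-2 * Real.pi) • ((innerSL ℝ y).comp
            (ContinuousLinearMap.snd ℝ X V)))).smulRight Complex.I).hasFDerivAt (x := z)
        convert! this using 2
      exact h2.cexp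
    have h3 : HasFDerivAt (fun z : X × V => f.slice z.1 y)
        ((fderiv ℝ f (z.1, y)).comp ((ContinuousLinearMap.inl ℝ X V).comp
          (ContinuousLinearMap.fst ℝ X V))) z := by
      have h4 : HasFDerivAt (fun z : X × V => (z.1, y))
          ((ContinuousLinearMap.inl ℝ X V).comp (ContinuousLinearMap.fst ℝ X V)) z := by
        have := (hasFDerivAt_fst (𝕜 := ℝ) (p := z)).prodMk (hasFDerivAt_const y z)
        convert! this using 1
      exact (f.hasFDerivAt (z.1, y)).comp z h4
    convert! h1.smul h3 using 1
    refine ContinuousLinearMap.ext fun v => ?_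
    simp [hM, partialFourierDeriv_apply, innerSL_apply_apply ℝ]
    ring

lemma norm_integral_exp_smul_eq (f : 𝓢(X × V, ℂ)) (z v : X × V) :
    (∫ y, Complex.exp (↑(-2 * Real.pi * inner ℝ y z.2) * Complex.I) •
        partialFourierDeriv X V f (z.1, y)) v =
      𝓕 ((SchwartzMap.evalCLM ℝ (X × V) ℂ v (partialFourierDeriv X V f)).slice z.1) z.2 := by
  rw [ContinuousLinearMap.integral_apply]
  · simp only [fourier_coe, Real.fourier_eq']
    rfl
  · refine Integrable.mono' (((partialFourierDeriv X V f).slice z.1).integrable (μ := volume)).norm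
      ?_ (Eventually.of_forall fun y => ?_)
    · have := ((partialFourierDeriv X V f).slice z.1).continuous
      change Continuous fun y => (partialFourierDeriv X V f) (z.1, y) at this
      exact Continuous.aestronglyMeasurable (by fun_prop)
    · rw [norm_smul, Complex.norm_exp_ofReal_mul_I, one_mul]
      rfl

variable [FiniteDimensional ℝ X]

/-- In a basis of `X × V` the derivative is a finite sum of fixed linear maps applied to partial
Fourier transforms of other Schwartz functions. This closes the inductions on the order of
differentiation, both for smoothness and for decay. -/
lemma fderiv_fourier_slice (f : 𝓢(X × V, ℂ)) :
    fderiv ℝ (fun z : X × V => 𝓕 (f.slice z.1) z.2) = fun z => ∑ i,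
      (ContinuousLinearMap.smulRightL ℝ (X × V) ℂ
        (LinearMap.toContinuousLinearMap ((Module.finBasis ℝ (X × V)).coord i)))
        (𝓕 ((SchwartzMap.evalCLM ℝ (X × V) ℂ (Module.finBasis ℝ (X × V) i)
          (partialFourierDeriv X V f)).slice z.1) z.2) := by
  ext z : 1
  rw [(hasFDerivAt_fourier_slice f z).fderiv]
  refine ContinuousLinearMap.ext fun v => ?_
  set A := ∫ y, Complex.exp (↑(-2 * Real.pi * inner ℝ y z.2) * Complex.I) •
        partialFourierDeriv X V f (z.1, y) with hA
  conv_lhs => rw [← (Module.finBasis ℝ (X × V)).sum_repr v, map_sum]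
  rw [sum_apply]
  refine Finset.sum_congr rfl fun i _ => ?_
  rw [map_smul, hA, norm_integral_exp_smul_eq]
  simp

lemma contDiff_fourier_slice (l : ℕ) (f : 𝓢(X × V, ℂ)) :
    ContDiff ℝ l (fun z : X × V => 𝓕 (f.slice z.1) z.2) := by
  induction l generalizing f with
  | zero =>
    refine contDiff_zero.2 (continuous_iff_continuousAt.2 fun z => ?_)
    exact (hasFDerivAt_fourier_slice f z).continuousAt
  | succ l ih =>
    rw [Nat.cast_succ, contDiff_succ_iff_fderiv]
    refine ⟨fun z => (hasFDerivAt_fourier_slice f z).differentiableAt, by simp, ?_⟩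
    rw [fderiv_fourier_slice]
    exact ContDiff.sum fun i _ => (ContinuousLinearMap.contDiff _).comp (ih _)

lemma iteratedFDeriv_fourier_slice_decay (k l : ℕ) : ∃ (s : Finset (ℕ × ℕ)) (C : ℝ), 0 ≤ C ∧
    ∀ (f : 𝓢(X × V, ℂ)) (z : X × V),
      ‖z‖ ^ k * ‖iteratedFDeriv ℝ l (fun z : X × V => 𝓕 (f.slice z.1) z.2) z‖ ≤
        C * s.sup (schwartzSeminormFamily ℝ (X × V) ℂ) f := by
  classical
  induction l with
  | zero => simpa using fourier_slice_decay (X := X) (V := V) k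
  | succ l ih =>
    obtain ⟨s, C, hC, h⟩ := ih
    set N : Fin (Module.finrank ℝ (X × V)) → 𝓢(X × V, ℂ) →L[ℝ] 𝓢(X × V, ℂ) := fun i =>
      (SchwartzMap.evalCLM ℝ (X × V) ℂ (Module.finBasis ℝ (X × V) i)) ∘L
        (partialFourierDeriv X V) with hN
    have hb : ∀ i, ∃ (s' : Finset (ℕ × ℕ)) (C' : ℝ), 0 ≤ C' ∧ ∀ f : 𝓢(X × V, ℂ),
        s.sup (schwartzSeminormFamily ℝ (X × V) ℂ) (N i f) ≤
          C' * s'.sup (schwartzSeminormFamily ℝ (X × V) ℂ) f := by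
      intro i
      have hc : Continuous ((s.sup (schwartzSeminormFamily ℝ (X × V) ℂ)).comp
          (N i).toLinearMap) := by
        have h1 := Seminorm.continuous_finsetSup (s := s)
          fun i _ => (schwartz_withSeminorms ℝ (X × V) ℂ).continuous_seminorm i
        exact h1.comp (N i).continuous
      obtain ⟨s', C', -, h'⟩ := Seminorm.bound_of_continuous
        (schwartz_withSeminorms ℝ (X × V) ℂ) _ hc
      exact ⟨s', C', C'.2, fun u => h' u⟩
    choose s' C' hC' h' using hb
    set R := fun i : Fin (Module.finrank ℝ (X × V)) =>
      ContinuousLinearMap.smulRightL ℝ (X × V) ℂ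
        (LinearMap.toContinuousLinearMap ((Module.finBasis ℝ (X × V)).coord i)) with hR
    refine ⟨Finset.univ.biUnion s', ∑ i, ‖R i‖ * (C * C' i),
      Finset.sum_nonneg fun i _ => by have := hC' i; positivity, fun f z => ?_⟩
    rw [← norm_iteratedFDeriv_fderiv, fderiv_fourier_slice]
    have h1 : iteratedFDeriv ℝ l (fun z : X × V => ∑ i, R i (𝓕 ((N i f).slice z.1) z.2)) z =
        ∑ i, iteratedFDeriv ℝ l (R i ∘ fun z : X × V => 𝓕 ((N i f).slice z.1) z.2) z := by
      rw [iteratedFDeriv_fun_sum_apply fun i _ => ?_]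
      · rfl
      · exact ContDiff.contDiffAt ((ContinuousLinearMap.contDiff _).comp (contDiff_fourier_slice l _))
    have h2 : ∀ i, ‖iteratedFDeriv ℝ l (R i ∘ fun z : X × V => 𝓕 ((N i f).slice z.1) z.2) z‖ ≤
        ‖R i‖ * ‖iteratedFDeriv ℝ l (fun z : X × V => 𝓕 ((N i f).slice z.1) z.2) z‖ := by
      intro i
      rw [(R i).iteratedFDeriv_comp_left (contDiff_fourier_slice l _).contDiffAt le_rfl]
      exact (R i).norm_compContinuousMultilinearMap_le _
    calc _ = ‖z‖ ^ k * ‖∑ i, iteratedFDeriv ℝ l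
          (R i ∘ fun z : X × V => 𝓕 ((N i f).slice z.1) z.2) z‖ := by rw [← h1]; rfl
      _ ≤ ‖z‖ ^ k * ∑ i, ‖R i‖ *
          ‖iteratedFDeriv ℝ l (fun z : X × V => 𝓕 ((N i f).slice z.1) z.2) z‖ := by
        gcongr
        exact (norm_sum_le _ _).trans (Finset.sum_le_sum fun i _ => h2 i)
      _ = ∑ i, ‖R i‖ * (‖z‖ ^ k *
          ‖iteratedFDeriv ℝ l (fun z : X × V => 𝓕 ((N i f).slice z.1) z.2) z‖) := by
        rw [Finset.mul_sum]
        exact Finset.sum_congr rfl fun i _ => by ring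
      _ ≤ ∑ i, ‖R i‖ * (C * (C' i * (Finset.univ.biUnion s').sup
          (schwartzSeminormFamily ℝ (X × V) ℂ) f)) := by
        refine Finset.sum_le_sum fun i _ => ?_
        refine mul_le_mul_of_nonneg_left ((h (N i f) z).trans ?_) (by positivity)
        gcongr
        refine (h' i f).trans ?_
        have := hC' i
        gcongr
        exact Finset.sup_mono (f := schwartzSeminormFamily ℝ (X × V) ℂ)
          (Finset.subset_biUnion_of_mem s' (Finset.mem_univ i)) f
      _ = _ := by
        rw [Finset.sum_mul]
        exact Finset.sum_congr rfl fun i _ => by ring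

/-- The decay estimates are proved with real scalars, since `partialFourierDeriv` is given as a
real-linear map, whereas the final operator is complex-linear. -/
lemma sup_schwartzSeminormFamily_complex (s : Finset (ℕ × ℕ)) (f : 𝓢(X × V, ℂ)) :
    s.sup (schwartzSeminormFamily ℝ (X × V) ℂ) f = s.sup (schwartzSeminormFamily ℂ (X × V) ℂ) f := by
  rw [Seminorm.finset_sup_apply, Seminorm.finset_sup_apply]
  rfl

lemma slice_add (f g : 𝓢(X × V, ℂ)) (x : X) : (f + g).slice x = f.slice x + g.slice x := rfl

lemma slice_smul (c : ℂ) (f : 𝓢(X × V, ℂ)) (x : X) : (c • f).slice x = c • f.slice x := rfl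

/-- The Fourier transform of a Schwartz function in its second variable. -/
def partialFourier : 𝓢(X × V, ℂ) →L[ℂ] 𝓢(X × V, ℂ) :=
  mkCLM (fun f z => 𝓕 (f.slice z.1) z.2)
    (fun f g z => by rw [slice_add, FourierTransform.fourier_add]; rfl)
    (fun c f z => by rw [slice_smul, FourierTransform.fourier_smul]; rfl)
    (fun f => contDiff_infty.2 fun l => contDiff_fourier_slice l f)
    (fun m => by
      obtain ⟨s, C, hC, h⟩ := iteratedFDeriv_fourier_slice_decay (X := X) (V := V) m.1 m.2
      exact ⟨s, C, hC, fun f z => by rw [← sup_schwartzSeminormFamily_complex]; exact h f z⟩)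

lemma slice_partialFourier (f : 𝓢(X × V, ℂ)) (x : X) :
    (partialFourier f).slice x = 𝓕 (f.slice x) := rfl

lemma partialFourier_apply (f : 𝓢(X × V, ℂ)) (z : X × V) :
    partialFourier f z = ∫ y, Complex.exp (↑(-2 * Real.pi * inner ℝ y z.2) * Complex.I) *
      f (z.1, y) := by
  change 𝓕 (f.slice z.1) z.2 = _
  rw [fourier_coe, Real.fourier_eq']
  rfl

/-- The inverse Fourier transform of a Schwartz function in its second variable. -/
def partialFourierInv : 𝓢(X × V, ℂ) →L[ℂ] 𝓢(X × V, ℂ) :=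
  compCLMOfContinuousLinearEquiv ℂ
    ((ContinuousLinearEquiv.refl ℝ X).prodCongr (ContinuousLinearEquiv.neg ℝ)) ∘L partialFourier

lemma slice_partialFourierInv (f : 𝓢(X × V, ℂ)) (x : X) :
    (partialFourierInv f).slice x = 𝓕⁻ (f.slice x) := by
  ext y
  rw [fourierInv_coe, Real.fourierInv_eq_fourier_neg]
  rfl

lemma partialFourierInv_apply (f : 𝓢(X × V, ℂ)) (z : X × V) :
    partialFourierInv f z = ∫ y, Complex.exp (↑(2 * Real.pi * inner ℝ y z.2) * Complex.I) *
      f (z.1, y) := by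
  change partialFourier f (z.1, -z.2) = _
  rw [partialFourier_apply]
  simp

lemma ext_slice {f g : 𝓢(X × V, ℂ)} (h : ∀ x, f.slice x = g.slice x) : f = g := by
  ext z
  exact DFunLike.congr_fun (h z.1) z.2

@[simp] lemma partialFourierInv_partialFourier (f : 𝓢(X × V, ℂ)) :
    partialFourierInv (partialFourier f) = f :=
  ext_slice fun x => by rw [slice_partialFourierInv, slice_partialFourier, fourierInv_fourier_eq]

@[simp] lemma partialFourier_partialFourierInv (f : 𝓢(X × V, ℂ)) :
    partialFourier (partialFourierInv f) = f :=
  ext_slice fun x => by rw [slice_partialFourier, slice_partialFourierInv, fourier_fourierInv_eq]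

/-- Plancherel's theorem on the slices of a Schwartz function. -/
lemma lintegral_slice_fourier (u : 𝓢(V, ℂ)) : ∫⁻ y, ‖𝓕 u y‖ₑ ^ 2 = ∫⁻ y, ‖u y‖ₑ ^ 2 := by
  have h : ∀ u : 𝓢(V, ℂ), ∫⁻ y, ‖u y‖ₑ ^ 2 = ENNReal.ofReal (∫ y, ‖u y‖ ^ 2) := fun u => by
    have hi : Integrable (fun y => ‖u y‖ ^ 2) := (u.memLp 2 volume).integrable_norm_pow (by norm_num)
    rw [ofReal_integral_eq_lintegral_ofReal hi
      (Eventually.of_forall fun _ => by positivity)]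
    refine lintegral_congr fun y => ?_
    rw [ENNReal.ofReal_pow (norm_nonneg _), ofReal_norm]
  rw [h, h, integral_norm_sq_fourier]

end PartialFourier
end SchwartzMap

/-! ### Tensor products and complex conjugates of Schwartz functions -/

namespace SchwartzMap

open LineDeriv FourierTransform

section Tensor

variable {X V : Type} [NormedAddCommGroup X] [NormedSpace ℝ X]
  [NormedAddCommGroup V] [NormedSpace ℝ V]

lemma norm_iteratedFDeriv_comp_fst_le (u : 𝓢(X, ℂ)) (l : ℕ) (z : X × V) :
    ‖iteratedFDeriv ℝ l (fun z : X × V => u z.1) z‖ ≤ ‖iteratedFDeriv ℝ l u z.1‖ := by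
  change ‖iteratedFDeriv ℝ l (u ∘ ContinuousLinearMap.fst ℝ X V) z‖ ≤ _
  rw [ContinuousLinearMap.iteratedFDeriv_comp_right _ (u.smooth l) _ le_rfl]
  refine (ContinuousMultilinearMap.norm_compContinuousLinearMap_le _ _).trans ?_
  refine mul_le_of_le_one_right (norm_nonneg _) (Finset.prod_le_one (fun _ _ => norm_nonneg _)
    (fun _ _ => ContinuousLinearMap.norm_fst_le ℝ X V))

lemma norm_iteratedFDeriv_comp_snd_le (v : 𝓢(V, ℂ)) (l : ℕ) (z : X × V) :
    ‖iteratedFDeriv ℝ l (fun z : X × V => v z.2) z‖ ≤ ‖iteratedFDeriv ℝ l v z.2‖ := by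
  change ‖iteratedFDeriv ℝ l (v ∘ ContinuousLinearMap.snd ℝ X V) z‖ ≤ _
  rw [ContinuousLinearMap.iteratedFDeriv_comp_right _ (v.smooth l) _ le_rfl]
  refine (ContinuousMultilinearMap.norm_compContinuousLinearMap_le _ _).trans ?_
  refine mul_le_of_le_one_right (norm_nonneg _) (Finset.prod_le_one (fun _ _ => norm_nonneg _)
    (fun _ _ => ContinuousLinearMap.norm_snd_le ℝ X V))

/-- The tensor product `(x, y) ↦ u x * v y` of two Schwartz functions. -/
def tensor (u : 𝓢(X, ℂ)) (v : 𝓢(V, ℂ)) : 𝓢(X × V, ℂ) where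
  toFun z := u z.1 * v z.2
  smooth' := ((u.smooth ⊤).comp contDiff_fst).mul ((v.smooth ⊤).comp contDiff_snd)
  decay' k l := by
    refine ⟨∑ i ∈ Finset.range (l + 1), (l.choose i : ℝ) *
      (SchwartzMap.seminorm ℝ k i u * SchwartzMap.seminorm ℝ 0 (l - i) v +
        SchwartzMap.seminorm ℝ 0 i u * SchwartzMap.seminorm ℝ k (l - i) v), fun z => ?_⟩
    have h1 := norm_iteratedFDeriv_mul_le (𝕜 := ℝ) (N := l)
      (f := fun z : X × V => u z.1) (g := fun z : X × V => v z.2)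
      ((u.smooth l).comp contDiff_fst) ((v.smooth l).comp contDiff_snd) z (n := l) le_rfl
    refine (mul_le_mul_of_nonneg_left h1 (by positivity)).trans ?_
    rw [Finset.mul_sum]
    refine Finset.sum_le_sum fun i _ => ?_
    have e1 : ‖z‖ ^ k ≤ ‖z.1‖ ^ k + ‖z.2‖ ^ k := by
      rcases max_choice ‖z.1‖ ‖z.2‖ with h | h
      · rw [Prod.norm_def, h]; exact le_add_of_nonneg_right (by positivity)
      · rw [Prod.norm_def, h]; exact le_add_of_nonneg_left (by positivity)
    have a1 := u.le_seminorm ℝ k i z.1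
    have a2 := v.le_seminorm ℝ 0 (l - i) z.2
    have a3 := u.le_seminorm ℝ 0 i z.1
    have a4 := v.le_seminorm ℝ k (l - i) z.2
    rw [pow_zero, one_mul] at a2 a3
    calc ‖z‖ ^ k * ((l.choose i : ℝ) * ‖iteratedFDeriv ℝ i (fun z : X × V => u z.1) z‖ *
          ‖iteratedFDeriv ℝ (l - i) (fun z : X × V => v z.2) z‖)
        ≤ (‖z.1‖ ^ k + ‖z.2‖ ^ k) * ((l.choose i : ℝ) * ‖iteratedFDeriv ℝ i u z.1‖ *
          ‖iteratedFDeriv ℝ (l - i) v z.2‖) := by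
          gcongr
          · exact norm_iteratedFDeriv_comp_fst_le u i z
          · exact norm_iteratedFDeriv_comp_snd_le v (l - i) z
      _ = (l.choose i : ℝ) * ((‖z.1‖ ^ k * ‖iteratedFDeriv ℝ i u z.1‖) *
          ‖iteratedFDeriv ℝ (l - i) v z.2‖ + ‖iteratedFDeriv ℝ i u z.1‖ *
          (‖z.2‖ ^ k * ‖iteratedFDeriv ℝ (l - i) v z.2‖)) := by ring
      _ ≤ _ := by gcongr

@[simp] lemma tensor_apply (u : 𝓢(X, ℂ)) (v : 𝓢(V, ℂ)) (z : X × V) :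
    tensor u v z = u z.1 * v z.2 := rfl

/-- The complex conjugate of a Schwartz function. -/
def conj (u : 𝓢(X, ℂ)) : 𝓢(X, ℂ) :=
  postcompCLM (𝕜 := ℝ) (Complex.conjCLE : ℂ →L[ℝ] ℂ) u

@[simp] lemma conj_apply (u : 𝓢(X, ℂ)) (x : X) : conj u x = (starRingEnd ℂ) (u x) := rfl

end Tensor

end SchwartzMap

/-! ### The Wigner transform, its inverse, and Plancherel identities on phase space -/

namespace Graphene

open SchwartzMap FourierTransform

instance : (volume : Measure Phase).IsAddHaarMeasure :=
  inferInstanceAs ((volume : Measure Plane).prod (volume : Measure Plane)).IsAddHaarMeasure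

/-- A linear change of variables multiplies Lebesgue integrals by a finite constant. -/
lemma exists_lintegral_comp_equiv (L : Phase ≃L[ℝ] Phase) :
    ∃ C : ENNReal, C ≠ ⊤ ∧ ∀ f : Phase → ENNReal, ∫⁻ z, f (L z) = C * ∫⁻ z, f z := by
  refine ⟨ENNReal.ofReal |(LinearMap.det (L.toLinearEquiv : Phase →ₗ[ℝ] Phase))⁻¹|,
    ENNReal.ofReal_ne_top, fun f => ?_⟩
  have h1 := Measure.map_linearMap_addHaar_eq_smul_addHaar (volume : Measure Phase)
    (f := (L.toLinearEquiv : Phase →ₗ[ℝ] Phase)) (LinearEquiv.isUnit_det' _).ne_zero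
  have h2 := lintegral_map_equiv (μ := volume) f L.toHomeomorph.toMeasurableEquiv
  have h3 : Measure.map (L.toHomeomorph.toMeasurableEquiv) (volume : Measure Phase) =
      ENNReal.ofReal |(LinearMap.det (L.toLinearEquiv : Phase →ₗ[ℝ] Phase))⁻¹| • volume := h1
  rw [h3, lintegral_smul_measure] at h2
  exact h2.symm

/-- Exchange of the two variables. -/
def swapEquiv : Phase ≃L[ℝ] Phase := ContinuousLinearEquiv.prodComm ℝ Plane Plane

/-- The change of variables `(r, η) ↦ (r - η/2, r + η/2)`. -/
def midEquiv : Phase ≃L[ℝ] Phase :=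
  ContinuousLinearEquiv.equivOfInverse
    (((ContinuousLinearMap.fst ℝ Plane Plane) -
      (1 / 2 : ℝ) • (ContinuousLinearMap.snd ℝ Plane Plane)).prod
      ((ContinuousLinearMap.fst ℝ Plane Plane) +
      (1 / 2 : ℝ) • (ContinuousLinearMap.snd ℝ Plane Plane)))
    (((1 / 2 : ℝ) • ((ContinuousLinearMap.fst ℝ Plane Plane) +
      (ContinuousLinearMap.snd ℝ Plane Plane))).prod
      ((ContinuousLinearMap.snd ℝ Plane Plane) - (ContinuousLinearMap.fst ℝ Plane Plane)))
    (fun z => by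
      ext i <;> simp <;> ring)
    (fun z => by
      ext i <;> simp <;> ring)

@[simp] lemma midEquiv_apply (z : Phase) :
    midEquiv z = (z.1 - (1 / 2 : ℝ) • z.2, z.1 + (1 / 2 : ℝ) • z.2) := rfl

@[simp] lemma midEquiv_symm_apply (z : Phase) :
    midEquiv.symm z = ((1 / 2 : ℝ) • (z.1 + z.2), z.2 - z.1) := rfl

/-- The map is a composition of two shears, `(r, η) ↦ (r - η/2, η)` and `(x, η) ↦ (x, x + η)`, each
a translation on fibres. -/
lemma measurePreserving_midEquiv : MeasurePreserving midEquiv (volume : Measure Phase) volume := by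
  have h1 : MeasurePreserving (fun z : Phase => (z.1 - (1 / 2 : ℝ) • z.2, z.2))
      (volume : Measure Phase) volume := by
    have h : MeasurePreserving (fun z : Phase => (z.1, z.2 - (1 / 2 : ℝ) • z.1))
        (volume : Measure Phase) volume :=
      MeasurePreserving.skew_product (g := fun x y : Plane => y - (1 / 2 : ℝ) • x)
        (MeasurePreserving.id (volume : Measure Plane)) (by fun_prop)
        (Eventually.of_forall fun a => (measurePreserving_sub_right volume _).map_eq)
    exact (Measure.measurePreserving_swap.comp h).comp Measure.measurePreserving_swap
  have h2 := (measurePreserving_prod_add (volume : Measure Plane) (volume : Measure Plane)).comp h1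
  convert! h2 using 1
  funext z
  simp only [midEquiv_apply, Function.comp_apply, Prod.mk.injEq, true_and]
  module

/-- The dilation `(r, p) ↦ (r, c p)` of the momentum. -/
def scaleEquiv (c : ℝˣ) : Phase ≃L[ℝ] Phase :=
  (ContinuousLinearEquiv.refl ℝ Plane).prodCongr (ContinuousLinearEquiv.smulLeft c)

@[simp] lemma scaleEquiv_apply (c : ℝˣ) (z : Phase) : scaleEquiv c z = (z.1, (c : ℝ) • z.2) := rfl

/-- The Wigner transform `(r, p) ↦ ∫ exp(2πi η·p/c) E(r - η/2, r + η/2) dη`. -/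
def wigner (c : ℝˣ) : 𝓢(Phase, ℂ) →L[ℂ] 𝓢(Phase, ℂ) :=
  compCLMOfContinuousLinearEquiv ℂ (scaleEquiv c⁻¹) ∘L partialFourierInv ∘L
    compCLMOfContinuousLinearEquiv ℂ midEquiv

/-- The integral kernel of a Weyl operator; the inverse of the Wigner transform. -/
def weylKernel (c : ℝˣ) : 𝓢(Phase, ℂ) →L[ℂ] 𝓢(Phase, ℂ) :=
  compCLMOfContinuousLinearEquiv ℂ midEquiv.symm ∘L partialFourier ∘L
    compCLMOfContinuousLinearEquiv ℂ (scaleEquiv c)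

lemma wigner_apply (c : ℝˣ) (E : 𝓢(Phase, ℂ)) (z : Phase) :
    wigner c E z = ∫ η, Complex.exp (↑(2 * Real.pi * inner ℝ η (((c⁻¹ : ℝˣ) : ℝ) • z.2)) * Complex.I) *
      E (z.1 - (1 / 2 : ℝ) • η, z.1 + (1 / 2 : ℝ) • η) := by
  change partialFourierInv (compCLMOfContinuousLinearEquiv ℂ midEquiv E) (scaleEquiv c⁻¹ z) = _
  rw [partialFourierInv_apply]
  rfl

lemma weylKernel_apply (c : ℝˣ) (g : 𝓢(Phase, ℂ)) (z : Phase) :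
    weylKernel c g z = ∫ q, Complex.exp (↑(-2 * Real.pi * inner ℝ q (z.2 - z.1)) * Complex.I) *
      g ((1 / 2 : ℝ) • (z.1 + z.2), (c : ℝ) • q) := by
  change partialFourier (compCLMOfContinuousLinearEquiv ℂ (scaleEquiv c) g) (midEquiv.symm z) = _
  rw [partialFourier_apply]
  rfl

@[simp] lemma wigner_weylKernel (c : ℝˣ) (g : 𝓢(Phase, ℂ)) : wigner c (weylKernel c g) = g := by
  have h : compCLMOfContinuousLinearEquiv ℂ midEquiv (weylKernel c g) =
      partialFourier (compCLMOfContinuousLinearEquiv ℂ (scaleEquiv c) g) := by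
    ext z
    change partialFourier (compCLMOfContinuousLinearEquiv ℂ (scaleEquiv c) g)
      (midEquiv.symm (midEquiv z)) = _
    rw [ContinuousLinearEquiv.symm_apply_apply]
  ext z
  change partialFourierInv (compCLMOfContinuousLinearEquiv ℂ midEquiv (weylKernel c g))
    (scaleEquiv c⁻¹ z) = g z
  rw [h, partialFourierInv_partialFourier]
  simp

/-- The Fourier transform of a Schwartz function in its first variable. -/
def partialFourierFst : 𝓢(Phase, ℂ) →L[ℂ] 𝓢(Phase, ℂ) :=
  compCLMOfContinuousLinearEquiv ℂ swapEquiv ∘L partialFourier ∘L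
    compCLMOfContinuousLinearEquiv ℂ swapEquiv

lemma partialFourierFst_apply (f : 𝓢(Phase, ℂ)) (z : Phase) :
    partialFourierFst f z = ∫ x, Complex.exp (↑(-2 * Real.pi * inner ℝ x z.1) * Complex.I) *
      f (x, z.2) := by
  change partialFourier (compCLMOfContinuousLinearEquiv ℂ swapEquiv f) (swapEquiv z) = _
  rw [partialFourier_apply]
  rfl

lemma integrable_exp_mul (f : 𝓢(Phase, ℂ)) {θ : Phase → ℝ} (hθ : Continuous θ) :
    Integrable fun z => Complex.exp (↑(θ z) * Complex.I) * f z := by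
  refine Integrable.mono' (f.integrable (μ := volume)).norm ?_ (Eventually.of_forall fun z => ?_)
  · have := f.continuous
    exact Continuous.aestronglyMeasurable (by fun_prop)
  · rw [norm_mul, Complex.norm_exp_ofReal_mul_I, one_mul]

lemma partialFourierFst_partialFourier_apply (f : 𝓢(Phase, ℂ)) (z : Phase) :
    partialFourierFst (partialFourier f) z = ∫ x : Phase,
      Complex.exp (↑(-2 * Real.pi * (inner ℝ x.1 z.1 + inner ℝ x.2 z.2)) * Complex.I) * f x := by
  rw [partialFourierFst_apply]
  simp_rw [partialFourier_apply, ← integral_const_mul]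
  rw [Measure.volume_eq_prod, integral_prod _ (integrable_exp_mul f (by fun_prop))]
  refine integral_congr_ae (Eventually.of_forall fun x => integral_congr_ae
    (Eventually.of_forall fun y => ?_))
  simp only [← mul_assoc, ← Complex.exp_add]
  congr 2
  push_cast
  ring

lemma partialFourier_partialFourierFst_apply (f : 𝓢(Phase, ℂ)) (z : Phase) :
    partialFourier (partialFourierFst f) z = ∫ x : Phase,
      Complex.exp (↑(-2 * Real.pi * (inner ℝ x.1 z.1 + inner ℝ x.2 z.2)) * Complex.I) * f x := by
  rw [partialFourier_apply]
  simp_rw [partialFourierFst_apply, ← integral_const_mul]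
  rw [Measure.volume_eq_prod, integral_prod_symm _ (integrable_exp_mul f (by fun_prop))]
  refine integral_congr_ae (Eventually.of_forall fun x => integral_congr_ae
    (Eventually.of_forall fun y => ?_))
  simp only [← mul_assoc, ← Complex.exp_add]
  congr 2
  push_cast
  ring

lemma partialFourierFst_partialFourier (f : 𝓢(Phase, ℂ)) :
    partialFourierFst (partialFourier f) = partialFourier (partialFourierFst f) := by
  ext z
  rw [partialFourierFst_partialFourier_apply, partialFourier_partialFourierFst_apply]

/-- The change of variables that relates the Wigner transforms of a kernel and of its Fourier
transform. -/
def fourierMidEquiv (c : ℝˣ) : Phase ≃L[ℝ] Phase :=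
  ContinuousLinearEquiv.equivOfInverse
    (((1 / 2 : ℝ) • (ContinuousLinearMap.fst ℝ Plane Plane) +
      ((c⁻¹ : ℝˣ) : ℝ) • (ContinuousLinearMap.snd ℝ Plane Plane)).prod
      ((1 / 2 : ℝ) • (ContinuousLinearMap.fst ℝ Plane Plane) -
      ((c⁻¹ : ℝˣ) : ℝ) • (ContinuousLinearMap.snd ℝ Plane Plane)))
    (((ContinuousLinearMap.fst ℝ Plane Plane) +
      (ContinuousLinearMap.snd ℝ Plane Plane)).prod
      ((c / 2 : ℝ) • ((ContinuousLinearMap.fst ℝ Plane Plane) -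
        (ContinuousLinearMap.snd ℝ Plane Plane))))
    (fun z => by
      have := c.ne_zero
      ext i
      · simp; ring
      · simp; field_simp; ring)
    (fun z => by
      have := c.ne_zero
      ext i
      · simp; field_simp; ring
      · simp; field_simp; ring)

lemma fourierMidEquiv_apply (c : ℝˣ) (z : Phase) : fourierMidEquiv c z =
    ((1 / 2 : ℝ) • z.1 + ((c⁻¹ : ℝˣ) : ℝ) • z.2, (1 / 2 : ℝ) • z.1 - ((c⁻¹ : ℝˣ) : ℝ) • z.2) := rfl

lemma fourierMidEquiv_symm_snd (c : ℝˣ) (z : Phase) :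
    ((fourierMidEquiv c).symm z).2 = (c / 2 : ℝ) • (z.1 - z.2) := rfl

/-- Fourier transforming the Wigner transform in position gives the full Fourier transform of the
kernel, up to a linear change of variables. In these variables the momentum is a multiple of a
difference of frequencies, which makes momentum weights tractable. -/
lemma partialFourierFst_wigner (c : ℝˣ) (E : 𝓢(Phase, ℂ)) (z : Phase) :
    partialFourierFst (wigner c E) z =
      partialFourierFst (partialFourier E) (fourierMidEquiv c z) := by
  rw [partialFourierFst_partialFourier_apply, partialFourierFst_apply]
  simp_rw [wigner_apply, ← integral_const_mul]
  rw [← measurePreserving_midEquiv.integral_comp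
    midEquiv.toHomeomorph.toMeasurableEquiv.measurableEmbedding]
  rw [Measure.volume_eq_prod, integral_prod]
  · refine integral_congr_ae (Eventually.of_forall fun x => integral_congr_ae
      (Eventually.of_forall fun y => ?_))
    simp only [← mul_assoc, ← Complex.exp_add, midEquiv_apply, fourierMidEquiv_apply]
    congr 2
    simp only [inner_add_left, inner_sub_left, inner_add_right, inner_sub_right, inner_smul_left,
      inner_smul_right]
    push_cast
    simp
    ring
  · exact integrable_exp_mul (compCLMOfContinuousLinearEquiv ℂ midEquiv E)
      (θ := fun x => -2 * Real.pi * (inner ℝ (midEquiv x).1 (fourierMidEquiv c z).1 +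
        inner ℝ (midEquiv x).2 (fourierMidEquiv c z).2)) (by simp only [midEquiv_apply]; fun_prop)

/-- Plancherel's theorem for a partial Fourier transform, with a weight in the other variable. -/
lemma lintegral_weight_partialFourier {w : Plane → ENNReal} (hw : Measurable w) (f : 𝓢(Phase, ℂ)) :
    ∫⁻ z : Phase, w z.1 * ‖partialFourier f z‖ₑ ^ 2 = ∫⁻ z : Phase, w z.1 * ‖f z‖ₑ ^ 2 := by
  have hm : ∀ f : 𝓢(Phase, ℂ), ∫⁻ z : Phase, w z.1 * ‖f z‖ₑ ^ 2 =
      ∫⁻ x, w x * ∫⁻ y, ‖f.slice x y‖ₑ ^ 2 := fun f => by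
    have hf := f.continuous
    rw [Measure.volume_eq_prod, lintegral_prod _ (by fun_prop)]
    refine lintegral_congr fun x => ?_
    have hfx := (f.slice x).continuous
    change ∫⁻ y, w x * ‖f.slice x y‖ₑ ^ 2 = _
    rw [lintegral_const_mul _ (by fun_prop)]
  rw [hm, hm]
  refine lintegral_congr fun x => ?_
  rw [slice_partialFourier, lintegral_slice_fourier]

lemma lintegral_weight_partialFourierInv {w : Plane → ENNReal} (hw : Measurable w)
    (f : 𝓢(Phase, ℂ)) :
    ∫⁻ z : Phase, w z.1 * ‖partialFourierInv f z‖ₑ ^ 2 = ∫⁻ z : Phase, w z.1 * ‖f z‖ₑ ^ 2 := by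
  rw [← lintegral_weight_partialFourier hw, partialFourier_partialFourierInv]

lemma lintegral_swap (f : Phase → ENNReal) : ∫⁻ z, f (swapEquiv z) = ∫⁻ z, f z :=
  (Measure.measurePreserving_swap (μ := (volume : Measure Plane))
    (ν := (volume : Measure Plane))).lintegral_comp_emb
    swapEquiv.toHomeomorph.toMeasurableEquiv.measurableEmbedding f

lemma lintegral_weight_partialFourierFst {w : Plane → ENNReal} (hw : Measurable w)
    (f : 𝓢(Phase, ℂ)) :
    ∫⁻ z : Phase, w z.2 * ‖partialFourierFst f z‖ₑ ^ 2 = ∫⁻ z : Phase, w z.2 * ‖f z‖ₑ ^ 2 := by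
  rw [← lintegral_swap fun z : Phase => w z.2 * ‖f z‖ₑ ^ 2]
  have := lintegral_weight_partialFourier hw (compCLMOfContinuousLinearEquiv ℂ swapEquiv f)
  rw [← lintegral_swap] at this
  exact this

end Graphene

/-! ### Weighted `L²` bounds for the Wigner transform and weak convergence -/

namespace Graphene

open SchwartzMap FourierTransform

lemma enorm_pow_le_of_norm_le {a b d : Plane} {M : ℝ} (hM : 0 ≤ M)
    (h : ‖a‖ ≤ M * (‖b‖ + ‖d‖)) (n : ℕ) :
    ‖a‖ₑ ^ n ≤ ENNReal.ofReal ((2 * M) ^ n) * (‖b‖ₑ ^ n + ‖d‖ₑ ^ n) := by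
  have h1 : ‖a‖ ^ n ≤ (2 * M) ^ n * (‖b‖ ^ n + ‖d‖ ^ n) := by
    have h2 : ‖b‖ + ‖d‖ ≤ 2 * max ‖b‖ ‖d‖ := by
      rw [two_mul]; exact add_le_add (le_max_left _ _) (le_max_right _ _)
    have h3 : max ‖b‖ ‖d‖ ^ n ≤ ‖b‖ ^ n + ‖d‖ ^ n := by
      rcases max_choice ‖b‖ ‖d‖ with h | h <;> rw [h]
      · exact le_add_of_nonneg_right (by positivity)
      · exact le_add_of_nonneg_left (by positivity)
    calc ‖a‖ ^ n ≤ (M * (2 * max ‖b‖ ‖d‖)) ^ n := by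
          gcongr
          exact h.trans (by gcongr)
      _ = (2 * M) ^ n * max ‖b‖ ‖d‖ ^ n := by rw [← mul_pow]; ring
      _ ≤ _ := by gcongr
  have := ENNReal.ofReal_le_ofReal h1
  rwa [ENNReal.ofReal_mul (by positivity), ENNReal.ofReal_add (by positivity) (by positivity),
    ENNReal.ofReal_pow (norm_nonneg _), ENNReal.ofReal_pow (norm_nonneg b),
    ENNReal.ofReal_pow (norm_nonneg d), ofReal_norm, ofReal_norm, ofReal_norm] at this

/-- A position weight is constant along the Fourier variable, so Plancherel on each slice removes
the transform; then `r = (x + y)/2` is bounded by the two kernel variables. -/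
lemma exists_lintegral_fst_wigner_le (c : ℝˣ) (n : ℕ) : ∃ C : ENNReal, C ≠ ⊤ ∧
    ∀ E : 𝓢(Phase, ℂ), ∫⁻ z : Phase, ‖z.1‖ₑ ^ n * ‖wigner c E z‖ₑ ^ 2 ≤
      C * ((∫⁻ z : Phase, ‖z.1‖ₑ ^ n * ‖E z‖ₑ ^ 2) + ∫⁻ z : Phase, ‖z.2‖ₑ ^ n * ‖E z‖ₑ ^ 2) := by
  obtain ⟨C₁, hC₁, h₁⟩ := exists_lintegral_comp_equiv (scaleEquiv c⁻¹)
  refine ⟨C₁ * ENNReal.ofReal ((2 * (1 / 2)) ^ n),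
    ENNReal.mul_ne_top hC₁ ENNReal.ofReal_ne_top, fun E => ?_⟩
  have hE := E.continuous
  calc ∫⁻ z : Phase, ‖z.1‖ₑ ^ n * ‖wigner c E z‖ₑ ^ 2
      = C₁ * ∫⁻ z : Phase, ‖z.1‖ₑ ^ n *
        ‖partialFourierInv (compCLMOfContinuousLinearEquiv ℂ midEquiv E) z‖ₑ ^ 2 :=
        h₁ fun z => ‖z.1‖ₑ ^ n *
          ‖partialFourierInv (compCLMOfContinuousLinearEquiv ℂ midEquiv E) z‖ₑ ^ 2
    _ = C₁ * ∫⁻ z : Phase, ‖z.1‖ₑ ^ n * ‖E (midEquiv z)‖ₑ ^ 2 := by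
        rw [lintegral_weight_partialFourierInv (w := fun x => ‖x‖ₑ ^ n) (by fun_prop)]
        rfl
    _ = C₁ * ∫⁻ z : Phase, ‖(midEquiv.symm z).1‖ₑ ^ n * ‖E z‖ₑ ^ 2 := by
        have := measurePreserving_midEquiv.lintegral_comp_emb
          midEquiv.toHomeomorph.toMeasurableEquiv.measurableEmbedding
          (fun z : Phase => ‖(midEquiv.symm z).1‖ₑ ^ n * ‖E z‖ₑ ^ 2)
        simp only [ContinuousLinearEquiv.symm_apply_apply] at this
        rw [this]
    _ ≤ C₁ * ∫⁻ z : Phase, ENNReal.ofReal ((2 * (1 / 2)) ^ n) *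
        (‖z.1‖ₑ ^ n * ‖E z‖ₑ ^ 2 + ‖z.2‖ₑ ^ n * ‖E z‖ₑ ^ 2) := by
        refine mul_le_mul_right (lintegral_mono fun z => ?_) _
        rw [← add_mul, ← mul_assoc]
        refine mul_le_mul_left ?_ _
        refine enorm_pow_le_of_norm_le (by norm_num) ?_ n
        rw [midEquiv_symm_apply, norm_smul]
        norm_num
        exact norm_add_le _ _
    _ = _ := by
        rw [lintegral_const_mul _ (by fun_prop), lintegral_add_left (by fun_prop), mul_assoc]

/-- After a Fourier transform in position the momentum equals `c/2` times the difference of the two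
frequencies of the kernel. In each resulting term, Plancherel in the unweighted variable undoes one
of the two Fourier transforms, leaving a single partial transform. -/
lemma exists_lintegral_snd_wigner_le (c : ℝˣ) (n : ℕ) : ∃ C : ENNReal, C ≠ ⊤ ∧
    ∀ E : 𝓢(Phase, ℂ), ∫⁻ z : Phase, ‖z.2‖ₑ ^ n * ‖wigner c E z‖ₑ ^ 2 ≤
      C * ((∫⁻ z : Phase, ‖z.1‖ₑ ^ n * ‖partialFourierFst E z‖ₑ ^ 2) +
        ∫⁻ z : Phase, ‖z.2‖ₑ ^ n * ‖partialFourier E z‖ₑ ^ 2) := by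
  obtain ⟨C₁, hC₁, h₁⟩ := exists_lintegral_comp_equiv (fourierMidEquiv c)
  refine ⟨C₁ * ENNReal.ofReal ((2 * |(c : ℝ) / 2|) ^ n),
    ENNReal.mul_ne_top hC₁ ENNReal.ofReal_ne_top, fun E => ?_⟩
  set F := partialFourierFst (partialFourier E) with hF
  have hFc := F.continuous
  calc ∫⁻ z : Phase, ‖z.2‖ₑ ^ n * ‖wigner c E z‖ₑ ^ 2
      = ∫⁻ z : Phase, ‖z.2‖ₑ ^ n * ‖F (fourierMidEquiv c z)‖ₑ ^ 2 := by
        rw [← lintegral_weight_partialFourierFst (w := fun x => ‖x‖ₑ ^ n) (by fun_prop)]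
        simp only [partialFourierFst_wigner, hF]
    _ = C₁ * ∫⁻ z : Phase, ‖((fourierMidEquiv c).symm z).2‖ₑ ^ n * ‖F z‖ₑ ^ 2 := by
        rw [← h₁]
        simp only [ContinuousLinearEquiv.symm_apply_apply]
    _ ≤ C₁ * ∫⁻ z : Phase, ENNReal.ofReal ((2 * |(c : ℝ) / 2|) ^ n) *
        (‖z.1‖ₑ ^ n * ‖F z‖ₑ ^ 2 + ‖z.2‖ₑ ^ n * ‖F z‖ₑ ^ 2) := by
        refine mul_le_mul_right (lintegral_mono fun z => ?_) _
        rw [← add_mul, ← mul_assoc]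
        refine mul_le_mul_left ?_ _
        refine enorm_pow_le_of_norm_le (abs_nonneg _) ?_ n
        rw [fourierMidEquiv_symm_snd, norm_smul, Real.norm_eq_abs]
        gcongr
        exact norm_sub_le _ _
    _ = C₁ * ENNReal.ofReal ((2 * |(c : ℝ) / 2|) ^ n) *
        ((∫⁻ z : Phase, ‖z.1‖ₑ ^ n * ‖F z‖ₑ ^ 2) + ∫⁻ z : Phase, ‖z.2‖ₑ ^ n * ‖F z‖ₑ ^ 2) := by
        rw [lintegral_const_mul _ (by fun_prop), lintegral_add_left (by fun_prop), mul_assoc]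
    _ = _ := by
        rw [hF, lintegral_weight_partialFourierFst (w := fun x => ‖x‖ₑ ^ n) (by fun_prop),
          partialFourierFst_partialFourier,
          lintegral_weight_partialFourier (w := fun x => ‖x‖ₑ ^ n) (by fun_prop)]

/-- A function of polynomial growth. -/
def PolyBounded {E F : Type*} [NormedAddCommGroup E] [NormedAddCommGroup F] (a : E → F) : Prop :=
  ∃ (C : ℝ) (k : ℕ), 0 ≤ C ∧ ∀ z, ‖a z‖ ≤ C * (1 + ‖z‖) ^ k

lemma exists_norm_mul_le {E F : Type} [NormedAddCommGroup E] [NormedSpace ℝ E]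
    [NormedAddCommGroup F] [NormedSpace ℝ F] (u : 𝓢(E, F)) (k : ℕ) (z : E) :
    (1 + ‖z‖) ^ k * ‖u z‖ ≤
      2 ^ k * (SchwartzMap.seminorm ℝ 0 0 u + SchwartzMap.seminorm ℝ k 0 u) := by
  have h := u.norm_le_one_add_rpow k z (norm_nonneg z) le_rfl
  have h1 : (0 : ℝ) < 1 + ‖z‖ := by positivity
  calc (1 + ‖z‖) ^ k * ‖u z‖ ≤ (1 + ‖z‖) ^ k * (2 ^ k *
        (SchwartzMap.seminorm ℝ 0 0 u + SchwartzMap.seminorm ℝ k 0 u) *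
        (1 + ‖z‖) ^ (-(k : ℝ))) := by gcongr
    _ = 2 ^ k * (SchwartzMap.seminorm ℝ 0 0 u + SchwartzMap.seminorm ℝ k 0 u) *
        ((1 + ‖z‖) ^ k * (1 + ‖z‖) ^ (-(k : ℝ))) := by ring
    _ = _ := by
      rw [Real.rpow_neg h1.le, Real.rpow_natCast, mul_inv_cancel₀ (by positivity), mul_one]

/-- The product of a measurable function of polynomial growth and a Schwartz function is
integrable. -/
lemma integrable_mul_schwartz {E : Type} [NormedAddCommGroup E] [NormedSpace ℝ E]
    [MeasurableSpace E] [BorelSpace E] [SecondCountableTopology E]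
    {μ : Measure E} [μ.HasTemperateGrowth] {a : E → ℂ} (ha : AEStronglyMeasurable a μ)
    (hb : PolyBounded a) (u : 𝓢(E, ℂ)) : Integrable (fun z => a z * u z) μ := by
  obtain ⟨C, k, hC, h⟩ := hb
  set l := μ.integrablePower
  refine Integrable.mono' ((Measure.integrable_pow_neg_integrablePower μ).const_mul
    (C * (2 ^ (k + l) * (SchwartzMap.seminorm ℝ 0 0 u + SchwartzMap.seminorm ℝ (k + l) 0 u))))
    (ha.mul u.continuous.aestronglyMeasurable) (Eventually.of_forall fun z => ?_)
  have h1 : (0 : ℝ) < 1 + ‖z‖ := by positivity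
  have h2 := exists_norm_mul_le u (k + l) z
  rw [norm_mul, Real.rpow_neg h1.le, Real.rpow_natCast, ← div_eq_mul_inv,
    le_div_iff₀ (by positivity)]
  calc ‖a z‖ * ‖u z‖ * (1 + ‖z‖) ^ l ≤ C * (1 + ‖z‖) ^ k * ‖u z‖ * (1 + ‖z‖) ^ l := by
        gcongr; exact h z
    _ = C * ((1 + ‖z‖) ^ (k + l) * ‖u z‖) := by rw [pow_add]; ring
    _ ≤ _ := by gcongr

/-- Cauchy-Schwarz, with a power weight whose inverse is square-integrable. Pairing with a function
of polynomial growth thus needs only weighted `L²` convergence, which is available for eigenfunction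
expansions, and no convergence of derivatives. -/
lemma tendsto_integral_mul_of_tendsto_weights {ι : Type*} {l : Filter ι} {u : ι → 𝓢(Phase, ℂ)}
    (h1 : ∀ n : ℕ, Tendsto (fun i => ∫⁻ z : Phase, ‖z.1‖ₑ ^ n * ‖u i z‖ₑ ^ 2) l (𝓝 0))
    (h2 : ∀ n : ℕ, Tendsto (fun i => ∫⁻ z : Phase, ‖z.2‖ₑ ^ n * ‖u i z‖ₑ ^ 2) l (𝓝 0))
    {a : Phase → ℂ} (ha : Measurable a) (hb : PolyBounded a) :
    Tendsto (fun i => ∫ z, a z * u i z) l (𝓝 0) := by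
  obtain ⟨C, k, hC, hCk⟩ := hb
  set N := (volume : Measure Phase).integrablePower with hN
  -- weight `b` with `b⁻²` integrable and `b * a` of polynomial growth
  have hw : ∀ n : ℕ, Tendsto (fun i => ∫⁻ z : Phase, ENNReal.ofReal ((1 + ‖z‖) ^ n) * ‖u i z‖ₑ ^ 2)
      l (𝓝 0) := by
    intro n
    have hle : ∀ i, ∫⁻ z : Phase, ENNReal.ofReal ((1 + ‖z‖) ^ n) * ‖u i z‖ₑ ^ 2 ≤
        ENNReal.ofReal (2 ^ n) * ((∫⁻ z : Phase, ‖z.1‖ₑ ^ 0 * ‖u i z‖ₑ ^ 2) +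
          ((∫⁻ z : Phase, ‖z.1‖ₑ ^ n * ‖u i z‖ₑ ^ 2) + ∫⁻ z : Phase, ‖z.2‖ₑ ^ n * ‖u i z‖ₑ ^ 2)) := by
      intro i
      have hu := (u i).continuous
      rw [← lintegral_add_left (by fun_prop), ← lintegral_add_left (by fun_prop),
        ← lintegral_const_mul _ (by fun_prop)]
      refine lintegral_mono fun z => ?_
      rw [← add_mul, ← add_mul, ← mul_assoc]
      gcongr
      have h3 : (1 + ‖z‖) ^ n ≤ 2 ^ n * (‖z.1‖ ^ 0 + (‖z.1‖ ^ n + ‖z.2‖ ^ n)) := by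
        have e1 : ‖z‖ ^ n ≤ ‖z.1‖ ^ n + ‖z.2‖ ^ n := by
          rcases max_choice ‖z.1‖ ‖z.2‖ with h | h
          · rw [Prod.norm_def, h]; exact le_add_of_nonneg_right (by positivity)
          · rw [Prod.norm_def, h]; exact le_add_of_nonneg_left (by positivity)
        have e2 : 1 + ‖z‖ ≤ 2 * max 1 ‖z‖ := by
          rw [two_mul]; exact add_le_add (le_max_left _ _) (le_max_right _ _)
        have e3 : max 1 ‖z‖ ^ n ≤ 1 + ‖z‖ ^ n := by
          rcases max_choice 1 ‖z‖ with h | h <;> rw [h]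
          · simp
          · exact le_add_of_nonneg_left (by positivity)
        calc (1 + ‖z‖) ^ n ≤ (2 * max 1 ‖z‖) ^ n := by gcongr
          _ = 2 ^ n * max 1 ‖z‖ ^ n := mul_pow _ _ _
          _ ≤ 2 ^ n * (‖z.1‖ ^ 0 + (‖z.1‖ ^ n + ‖z.2‖ ^ n)) := by
            gcongr
            rw [pow_zero]
            linarith
      refine (ENNReal.ofReal_le_ofReal h3).trans (le_of_eq ?_)
      rw [ENNReal.ofReal_mul (by positivity), ENNReal.ofReal_add (by positivity) (by positivity),
        ENNReal.ofReal_add (by positivity) (by positivity),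
        ENNReal.ofReal_pow (norm_nonneg _), ENNReal.ofReal_pow (norm_nonneg z.1),
        ENNReal.ofReal_pow (norm_nonneg z.2), ofReal_norm, ofReal_norm]
    have hlim := ENNReal.Tendsto.const_mul (a := ENNReal.ofReal (2 ^ n))
      ((h1 0).add ((h1 n).add (h2 n))) (Or.inr ENNReal.ofReal_ne_top)
    simp only [add_zero, mul_zero] at hlim
    exact tendsto_of_tendsto_of_tendsto_of_le_of_le tendsto_const_nhds hlim
      (fun _ => zero_le) hle
  have hint : ∫⁻ z : Phase, ENNReal.ofReal ((1 + ‖z‖) ^ (-(N : ℝ))) ≠ ⊤ := by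
    have := (Measure.integrable_pow_neg_integrablePower (volume : Measure Phase))
    exact this.lintegral_lt_top.ne
  set D := ∫⁻ z : Phase, ENNReal.ofReal ((1 + ‖z‖) ^ (-(N : ℝ))) with hD
  have hbound : ∀ i, ‖∫ z, a z * u i z‖ₑ ≤ D ^ (1 / 2 : ℝ) * (ENNReal.ofReal (C ^ 2) *
      ∫⁻ z : Phase, ENNReal.ofReal ((1 + ‖z‖) ^ (2 * k + N)) * ‖u i z‖ₑ ^ 2) ^ (1 / 2 : ℝ) := by
    intro i
    have hu := (u i).continuous
    refine (enorm_integral_le_lintegral_enorm _).trans ?_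
    set b : Phase → ENNReal := fun z => ENNReal.ofReal ((1 + ‖z‖) ^ (-(N : ℝ) / 2)) with hb
    set d : Phase → ENNReal := fun z => ENNReal.ofReal ((1 + ‖z‖) ^ ((N : ℝ) / 2)) * ‖a z * u i z‖ₑ
      with hd
    have e1 : ∀ z, ‖a z * u i z‖ₑ = (b * d) z := by
      intro z
      have h1 : (0 : ℝ) < 1 + ‖z‖ := by positivity
      simp only [hb, hd, Pi.mul_apply]
      rw [← mul_assoc, ← ENNReal.ofReal_mul (by positivity), ← Real.rpow_add h1]
      norm_num [neg_div]
    simp_rw [e1]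
    refine (ENNReal.lintegral_mul_le_Lp_mul_Lq volume Real.HolderConjugate.two_two
      (f := b) (g := d) (by fun_prop) (by fun_prop)).trans ?_
    refine mul_le_mul' (ENNReal.rpow_le_rpow (lintegral_mono fun z => ?_) (by norm_num))
      (ENNReal.rpow_le_rpow ?_ (by norm_num))
    · simp only [hb]
      have h1 : (0 : ℝ) < 1 + ‖z‖ := by positivity
      rw [ENNReal.ofReal_rpow_of_nonneg (by positivity) (by norm_num), ← Real.rpow_mul h1.le]
      norm_num
    · rw [← lintegral_const_mul _ (by fun_prop)]
      refine lintegral_mono fun z => ?_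
      have h1 : (0 : ℝ) < 1 + ‖z‖ := by positivity
      simp only [hd]
      rw [ENNReal.mul_rpow_of_nonneg _ _ (by norm_num), enorm_mul,
        ENNReal.mul_rpow_of_nonneg _ _ (by norm_num),
        ENNReal.ofReal_rpow_of_nonneg (by positivity) (by norm_num), ← Real.rpow_mul h1.le]
      simp only [ENNReal.rpow_ofNat]
      have h3 : ‖a z‖ₑ ^ 2 ≤ ENNReal.ofReal (C ^ 2 * (1 + ‖z‖) ^ (2 * k)) := by
        rw [← ofReal_norm, ← ENNReal.ofReal_pow (norm_nonneg _)]
        refine ENNReal.ofReal_le_ofReal ?_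
        calc ‖a z‖ ^ 2 ≤ (C * (1 + ‖z‖) ^ k) ^ 2 := by gcongr; exact hCk z
          _ = _ := by ring
      calc ENNReal.ofReal ((1 + ‖z‖) ^ ((N : ℝ) / 2 * 2)) * (‖a z‖ₑ ^ 2 * ‖u i z‖ₑ ^ 2)
          ≤ ENNReal.ofReal ((1 + ‖z‖) ^ ((N : ℝ) / 2 * 2)) *
            (ENNReal.ofReal (C ^ 2 * (1 + ‖z‖) ^ (2 * k)) * ‖u i z‖ₑ ^ 2) := by gcongr
        _ = _ := by
          rw [div_mul_cancel₀ _ (by norm_num), Real.rpow_natCast,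
            ENNReal.ofReal_mul (by positivity), pow_add, mul_comm ((1 + ‖z‖) ^ (2 * k)),
            ENNReal.ofReal_mul (by positivity)]
          ring
  rw [tendsto_zero_iff_enorm_tendsto_zero]
  have hlim : Tendsto (fun i => D ^ (1 / 2 : ℝ) * (ENNReal.ofReal (C ^ 2) *
      ∫⁻ z : Phase, ENNReal.ofReal ((1 + ‖z‖) ^ (2 * k + N)) * ‖u i z‖ₑ ^ 2) ^ (1 / 2 : ℝ))
      l (𝓝 0) := by
    have e1 := ENNReal.Tendsto.const_mul (a := ENNReal.ofReal (C ^ 2)) (hw (2 * k + N))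
      (Or.inr ENNReal.ofReal_ne_top)
    have e2 := e1.ennrpow_const (1 / 2 : ℝ)
    have e3 := ENNReal.Tendsto.const_mul (a := D ^ (1 / 2 : ℝ)) e2
      (Or.inr (ENNReal.rpow_ne_top_of_nonneg (by norm_num) hint))
    simpa using e3
  exact tendsto_of_tendsto_of_tendsto_of_le_of_le tendsto_const_nhds hlim
    (fun _ => zero_le) hbound

end Graphene

/-! ### Weyl quantization of scalar symbols -/

namespace Graphene

open SchwartzMap FourierTransform

lemma PolyBounded.of_comp_le {E F G : Type*} [NormedAddCommGroup E] [NormedAddCommGroup F]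
    [NormedAddCommGroup G] {a : E → F} (ha : PolyBounded a) {f : G → E} {M : ℝ}
    (hf : ∀ z, 1 + ‖f z‖ ≤ M * (1 + ‖z‖)) : PolyBounded (fun z => a (f z)) := by
  obtain ⟨C, k, hC, h⟩ := ha
  have hM : 0 ≤ M := by
    have := hf 0
    rw [norm_zero, add_zero, mul_one] at this
    exact (by positivity : (0 : ℝ) ≤ 1 + ‖f 0‖).trans this
  refine ⟨C * M ^ k, k, by positivity, fun z => (h _).trans ?_⟩
  rw [mul_assoc, ← mul_pow]
  gcongr
  exact hf z

lemma PolyBounded.add {E F : Type*} [NormedAddCommGroup E] [NormedAddCommGroup F]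
    {a b : E → F} (ha : PolyBounded a) (hb : PolyBounded b) : PolyBounded (fun z => a z + b z) := by
  obtain ⟨C, k, hC, h⟩ := ha
  obtain ⟨D, l, hD, h'⟩ := hb
  refine ⟨C + D, max k l, by positivity, fun z => (norm_add_le _ _).trans ?_⟩
  have h1 : 1 ≤ 1 + ‖z‖ := by simp
  rw [add_mul]
  gcongr
  · exact (h z).trans (by gcongr; exact le_max_left _ _)
  · exact (h' z).trans (by gcongr; exact le_max_right _ _)

lemma PolyBounded.mul {E : Type*} [NormedAddCommGroup E]
    {a b : E → ℂ} (ha : PolyBounded a) (hb : PolyBounded b) : PolyBounded (fun z => a z * b z) := by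
  obtain ⟨C, k, hC, h⟩ := ha
  obtain ⟨D, l, hD, h'⟩ := hb
  refine ⟨C * D, k + l, by positivity, fun z => ?_⟩
  rw [norm_mul]
  calc ‖a z‖ * ‖b z‖ ≤ (C * (1 + ‖z‖) ^ k) * (D * (1 + ‖z‖) ^ l) := by
        gcongr
        exacts [h z, h' z]
    _ = _ := by ring

lemma PolyBounded.mul_of_norm_eq {E : Type*} [NormedAddCommGroup E]
    {a b : E → ℂ} (ha : PolyBounded a) (hb : ∀ z, ‖b z‖ ≤ 1) : PolyBounded (fun z => b z * a z) := by
  obtain ⟨C, k, hC, h⟩ := ha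
  refine ⟨C, k, hC, fun z => ?_⟩
  rw [norm_mul]
  exact (mul_le_of_le_one_left (norm_nonneg _) (hb z)).trans (h z)

lemma polyBounded_schwartz (g : 𝓢(Phase, ℂ)) : PolyBounded g :=
  ⟨SchwartzMap.seminorm ℝ 0 0 g, 0, by positivity, fun z => by
    simpa using g.norm_le_seminorm ℝ z⟩

/-- The inner integral of the Weyl quantization of a scalar symbol. -/
def weylInner (ε : ℝ) (a : Phase → ℂ) (u : Plane → ℂ) (x p : Plane) : ℂ :=
  ∫ y, Complex.exp (Complex.I * (inner ℝ (x - y) p / ε : ℝ)) * (a ((1 / 2 : ℝ) • (x + y), p) * u y)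

lemma norm_exp_I_mul (r : ℝ) : ‖Complex.exp (Complex.I * r)‖ = 1 := by
  rw [mul_comm]; exact Complex.norm_exp_ofReal_mul_I r

lemma integrable_weylIntegrand (ε : ℝ) {a : Phase → ℂ} (ha : Measurable a) (hb : PolyBounded a)
    (u : 𝓢(Plane, ℂ)) (x p : Plane) :
    Integrable fun y => Complex.exp (Complex.I * (inner ℝ (x - y) p / ε : ℝ)) *
      (a ((1 / 2 : ℝ) • (x + y), p) * u y) := by
  simp_rw [← mul_assoc]
  refine integrable_mul_schwartz (Measurable.aestronglyMeasurable (by fun_prop))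
    (PolyBounded.mul_of_norm_eq (hb.of_comp_le (M := 1 + ‖x‖ + ‖p‖) fun y => ?_)
      fun y => (norm_exp_I_mul _).le) u
  have h1 : ‖((1 / 2 : ℝ) • (x + y), p)‖ ≤ ‖x‖ + ‖y‖ + ‖p‖ := by
    refine max_le ?_ ?_
    · rw [norm_smul]
      norm_num
      have := norm_add_le x y
      have := norm_nonneg p
      have := norm_nonneg (x + y)
      linarith
    · change ‖p‖ ≤ _
      have := norm_nonneg x
      have := norm_nonneg y
      linarith
  nlinarith [norm_nonneg x, norm_nonneg y, norm_nonneg p, mul_nonneg (norm_nonneg x) (norm_nonneg y),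
    mul_nonneg (norm_nonneg p) (norm_nonneg y)]

/-- The scalar symbols for which the iterated integrals of the Weyl quantization converge
absolutely on Schwartz functions. -/
structure WeylAdmissible (ε : ℝ) (a : Phase → ℂ) : Prop where
  measurable : Measurable a
  polyBounded : PolyBounded a
  integrable_inner : ∀ (u : 𝓢(Plane, ℂ)) x, Integrable (weylInner ε a u x)
  integrable_prod : ∀ u v : 𝓢(Plane, ℂ), Integrable fun z : Phase => v z.1 * weylInner ε a u z.1 z.2

lemma WeylAdmissible.weylInner_add {ε : ℝ} {a b : Phase → ℂ} (ha : WeylAdmissible ε a)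
    (hb : WeylAdmissible ε b) (u : 𝓢(Plane, ℂ)) (x p : Plane) :
    weylInner ε (fun z => a z + b z) u x p = weylInner ε a u x p + weylInner ε b u x p := by
  unfold weylInner
  rw [← integral_add (integrable_weylIntegrand ε ha.measurable ha.polyBounded u x p)
    (integrable_weylIntegrand ε hb.measurable hb.polyBounded u x p)]
  refine integral_congr_ae (Eventually.of_forall fun y => ?_)
  simp only []
  ring

lemma WeylAdmissible.add {ε : ℝ} {a b : Phase → ℂ} (ha : WeylAdmissible ε a)
    (hb : WeylAdmissible ε b) : WeylAdmissible ε (fun z => a z + b z) where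
  measurable := ha.measurable.add hb.measurable
  polyBounded := ha.polyBounded.add hb.polyBounded
  integrable_inner u x := by
    have := (ha.integrable_inner u x).add (hb.integrable_inner u x)
    refine this.congr (Eventually.of_forall fun p => ?_)
    exact (ha.weylInner_add hb u x p).symm
  integrable_prod u v := by
    refine ((ha.integrable_prod u v).add (hb.integrable_prod u v)).congr
      (Eventually.of_forall fun z => ?_)
    simp only [Pi.add_apply, ha.weylInner_add hb, mul_add]

/-- The weak form of the Weyl quantization of a scalar symbol. -/
lemma WeylAdmissible.integral_mul {ε : ℝ} {c : ℝˣ} (hc : (c : ℝ) = 2 * Real.pi * ε) {a : Phase → ℂ}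
    (ha : WeylAdmissible ε a) (u v : 𝓢(Plane, ℂ)) :
    ∫ x, v x * ∫ p, weylInner ε a u x p = ∫ z, a z * wigner c (tensor u v) z := by
  simp_rw [← integral_const_mul]
  have hsw : ∫ x, ∫ p, v x * weylInner ε a u x p = ∫ p, ∫ x, v x * weylInner ε a u x p :=
    integral_integral_swap (f := fun x p => v x * weylInner ε a u x p) (ha.integrable_prod u v)
  rw [hsw, Measure.volume_eq_prod, integral_prod_symm _ (by
    rw [← Measure.volume_eq_prod]
    exact integrable_mul_schwartz ha.measurable.aestronglyMeasurable ha.polyBounded _)]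
  refine integral_congr_ae (Eventually.of_forall fun p => ?_)
  -- The input variable comes first, `z = (y, x)`, so that `midEquiv` turns `x - y` into `η` and `(x
  -- + y)/2` into `r`; the integral then has the form of a Wigner transform.
  set H : Phase → ℂ := fun z => Complex.exp (Complex.I * (inner ℝ (z.2 - z.1) p / ε : ℝ)) *
    a ((1 / 2 : ℝ) • (z.1 + z.2), p) * tensor u v z with hH
  have hHint : Integrable H := by
    have hm := ha.measurable
    refine integrable_mul_schwartz (Measurable.aestronglyMeasurable (by fun_prop))
      (PolyBounded.mul_of_norm_eq (ha.polyBounded.of_comp_le (M := 1 + ‖p‖) fun y => ?_)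
        fun y => (norm_exp_I_mul _).le) (tensor u v)
    have h1 : ‖((1 / 2 : ℝ) • (y.1 + y.2), p)‖ ≤ ‖y‖ + ‖p‖ := by
      refine max_le ?_ ?_
      · rw [norm_smul]
        norm_num
        have := norm_add_le y.1 y.2
        have := norm_nonneg p
        have := norm_fst_le y
        have := norm_snd_le y
        linarith
      · change ‖p‖ ≤ _
        have := norm_nonneg y
        linarith
    nlinarith [norm_nonneg y, norm_nonneg p, mul_nonneg (norm_nonneg p) (norm_nonneg y)]
  have h1 : ∫ x, v x * weylInner ε a u x p = ∫ z, H z := by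
    rw [Measure.volume_eq_prod, integral_prod_symm _ hHint]
    refine integral_congr_ae (Eventually.of_forall fun x => ?_)
    simp only [weylInner, ← integral_const_mul, hH, tensor_apply]
    refine integral_congr_ae (Eventually.of_forall fun y => ?_)
    simp only [add_comm x y]
    ring
  simp only []
  have hHm : Integrable fun z => H (midEquiv z) :=
    (measurePreserving_midEquiv.integrable_comp_emb
      midEquiv.toHomeomorph.toMeasurableEquiv.measurableEmbedding).2 hHint
  rw [h1, ← measurePreserving_midEquiv.integral_comp
    midEquiv.toHomeomorph.toMeasurableEquiv.measurableEmbedding, Measure.volume_eq_prod,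
    integral_prod _ hHm]
  refine integral_congr_ae (Eventually.of_forall fun r => ?_)
  simp only [wigner_apply, ← integral_const_mul, hH, tensor_apply, midEquiv_apply]
  refine integral_congr_ae (Eventually.of_forall fun η => ?_)
  simp only []
  have e1 : (1 / 2 : ℝ) • (r - (1 / 2 : ℝ) • η + (r + (1 / 2 : ℝ) • η)) = r := by module
  have e2 : r + (1 / 2 : ℝ) • η - (r - (1 / 2 : ℝ) • η) = η := by module
  have e3 : Complex.I * ((inner ℝ η p / ε : ℝ) : ℂ) =
      ((2 * Real.pi * inner ℝ η (((c⁻¹ : ℝˣ) : ℝ) • p) : ℝ) : ℂ) * Complex.I := by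
    rw [mul_comm, inner_smul_right, Units.val_inv_eq_inv_val, hc]
    congr 2
    have := Real.pi_ne_zero
    by_cases hε : ε = 0
    · simp [hε]
    field_simp
  rw [e1, e2, e3]
  ring

/-- Products of a function of the position and of a function of the momentum. -/
lemma weylAdmissible_fst_mul_snd {ε : ℝ} {c : ℝˣ} (hc : (c : ℝ) = 2 * Real.pi * ε) {f q : Plane → ℂ}
    (hf : f.HasTemperateGrowth) (hq : Measurable q) (hqb : PolyBounded q) :
    WeylAdmissible ε (fun z => f z.1 * q z.2) := by
  have hfc : Continuous f := hf.1.continuous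
  have hfb : PolyBounded f := by
    obtain ⟨k, C, h⟩ := hf.2 0
    refine ⟨C, k, ?_, fun z => by simpa using h z⟩
    simpa using (norm_nonneg _).trans (h 0)
  have hε : ε ≠ 0 := fun h => c.ne_zero (by rw [hc, h, mul_zero])
  -- Once `f((x + y)/2)` is absorbed into the Schwartz function, the `y`-integral is `q p` times a
  -- phase times a Fourier transform. Its rapid decay in `p` tolerates any measurable `q` of
  -- polynomial growth, in particular one that is not smooth.
  have key : ∀ (w : 𝓢(Plane, ℂ)) (x p : Plane),
      ∫ y, Complex.exp (Complex.I * (inner ℝ (x - y) p / ε : ℝ)) * (q p * w y) =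
      q p * Complex.exp (Complex.I * (inner ℝ x p / ε : ℝ)) *
        ∫ y, Complex.exp (↑(-2 * Real.pi * inner ℝ y (((c⁻¹ : ℝˣ) : ℝ) • p)) * Complex.I) * w y := by
    intro w x p
    rw [← integral_const_mul]
    refine integral_congr_ae (Eventually.of_forall fun y => ?_)
    simp only []
    have : Complex.I * ((inner ℝ (x - y) p / ε : ℝ) : ℂ) =
        Complex.I * (inner ℝ x p / ε : ℝ) +
        ((-2 * Real.pi * inner ℝ y (((c⁻¹ : ℝˣ) : ℝ) • p) : ℝ) : ℂ) * Complex.I := by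
      rw [inner_smul_right, Units.val_inv_eq_inv_val, hc, mul_comm _ Complex.I, ← mul_add,
        inner_sub_left]
      congr 1
      rw [← Complex.ofReal_add]
      congr 1
      have := Real.pi_ne_zero
      field_simp
      ring
    rw [this, Complex.exp_add]
    ring
  have hnorm : ∀ x p : Plane, ‖Complex.exp (Complex.I * (inner ℝ x p / ε : ℝ))‖ ≤ 1 :=
    fun x p => (norm_exp_I_mul _).le
  refine ⟨by fun_prop, ?_, fun u x => ?_, fun u v => ?_⟩
  · refine PolyBounded.mul (hfb.of_comp_le (M := 1) fun z => ?_)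
      (hqb.of_comp_le (M := 1) fun z => ?_)
    · rw [one_mul]; gcongr; exact norm_fst_le z
    · rw [one_mul]; gcongr; exact norm_snd_le z
  · have hfx : (fun y => f ((1 / 2 : ℝ) • (x + y))).HasTemperateGrowth := by
      refine hf.comp ?_
      fun_prop
    set w := smulLeftCLM ℂ (fun y => f ((1 / 2 : ℝ) • (x + y))) u with hw
    have hw1 : ∀ y, w y = f ((1 / 2 : ℝ) • (x + y)) * u y := fun y => by
      rw [hw, smulLeftCLM_apply_apply hfx, smul_eq_mul]
    have := integrable_mul_schwartz (μ := (volume : Measure Plane))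
      (a := fun p => Complex.exp (Complex.I * (inner ℝ x p / ε : ℝ)) * q p)
      (Measurable.aestronglyMeasurable (by fun_prop)) (hqb.mul_of_norm_eq (hnorm x))
      (compCLMOfContinuousLinearEquiv ℂ (ContinuousLinearEquiv.smulLeft c⁻¹) (𝓕 w))
    refine this.congr (Eventually.of_forall fun p => ?_)
    have e1 : weylInner ε (fun z => f z.1 * q z.2) u x p =
        ∫ y, Complex.exp (Complex.I * (inner ℝ (x - y) p / ε : ℝ)) * (q p * w y) := by
      refine integral_congr_ae (Eventually.of_forall fun y => ?_)
      simp only [hw1]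
      ring
    rw [e1, key]
    change _ * 𝓕 w (((c⁻¹ : ℝˣ) : ℝ) • p) = _
    rw [fourier_coe, Real.fourier_eq']
    simp only [smul_eq_mul]
    ring
  · have hfx : (fun z : Phase => f ((1 / 2 : ℝ) • (z.1 + z.2))).HasTemperateGrowth := by
      exact hf.comp ((1 / 2 : ℝ) • (ContinuousLinearMap.fst ℝ Plane Plane +
        ContinuousLinearMap.snd ℝ Plane Plane)).hasTemperateGrowth
    set w := smulLeftCLM ℂ (fun z : Phase => f ((1 / 2 : ℝ) • (z.1 + z.2))) (tensor v u) with hw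
    have hw1 : ∀ z, w z = f ((1 / 2 : ℝ) • (z.1 + z.2)) * (v z.1 * u z.2) := fun z => by
      rw [hw, smulLeftCLM_apply_apply hfx, smul_eq_mul, tensor_apply]
    have := integrable_mul_schwartz (μ := (volume : Measure Phase))
      (a := fun z => Complex.exp (Complex.I * (inner ℝ z.1 z.2 / ε : ℝ)) * q z.2)
      (Measurable.aestronglyMeasurable (by fun_prop))
      ((hqb.of_comp_le (f := fun z : Phase => z.2) (M := 1) fun z => by
        rw [one_mul]; gcongr; exact norm_snd_le z).mul_of_norm_eq fun z => hnorm z.1 z.2)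
      (compCLMOfContinuousLinearEquiv ℂ (scaleEquiv c⁻¹) (partialFourier w))
    refine this.congr (Eventually.of_forall fun z => ?_)
    have e1 : v z.1 * weylInner ε (fun z => f z.1 * q z.2) u z.1 z.2 =
        ∫ y, Complex.exp (Complex.I * (inner ℝ (z.1 - y) z.2 / ε : ℝ)) *
          (q z.2 * w.slice z.1 y) := by
      rw [weylInner, ← integral_const_mul]
      refine integral_congr_ae (Eventually.of_forall fun y => ?_)
      simp only [slice_apply, hw1]
      ring
    change _ = v z.1 * weylInner ε (fun z => f z.1 * q z.2) u z.1 z.2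
    rw [e1, key]
    change _ * partialFourier w (z.1, ((c⁻¹ : ℝˣ) : ℝ) • z.2) = _
    rw [partialFourier_apply]
    simp only [slice_apply]
    ring

lemma norm_schwartz_le_rpow_snd (g : 𝓢(Phase, ℂ)) (N : ℕ) : ∃ C : ℝ, 0 ≤ C ∧
    ∀ z : Phase, ‖g z‖ ≤ C * (1 + ‖z.2‖) ^ (-(N : ℝ)) :=
  ⟨2 ^ N * (SchwartzMap.seminorm ℝ 0 0 g + SchwartzMap.seminorm ℝ N 0 g), by positivity,
    fun z => g.norm_le_one_add_rpow N z (norm_nonneg _) (norm_snd_le z)⟩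

lemma integrable_weylIntegrand_prod (ε : ℝ) (g : 𝓢(Phase, ℂ)) (u : 𝓢(Plane, ℂ)) (x : Plane) :
    Integrable fun z : Plane × Plane => Complex.exp (Complex.I * (inner ℝ (x - z.2) z.1 / ε : ℝ)) *
      (g ((1 / 2 : ℝ) • (x + z.2), z.1) * u z.2) := by
  obtain ⟨C, hC, hg⟩ := norm_schwartz_le_rpow_snd g (volume : Measure Plane).integrablePower
  have h1 := ((Measure.integrable_pow_neg_integrablePower (volume : Measure Plane)).const_mul
    C).mul_prod (u.integrable (μ := volume)).norm
  have hgc := g.continuous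
  have huc := u.continuous
  refine Integrable.mono' h1 (Measurable.aestronglyMeasurable (by fun_prop))
    (Eventually.of_forall fun z => ?_)
  rw [norm_mul, norm_exp_I_mul, one_mul, norm_mul]
  gcongr
  exact hg _

/-- Schwartz symbols are admissible. -/
lemma weylAdmissible_schwartz (ε : ℝ) (g : 𝓢(Phase, ℂ)) : WeylAdmissible ε g where
  measurable := g.continuous.measurable
  polyBounded := polyBounded_schwartz g
  integrable_inner u x := (integrable_weylIntegrand_prod ε g u x).integral_prod_left
  integrable_prod u v := by
    obtain ⟨C, hC, hg⟩ := norm_schwartz_le_rpow_snd g (volume : Measure Plane).integrablePower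
    have h1 := ((v.integrable (μ := volume)).norm.mul_prod
      ((Measure.integrable_pow_neg_integrablePower (volume : Measure Plane)).const_mul
        C)).mul_prod (u.integrable (μ := volume)).norm
    have hgc := g.continuous
    have huc := u.continuous
    have hvc := v.continuous
    have h2 : Integrable (fun z : Phase × Plane => v z.1.1 *
        (Complex.exp (Complex.I * (inner ℝ (z.1.1 - z.2) z.1.2 / ε : ℝ)) *
          (g ((1 / 2 : ℝ) • (z.1.1 + z.2), z.1.2) * u z.2)))
        ((volume : Measure Phase).prod volume) := by
      refine Integrable.mono' h1 (Measurable.aestronglyMeasurable (by fun_prop))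
        (Eventually.of_forall fun z => ?_)
      rw [norm_mul, norm_mul, norm_exp_I_mul, one_mul, norm_mul, ← mul_assoc]
      gcongr
      exact hg _
    refine h2.integral_prod_left.congr (Eventually.of_forall fun z => ?_)
    exact integral_const_mul (v z.1) fun y =>
      Complex.exp (Complex.I * (inner ℝ (z.1 - y) z.2 / ε : ℝ)) *
        (g ((1 / 2 : ℝ) • (z.1 + y), z.2) * u y)

/-- The Weyl quantization of a Schwartz symbol is an integral operator. -/
lemma integral_weylInner_schwartz {ε : ℝ} {c : ℝˣ} (hc : (c : ℝ) = 2 * Real.pi * ε)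
    (g : 𝓢(Phase, ℂ)) (u : 𝓢(Plane, ℂ)) (x : Plane) :
    ∫ p, weylInner ε g u x p = ((c : ℝ) : ℂ) ^ 2 * ∫ y, weylKernel c g (x, y) * u y := by
  have hε : ε ≠ 0 := fun h => c.ne_zero (by rw [hc, h, mul_zero])
  have hsw := integral_integral_swap (f := fun p y =>
    Complex.exp (Complex.I * (inner ℝ (x - y) p / ε : ℝ)) *
      (g ((1 / 2 : ℝ) • (x + y), p) * u y)) (integrable_weylIntegrand_prod ε g u x)
  unfold weylInner
  rw [hsw, ← integral_const_mul]
  refine integral_congr_ae (Eventually.of_forall fun y => ?_)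
  -- The substitution `p = c q` produces the phase of `weylKernel`; in dimension two its Jacobian is
  -- `c ^ 2`.
  have h1 := Measure.integral_comp_smul (volume : Measure Plane) (fun p =>
    Complex.exp (Complex.I * (inner ℝ (x - y) p / ε : ℝ)) *
      (g ((1 / 2 : ℝ) • (x + y), p) * u y)) (c : ℝ)
  have hc2 : |((c : ℝ) ^ Module.finrank ℝ Plane)⁻¹| = ((c : ℝ) ^ 2)⁻¹ := by
    rw [finrank_euclideanSpace, Fintype.card_fin, abs_of_nonneg (by positivity)]
  rw [hc2, eq_inv_smul_iff₀ (by have := c.ne_zero; positivity)] at h1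
  simp only []
  rw [← h1, Complex.real_smul, weylKernel_apply, ← integral_mul_const]
  rw [Complex.ofReal_pow]
  congr 1
  refine integral_congr_ae (Eventually.of_forall fun q => ?_)
  simp only []
  have e3 : Complex.I * ((inner ℝ (x - y) ((c : ℝ) • q) / ε : ℝ) : ℂ) =
      ((-2 * Real.pi * inner ℝ q (y - x) : ℝ) : ℂ) * Complex.I := by
    rw [mul_comm, inner_smul_right, real_inner_comm q, hc, ← neg_sub y x, inner_neg_right]
    congr 2
    field_simp
  rw [e3]
  ring

end Graphene

/-! ### Weyl quantization of matrix symbols: weak form, symmetry and integral kernels -/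

namespace Graphene

open SchwartzMap FourierTransform

/-- A component of a Schwartz spinor. -/
def comp (α : Fin 2) : 𝓢(Plane, Spinor) →L[ℂ] 𝓢(Plane, ℂ) :=
  postcompCLM (EuclideanSpace.proj α : Spinor →L[ℂ] ℂ)

@[simp] lemma comp_apply (α : Fin 2) (φ : 𝓢(Plane, Spinor)) (x : Plane) :
    comp α φ x = φ x α := rfl

/-- All Pauli components are admissible. -/
def Symbol.Admissible (ε : ℝ) (a : Symbol) : Prop := ∀ s, WeylAdmissible ε (fun z => (a s z : ℂ))

lemma weylOp_apply {ε : ℝ} {a : Symbol} (ha : a.Admissible ε) (φ : 𝓢(Plane, Spinor)) (x : Plane)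
    (α : Fin 2) : weylOp ε a φ x α = ((2 * Real.pi * ε : ℂ) ^ 2)⁻¹ *
      ∑ s, ∑ β, pauli s α β * ∫ p, weylInner ε (fun z => (a s z : ℂ)) (comp β φ) x p := by
  set F : Plane → Plane → Spinor := fun p y =>
    Complex.exp (Complex.I * (inner ℝ (x - y) p / ε : ℝ)) •
        WithLp.toLp 2 (a.toMatrix ((1 / 2 : ℝ) • (x + y), p) *ᵥ (φ y).ofLp) with hF
  have hF1 : ∀ p y γ, F p y γ = ∑ s, ∑ β, pauli s γ β *
      (Complex.exp (Complex.I * (inner ℝ (x - y) p / ε : ℝ)) *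
        ((a s ((1 / 2 : ℝ) • (x + y), p) : ℂ) * comp β φ y)) := by
    intro p y γ
    simp only [hF, PiLp.smul_apply, Symbol.toMatrix, Matrix.mulVec, dotProduct, smul_eq_mul,
      Matrix.sum_apply, Matrix.smul_apply, Finset.mul_sum, Finset.sum_mul, comp_apply]
    rw [Finset.sum_comm]
    refine Finset.sum_congr rfl fun s _ => Finset.sum_congr rfl fun β _ => ?_
    ring
  have hi : ∀ p γ, Integrable fun y => F p y γ := fun p γ => by
    simp only [hF1]
    exact integrable_finsetSum _ fun s _ => integrable_finsetSum _ fun β _ =>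
      (integrable_weylIntegrand ε (ha s).measurable (ha s).polyBounded (comp β φ) x p).const_mul _
  have hF2 : ∀ p γ, (∫ y, F p y) γ = ∑ s, ∑ β, pauli s γ β *
      weylInner ε (fun z => (a s z : ℂ)) (comp β φ) x p := fun p γ => by
    rw [eval_integral_piLp (hi p)]
    simp only [hF1]
    rw [integral_finsetSum _ fun s _ => integrable_finsetSum _ fun β _ =>
      (integrable_weylIntegrand ε (ha s).measurable (ha s).polyBounded (comp β φ) x p).const_mul _]
    refine Finset.sum_congr rfl fun s _ => ?_
    rw [integral_finsetSum _ fun β _ =>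
      (integrable_weylIntegrand ε (ha s).measurable (ha s).polyBounded (comp β φ) x p).const_mul _]
    refine Finset.sum_congr rfl fun β _ => ?_
    rw [integral_const_mul, weylInner]
  change (((2 * Real.pi * ε : ℂ) ^ 2)⁻¹ • ∫ p, ∫ y, F p y) α = _
  rw [PiLp.smul_apply, smul_eq_mul, eval_integral_piLp fun γ => ?_]
  · congr 1
    simp only [hF2]
    rw [integral_finsetSum _ fun s _ => integrable_finsetSum _ fun β _ =>
      ((ha s).integrable_inner (comp β φ) x).const_mul _]
    refine Finset.sum_congr rfl fun s _ => ?_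
    rw [integral_finsetSum _ fun β _ => ((ha s).integrable_inner (comp β φ) x).const_mul _]
    refine Finset.sum_congr rfl fun β _ => ?_
    rw [integral_const_mul]
  · simp only [hF2]
    exact integrable_finsetSum _ fun s _ => integrable_finsetSum _ fun β _ =>
      ((ha s).integrable_inner (comp β φ) x).const_mul _

/-- The Pauli components of the (cross) Wigner function of two spinors. -/
def wignerSpinor (c : ℝˣ) (s : Fin 4) (φ χ : 𝓢(Plane, Spinor)) : 𝓢(Phase, ℂ) :=
  ∑ α, ∑ β, pauli s α β • wigner c (tensor (comp β φ) (conj (comp α χ)))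

lemma wignerSpinor_apply (c : ℝˣ) (s : Fin 4) (φ χ : 𝓢(Plane, Spinor)) (z : Phase) :
    wignerSpinor c s φ χ z =
      ∑ α, ∑ β, pauli s α β * wigner c (tensor (comp β φ) (conj (comp α χ))) z := by
  simp [wignerSpinor]

/-- The weak form of Weyl quantization. -/
lemma integral_inner_weylOp {ε : ℝ} {c : ℝˣ} (hc : (c : ℝ) = 2 * Real.pi * ε) {a : Symbol}
    (ha : a.Admissible ε) (φ χ : 𝓢(Plane, Spinor)) :
    ∫ x, inner ℂ (χ x) (weylOp ε a φ x) = ((2 * Real.pi * ε : ℂ) ^ 2)⁻¹ *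
      ∑ s, ∫ z, (a s z : ℂ) * wignerSpinor c s φ χ z := by
  have h1 : ∀ x, inner ℂ (χ x) (weylOp ε a φ x) = ((2 * Real.pi * ε : ℂ) ^ 2)⁻¹ *
      ∑ s, ∑ α, ∑ β, pauli s α β * (conj (comp α χ) x *
        ∫ p, weylInner ε (fun z => (a s z : ℂ)) (comp β φ) x p) := by
    intro x
    rw [PiLp.inner_apply]
    simp only [weylOp_apply ha, RCLike.inner_apply, conj_apply, comp_apply, Finset.mul_sum,
      Finset.sum_mul]
    rw [Finset.sum_comm]
    refine Finset.sum_congr rfl fun s _ => Finset.sum_congr rfl fun α _ =>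
      Finset.sum_congr rfl fun β _ => ?_
    ring
  have hi : ∀ s α β, Integrable fun x => pauli s α β * (conj (comp α χ) x *
        ∫ p, weylInner ε (fun z => (a s z : ℂ)) (comp β φ) x p) := fun s α β => by
    have := ((ha s).integrable_prod (comp β φ) (conj (comp α χ))).integral_prod_left
    simp only [integral_const_mul] at this
    exact this.const_mul _
  have hw : ∀ s α β, Integrable fun z => pauli s α β *
      ((a s z : ℂ) * wigner c (tensor (comp β φ) (conj (comp α χ))) z) := fun s α β =>
    (integrable_mul_schwartz (ha s).measurable.aestronglyMeasurable (ha s).polyBounded _).const_mul _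
  simp only [h1]
  rw [integral_const_mul]
  congr 1
  rw [integral_finsetSum _ fun s _ => integrable_finsetSum _ fun α _ =>
    integrable_finsetSum _ fun β _ => hi s α β]
  refine Finset.sum_congr rfl fun s _ => ?_
  have h2 : ∀ z, (a s z : ℂ) * wignerSpinor c s φ χ z = ∑ α, ∑ β, pauli s α β *
      ((a s z : ℂ) * wigner c (tensor (comp β φ) (conj (comp α χ))) z) := fun z => by
    rw [wignerSpinor_apply]
    simp only [Finset.mul_sum]
    refine Finset.sum_congr rfl fun α _ => Finset.sum_congr rfl fun β _ => ?_
    ring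
  simp only [h2]
  rw [integral_finsetSum _ fun α _ => integrable_finsetSum _ fun β _ => hi s α β,
    integral_finsetSum _ fun α _ => integrable_finsetSum _ fun β _ => hw s α β]
  refine Finset.sum_congr rfl fun α _ => ?_
  rw [integral_finsetSum _ fun β _ => hi s α β, integral_finsetSum _ fun β _ => hw s α β]
  refine Finset.sum_congr rfl fun β _ => ?_
  rw [integral_const_mul, integral_const_mul, (ha s).integral_mul hc]

lemma pauli_conj (s : Fin 4) (α β : Fin 2) : (starRingEnd ℂ) (pauli s α β) = pauli s β α := by
  fin_cases s <;> fin_cases α <;> fin_cases β <;> simp [pauli]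

lemma conj_wigner_tensor (c : ℝˣ) (u v : 𝓢(Plane, ℂ)) (z : Phase) :
    (starRingEnd ℂ) (wigner c (tensor u v) z) = wigner c (tensor (conj v) (conj u)) z := by
  rw [wigner_apply, wigner_apply, ← integral_conj, ← integral_neg_eq_self]
  refine integral_congr_ae (Eventually.of_forall fun η => ?_)
  simp only [map_mul, ← Complex.exp_conj, Complex.conj_I, Complex.conj_ofReal, tensor_apply,
    conj_apply, smul_neg, sub_neg_eq_add, ← sub_eq_add_neg, inner_neg_left]
  push_cast
  ring_nf

lemma conj_wignerSpinor (c : ℝˣ) (s : Fin 4) (φ χ : 𝓢(Plane, Spinor)) (z : Phase) :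
    (starRingEnd ℂ) (wignerSpinor c s φ χ z) = wignerSpinor c s χ φ z := by
  rw [wignerSpinor_apply, wignerSpinor_apply, Finset.sum_comm]
  simp only [map_sum, map_mul, pauli_conj, conj_wigner_tensor]
  refine Finset.sum_congr rfl fun α _ => Finset.sum_congr rfl fun β _ => ?_
  congr 4
  ext x
  simp

/-- Weyl operators with real Pauli components are symmetric. -/
lemma integral_inner_weylOp_symm {ε : ℝ} (hε : 0 < ε) {a : Symbol}
    (ha : a.Admissible ε) (φ χ : 𝓢(Plane, Spinor)) :
    ∫ x, inner ℂ (χ x) (weylOp ε a φ x) = ∫ x, inner ℂ (weylOp ε a χ x) (φ x) := by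
  have hc0 : 2 * Real.pi * ε ≠ 0 := by positivity
  have hc : ((Units.mk0 _ hc0 : ℝˣ) : ℝ) = 2 * Real.pi * ε := rfl
  have h1 : ∀ x, inner ℂ (weylOp ε a χ x) (φ x) =
      (starRingEnd ℂ) (inner ℂ (φ x) (weylOp ε a χ x)) := fun x => (inner_conj_symm _ _).symm
  simp only [h1]
  rw [integral_conj, integral_inner_weylOp hc ha, integral_inner_weylOp hc ha, map_mul, map_sum]
  congr 1
  · simp only [map_inv₀, map_pow, map_mul, Complex.conj_ofReal, map_ofNat]
  · refine Finset.sum_congr rfl fun s _ => ?_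
    rw [← integral_conj]
    simp only [map_mul, Complex.conj_ofReal, conj_wignerSpinor]

/-- A real Schwartz function seen as a complex one. -/
def toComplex : 𝓢(Phase, ℝ) →L[ℝ] 𝓢(Phase, ℂ) := postcompCLM (𝕜 := ℝ) Complex.ofRealCLM

@[simp] lemma toComplex_apply (f : 𝓢(Phase, ℝ)) (z : Phase) : toComplex f z = (f z : ℂ) := rfl

lemma admissible_toSymbol (ε : ℝ) (g : WignerFun) : g.toSymbol.Admissible ε := fun s =>
  weylAdmissible_schwartz ε (toComplex (g s))

/-- The matrix entries of a Schwartz symbol. -/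
def entry (g : WignerFun) (α β : Fin 2) : 𝓢(Phase, ℂ) := ∑ s, pauli s α β • toComplex (g s)

lemma entry_apply (g : WignerFun) (α β : Fin 2) (z : Phase) :
    entry g α β z = ∑ s, pauli s α β * (g s z : ℂ) := by
  simp [entry]

lemma conj_entry (g : WignerFun) (α β : Fin 2) (z : Phase) :
    (starRingEnd ℂ) (entry g α β z) = entry g β α z := by
  simp only [entry_apply, map_sum, map_mul, pauli_conj, Complex.conj_ofReal]

/-- The integral kernel of the quantization of a Schwartz symbol. -/
def kernel (c : ℝˣ) (g : WignerFun) (α β : Fin 2) : 𝓢(Phase, ℂ) := weylKernel c (entry g α β)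

lemma conj_kernel (c : ℝˣ) (g : WignerFun) (α β : Fin 2) (x y : Plane) :
    (starRingEnd ℂ) (kernel c g α β (x, y)) = kernel c g β α (y, x) := by
  rw [kernel, kernel, weylKernel_apply, weylKernel_apply, ← integral_conj]
  refine integral_congr_ae (Eventually.of_forall fun q => ?_)
  simp only [map_mul, ← Complex.exp_conj, Complex.conj_I, Complex.conj_ofReal, conj_entry]
  rw [← neg_sub y x, inner_neg_right, add_comm x y]
  push_cast
  ring_nf

lemma weylOp_toSymbol_apply {ε : ℝ} {c : ℝˣ} (hc : (c : ℝ) = 2 * Real.pi * ε) (g : WignerFun)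
    (φ : 𝓢(Plane, Spinor)) (x : Plane) (α : Fin 2) :
    weylOp ε g.toSymbol φ x α = ∑ β, ∫ y, kernel c g α β (x, y) * φ y β := by
  have h1 : ∀ s β, ∫ p, weylInner ε (fun z => (g.toSymbol s z : ℂ)) (comp β φ) x p =
      ((c : ℝ) : ℂ) ^ 2 * ∫ y, weylKernel c (toComplex (g s)) (x, y) * comp β φ y := fun s β =>
    integral_weylInner_schwartz hc (toComplex (g s)) (comp β φ) x
  have h2 : ∀ (K : 𝓢(Phase, ℂ)) β, Integrable fun y => K (x, y) * comp β φ y := fun K β =>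
    integrable_mul_schwartz (K.slice x).continuous.aestronglyMeasurable
      ⟨SchwartzMap.seminorm ℝ 0 0 (K.slice x), 0, by positivity, fun z => by
        simpa using (K.slice x).norm_le_seminorm ℝ z⟩ _
  have h3 : ∀ β y, kernel c g α β (x, y) * φ y β =
      ∑ s, pauli s α β * (weylKernel c (toComplex (g s)) (x, y) * comp β φ y) := fun β y => by
    simp only [kernel, entry, map_sum, map_smul, _root_.sum_apply, _root_.smul_apply,
      Finset.sum_mul, smul_eq_mul, comp_apply, mul_assoc]
  rw [weylOp_apply (admissible_toSymbol ε g)]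
  simp only [h1, h3]
  have hc' : ((2 * Real.pi * ε : ℂ) ^ 2) = ((c : ℝ) : ℂ) ^ 2 := by rw [hc]; push_cast; ring
  have hc0 : (((c : ℝ) : ℂ) ^ 2) ≠ 0 := by
    have := c.ne_zero
    exact_mod_cast pow_ne_zero 2 this
  rw [hc', Finset.sum_comm, Finset.mul_sum]
  refine Finset.sum_congr rfl fun β _ => ?_
  rw [integral_finsetSum _ fun s _ => (h2 _ β).const_mul _, Finset.mul_sum]
  refine Finset.sum_congr rfl fun s _ => ?_
  rw [integral_const_mul]
  field_simp

/-- The Wigner function of the kernel of a quantized symbol recovers the symbol. -/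
lemma sum_wigner_kernel (c : ℝˣ) (g : WignerFun) (s : Fin 4) (z : Phase) :
    ∑ α, ∑ β, pauli s α β * wigner c (kernel c g β α) z = 2 * (g s z : ℂ) := by
  simp only [kernel, wigner_weylKernel, entry_apply]
  -- Orthogonality of the Pauli matrices: the trace of the product of two of them is `2` if they
  -- coincide and `0` otherwise.
  simp only [Fin.sum_univ_four, Fin.sum_univ_two]
  fin_cases s <;> simp [pauli] <;> ring_nf <;> simp

lemma measurable_vec3 (s : Fin 3) : Measurable fun p : Plane => vec3 p s := by
  fin_cases s <;> simp [vec3] <;> fun_prop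

lemma abs_vec3_le (p : Plane) (s : Fin 3) : |vec3 p s| ≤ ‖p‖ := by
  fin_cases s
  · exact PiLp.norm_apply_le p 0
  · exact PiLp.norm_apply_le p 1
  · simp [vec3]

lemma abs_vec3_div_le (p : Plane) (s : Fin 3) : |vec3 p s / ‖p‖| ≤ 1 := by
  rw [abs_div, abs_norm]
  exact div_le_one_of_le₀ (abs_vec3_le p s) (norm_nonneg _)

/-- Each Pauli component is a sum of products of a smooth temperate function of `r` and a measurable
function of `p`. Allowing the second factor to be merely measurable covers the singularity of
`p/|p|` at the origin. -/
lemma admissible_neg_modHamiltonian {ε : ℝ} (hε : 0 < ε) (c : ℝ) {A B : Plane → ℝ}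
    (hA : A.HasTemperateGrowth) (hB : B.HasTemperateGrowth) :
    (-modHamiltonian c A B).Admissible ε := by
  have hc0 : 2 * Real.pi * ε ≠ 0 := by positivity
  have hc : ((Units.mk0 _ hc0 : ℝˣ) : ℝ) = 2 * Real.pi * ε := rfl
  have ofReal : ∀ {A : Plane → ℝ}, A.HasTemperateGrowth →
      (fun r => ((-A r : ℝ) : ℂ)).HasTemperateGrowth := fun hA =>
    Function.Complex.hasTemperateGrowth_ofReal.comp hA.neg
  refine Fin.cases ?_ fun s => ?_
  · have h1 := weylAdmissible_fst_mul_snd hc (Function.HasTemperateGrowth.const (1 : ℂ))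
      (q := fun p : Plane => ((-(‖p‖ ^ 2 / 2) : ℝ) : ℂ)) (by fun_prop) ⟨1, 2, zero_le_one, fun p => by
        rw [Complex.norm_real, norm_neg, Real.norm_of_nonneg (by positivity)]
        nlinarith [norm_nonneg p]⟩
    have h2 := weylAdmissible_fst_mul_snd hc (ofReal hA) (q := fun _ : Plane => (1 : ℂ))
      measurable_const ⟨1, 0, zero_le_one, fun p => by simp⟩
    convert! h1.add h2 using 2 with z
    simp [modHamiltonian]
    ring
  · have hm := measurable_vec3 s
    have h1 := weylAdmissible_fst_mul_snd hc (Function.HasTemperateGrowth.const (1 : ℂ))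
      (q := fun p : Plane => ((-(c * ‖p‖ * (vec3 p s / ‖p‖)) : ℝ) : ℂ)) (by fun_prop)
      ⟨|c|, 1, abs_nonneg _, fun p => by
        rw [Complex.norm_real, norm_neg, Real.norm_eq_abs, abs_mul, abs_mul, abs_norm]
        refine (mul_le_of_le_one_right (by positivity) (abs_vec3_div_le p s)).trans ?_
        gcongr
        simp⟩
    have h2 := weylAdmissible_fst_mul_snd hc (ofReal hB)
      (q := fun p : Plane => ((vec3 p s / ‖p‖ : ℝ) : ℂ)) (by fun_prop) ⟨1, 0, zero_le_one, fun p => by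
        rw [Complex.norm_real, Real.norm_eq_abs]
        simpa using abs_vec3_div_le p s⟩
    convert! h1.add h2 using 2 with z
    simp [modHamiltonian]
    ring

end Graphene

/-! ### Orthonormal bases of Schwartz spinors and expansion of kernels -/

namespace Graphene

open SchwartzMap FourierTransform

/-- The inner product of two square-integrable spinors. -/
def bracket (f g : Plane → Spinor) : ℂ := ∫ x, inner ℂ (f x) (g x)

lemma inner_toLp_toLp {f g : Plane → Spinor} (hf : MemLp f 2 volume) (hg : MemLp g 2 volume) :
    inner ℂ (hf.toLp f) (hg.toLp g) = bracket f g := by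
  rw [L2.inner_def]
  refine integral_congr_ae ?_
  filter_upwards [hf.coeFn_toLp, hg.coeFn_toLp] with x h1 h2
  rw [h1, h2]

lemma integrable_inner {f g : Plane → Spinor} (hf : MemLp f 2 volume) (hg : MemLp g 2 volume) :
    Integrable fun x => inner ℂ (f x) (g x) := by
  refine (L2.integrable_inner (𝕜 := ℂ) (hf.toLp f) (hg.toLp g)).congr ?_
  filter_upwards [hf.coeFn_toLp, hg.coeFn_toLp] with x h1 h2
  rw [h1, h2]

lemma conj_bracket (f g : Plane → Spinor) : (starRingEnd ℂ) (bracket f g) = bracket g f := by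
  rw [bracket, ← integral_conj]
  simp only [inner_conj_symm, bracket]

lemma norm_bracket_symm (f g : Plane → Spinor) : ‖bracket f g‖ = ‖bracket g f‖ := by
  rw [← conj_bracket, RCLike.norm_conj]

lemma bracket_smul_right (f g : Plane → Spinor) (a : ℂ) :
    bracket f (fun x => a • g x) = a * bracket f g := by
  simp only [bracket, inner_smul_right, integral_const_mul]

lemma bracket_smul_left (f g : Plane → Spinor) (a : ℂ) :
    bracket (fun x => a • f x) g = (starRingEnd ℂ) a * bracket f g := by
  simp only [bracket, inner_smul_left, integral_const_mul]

lemma bracket_self_eq {f : Plane → Spinor} : bracket f f = ((∫ x, ‖f x‖ ^ 2 : ℝ) : ℂ) := by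
  rw [bracket, ← integral_complex_ofReal]
  refine integral_congr_ae (Eventually.of_forall fun x => ?_)
  simp only [inner_self_eq_norm_sq_to_K]
  norm_cast

/-- A sequence of Schwartz spinors that is an orthonormal basis of the space of
square-integrable spinors. -/
structure IsSchwartzBasis (φ : ℕ → 𝓢(Plane, Spinor)) : Prop where
  hasSum_bracket : ∀ {f g : Plane → Spinor}, MemLp f 2 volume → MemLp g 2 volume →
    HasSum (fun i => bracket f (φ i) * bracket (φ i) g) (bracket f g)
  bracket_eq : ∀ i j, bracket (φ i) (φ j) = if i = j then 1 else 0

variable {φ : ℕ → 𝓢(Plane, Spinor)}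

lemma isSchwartzBasis_of_hilbertBasis (b : HilbertBasis ℕ ℂ (Lp Spinor 2 (volume : Measure Plane)))
    (hb : ∀ i, b i = (φ i).toLp 2 volume) : IsSchwartzBasis φ where
  hasSum_bracket {f g} hf hg := by
    have := b.hasSum_inner_mul_inner (hf.toLp f) (hg.toLp g)
    rw [inner_toLp_toLp hf hg] at this
    convert! this using 3 with i
    · rw [hb]; exact (inner_toLp_toLp hf ((φ i).memLp 2 volume)).symm
    · rw [hb]; exact (inner_toLp_toLp ((φ i).memLp 2 volume) hg).symm
  bracket_eq i j := by
    have := orthonormal_iff_ite.1 b.orthonormal i j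
    rw [← this, hb, hb]
    exact (inner_toLp_toLp ((φ i).memLp 2 volume) ((φ j).memLp 2 volume)).symm

/-- Parseval's identity. -/
lemma IsSchwartzBasis.hasSum_sq (hφ : IsSchwartzBasis φ) {f : Plane → Spinor}
    (hf : MemLp f 2 volume) :
    HasSum (fun i => ‖bracket (φ i) f‖ ^ 2) (∫ x, ‖f x‖ ^ 2) := by
  have := hφ.hasSum_bracket hf hf
  rw [bracket_self_eq] at this
  have h2 : ∀ i, bracket f (φ i) * bracket (φ i) f = ((‖bracket (φ i) f‖ ^ 2 : ℝ) : ℂ) := fun i => by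
    rw [← conj_bracket (φ i) f, mul_comm, Complex.mul_conj, Complex.normSq_eq_norm_sq]
  simp only [h2] at this
  exact_mod_cast this

lemma lintegral_enorm_sq_eq {f : Plane → Spinor} (hf : MemLp f 2 volume) :
    ∫⁻ x, ‖f x‖ₑ ^ 2 = ENNReal.ofReal (∫ x, ‖f x‖ ^ 2) := by
  rw [ofReal_integral_eq_lintegral_ofReal (hf.integrable_norm_pow two_ne_zero)
    (Eventually.of_forall fun x => by positivity)]
  refine lintegral_congr fun x => ?_
  rw [ENNReal.ofReal_pow (norm_nonneg _), ofReal_norm]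

lemma IsSchwartzBasis.lintegral_eq_tsum (hφ : IsSchwartzBasis φ) {f : Plane → Spinor}
    (hf : MemLp f 2 volume) :
    ∫⁻ x, ‖f x‖ₑ ^ 2 = ∑' i, ‖bracket (φ i) f‖ₑ ^ 2 := by
  have h := hφ.hasSum_sq hf
  rw [lintegral_enorm_sq_eq hf, ← h.tsum_eq, ENNReal.ofReal_tsum_of_nonneg
    (fun i => by positivity) h.summable]
  refine tsum_congr fun i => ?_
  rw [ENNReal.ofReal_pow (norm_nonneg _), ofReal_norm]

/-- One row of a matrix of integral operators, applied to a spinor. -/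
def rowApply (E : Fin 2 → 𝓢(Phase, ℂ)) (f : 𝓢(Plane, Spinor)) (x : Plane) : ℂ :=
  ∑ β, ∫ y, E β (x, y) * f y β

lemma integrable_row_mul (K : 𝓢(Phase, ℂ)) (x : Plane) (u : 𝓢(Plane, ℂ)) :
    Integrable fun y => K (x, y) * u y :=
  integrable_mul_schwartz (K.slice x).continuous.aestronglyMeasurable
    ⟨SchwartzMap.seminorm ℝ 0 0 (K.slice x), 0, by positivity, fun z => by
      simpa using (K.slice x).norm_le_seminorm ℝ z⟩ _

lemma integrable_row_mul_spinor (K : 𝓢(Phase, ℂ)) (x : Plane) (f : 𝓢(Plane, Spinor)) (β : Fin 2) :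
    Integrable fun y => K (x, y) * f y β := integrable_row_mul K x (comp β f)

lemma enorm_sq_spinor (v : Spinor) : ‖v‖ₑ ^ 2 = ∑ β, ‖v β‖ₑ ^ 2 := by
  rw [← ofReal_norm, ← ENNReal.ofReal_pow (norm_nonneg _), EuclideanSpace.norm_sq_eq,
    ENNReal.ofReal_sum_of_nonneg (fun i _ => by positivity)]
  refine Finset.sum_congr rfl fun β _ => ?_
  rw [ENNReal.ofReal_pow (norm_nonneg _), ofReal_norm]

/-- Parseval's identity in `y` at a fixed `x`: the coefficients of the conjugated row have the
moduli of the values at `x` of the operator applied to the basis. -/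
lemma IsSchwartzBasis.lintegral_row (hφ : IsSchwartzBasis φ) (E : Fin 2 → 𝓢(Phase, ℂ))
    (x : Plane) : ∑ β, ∫⁻ y, ‖E β (x, y)‖ₑ ^ 2 = ∑' i, ‖rowApply E (φ i) x‖ₑ ^ 2 := by
  set e : Plane → Spinor := fun y => WithLp.toLp 2 fun β => (starRingEnd ℂ) (E β (x, y)) with he
  have heM : MemLp e 2 volume := MemLp.of_eval_piLp fun β =>
    (conj ((E β).slice x)).memLp 2 volume
  have h1 : ∑ β, ∫⁻ y, ‖E β (x, y)‖ₑ ^ 2 = ∫⁻ y, ‖e y‖ₑ ^ 2 := by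
    rw [← lintegral_finsetSum _ fun β _ => by
      have := ((E β).slice x).continuous
      change Measurable fun y => ‖(E β).slice x y‖ₑ ^ 2
      fun_prop]
    refine lintegral_congr fun y => ?_
    rw [enorm_sq_spinor]
    simp [he]
  rw [h1, hφ.lintegral_eq_tsum heM]
  refine tsum_congr fun i => ?_
  have h2 : bracket e (φ i) = rowApply E (φ i) x := by
    rw [bracket, rowApply, ← integral_finsetSum _ fun β _ => integrable_row_mul_spinor (E β) x
      (φ i) β]
    refine integral_congr_ae (Eventually.of_forall fun y => ?_)
    simp only [PiLp.inner_apply, RCLike.inner_apply, he, Complex.conj_conj]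
    refine Finset.sum_congr rfl fun β _ => mul_comm _ _
  have h3 : ‖bracket (φ i) e‖ₑ = ‖bracket e (φ i)‖ₑ := by
    rw [← ofReal_norm, norm_bracket_symm, ofReal_norm]
  rw [h3, h2]

lemma continuous_rowApply (E : Fin 2 → 𝓢(Phase, ℂ)) (f : 𝓢(Plane, Spinor)) :
    StronglyMeasurable (rowApply E f) := by
  unfold rowApply
  refine Finset.stronglyMeasurable_fun_sum _ fun β _ => ?_
  have h1 := (E β).continuous
  have h2 := (comp β f).continuous
  have : StronglyMeasurable fun z : Plane × Plane => E β z * comp β f z.2 :=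
    Continuous.stronglyMeasurable (by fun_prop)
  exact this.integral_prod_right

lemma lintegral_weight_lt_top (n : ℕ) (E : 𝓢(Phase, ℂ)) :
    ∫⁻ z : Phase, ‖z.1‖ₑ ^ n * ‖E z‖ₑ ^ 2 < ⊤ := by
  have h1 := integrable_mul_schwartz (μ := (volume : Measure Phase))
    (a := fun z => ((‖z.1‖ ^ n : ℝ) : ℂ) * conj E z) (by
      have := (conj E).continuous
      exact Continuous.aestronglyMeasurable (by fun_prop))
    (PolyBounded.mul ⟨1, n, zero_le_one, fun z => by
      rw [Complex.norm_real, Real.norm_of_nonneg (by positivity), one_mul]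
      gcongr
      exact (norm_fst_le z).trans (by simp)⟩ (polyBounded_schwartz _)) E
  have h2 := h1.2
  rw [hasFiniteIntegral_iff_enorm] at h2
  refine lt_of_eq_of_lt (lintegral_congr fun z => ?_) h2
  have e1 : ‖((‖z.1‖ ^ n : ℝ) : ℂ)‖ₑ = ‖z.1‖ₑ ^ n := by
    rw [← ofReal_norm, Complex.norm_real, Real.norm_of_nonneg (by positivity),
      ENNReal.ofReal_pow (norm_nonneg _), ofReal_norm]
  have e2 : ‖conj E z‖ₑ = ‖E z‖ₑ := by
    rw [← ofReal_norm, conj_apply, RCLike.norm_conj, ofReal_norm]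
  rw [enorm_mul, enorm_mul, e1, e2]
  ring

/-- The Parseval identity holds row by row, so any weight in the row variable may be inserted before
integrating. -/
lemma IsSchwartzBasis.lintegral_weight_row (hφ : IsSchwartzBasis φ) (E : Fin 2 → 𝓢(Phase, ℂ))
    (n : ℕ) : ∑ β, ∫⁻ z : Phase, ‖z.1‖ₑ ^ n * ‖E β z‖ₑ ^ 2 =
      ∑' i, ∫⁻ x : Plane, ‖x‖ₑ ^ n * ‖rowApply E (φ i) x‖ₑ ^ 2 := by
  have hE := fun β => (E β).continuous
  rw [← lintegral_tsum fun i => by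
    have := (continuous_rowApply E (φ i)).measurable
    exact Measurable.aemeasurable (by fun_prop)]
  simp_rw [ENNReal.tsum_mul_left, ← hφ.lintegral_row E]
  have h1 : ∀ β, ∫⁻ z : Phase, ‖z.1‖ₑ ^ n * ‖E β z‖ₑ ^ 2 =
      ∫⁻ x : Plane, ‖x‖ₑ ^ n * ∫⁻ y : Plane, ‖E β (x, y)‖ₑ ^ 2 := fun β => by
    rw [Measure.volume_eq_prod, lintegral_prod _ (by have := hE β; fun_prop)]
    refine lintegral_congr fun x => ?_
    have := ((E β).slice x).continuous
    change ∫⁻ y, ‖x‖ₑ ^ n * ‖(E β).slice x y‖ₑ ^ 2 = ‖x‖ₑ ^ n * ∫⁻ y, ‖(E β).slice x y‖ₑ ^ 2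
    rw [lintegral_const_mul _ (by fun_prop)]
  simp_rw [h1, Finset.mul_sum]
  rw [lintegral_finsetSum _ fun β _ => ?_]
  have := hE β
  refine Measurable.mul (by fun_prop) (Measurable.lintegral_prod_right' (f := fun z => ‖E β z‖ₑ ^ 2) (by fun_prop))

/-- A row of kernels minus a partial sum of its expansion in an orthonormal basis. -/
def rowRemainder (E : Fin 2 → 𝓢(Phase, ℂ)) (κ : ℕ → 𝓢(Plane, ℂ)) (φ : ℕ → 𝓢(Plane, Spinor))
    (I : Finset ℕ) (β : Fin 2) : 𝓢(Phase, ℂ) :=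
  E β - ∑ i ∈ I, tensor (κ i) (conj (comp β (φ i)))

lemma rowRemainder_apply (E : Fin 2 → 𝓢(Phase, ℂ)) (κ : ℕ → 𝓢(Plane, ℂ))
    (φ : ℕ → 𝓢(Plane, Spinor)) (I : Finset ℕ) (β : Fin 2) (z : Phase) :
    rowRemainder E κ φ I β z =
      E β z - ∑ i ∈ I, κ i z.1 * (starRingEnd ℂ) (φ i z.2 β) := by
  simp [rowRemainder]

/-- Orthonormality: the remainder annihilates the basis vectors already expanded and acts on the
others as the full kernel does. -/
lemma IsSchwartzBasis.rowApply_rowRemainder (hφ : IsSchwartzBasis φ) {E : Fin 2 → 𝓢(Phase, ℂ)}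
    {κ : ℕ → 𝓢(Plane, ℂ)} (hκ : ∀ i x, rowApply E (φ i) x = κ i x) (I : Finset ℕ) (j : ℕ)
    (x : Plane) : rowApply (rowRemainder E κ φ I) (φ j) x = if j ∈ I then 0 else κ j x := by
  have h1 : ∀ i β, Integrable fun y => (starRingEnd ℂ) (φ i y β) * φ j y β := fun i β =>
    integrable_mul_schwartz (conj (comp β (φ i))).continuous.aestronglyMeasurable
      ⟨SchwartzMap.seminorm ℝ 0 0 (conj (comp β (φ i))), 0, by positivity, fun z => by
        simpa using (conj (comp β (φ i))).norm_le_seminorm ℝ z⟩ (comp β (φ j))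
  have h2 : ∀ β, ∫ y, rowRemainder E κ φ I β (x, y) * φ j y β =
      (∫ y, E β (x, y) * φ j y β) -
        ∑ i ∈ I, κ i x * ∫ y, (starRingEnd ℂ) (φ i y β) * φ j y β := fun β => by
    simp_rw [rowRemainder_apply, sub_mul, Finset.sum_mul, mul_assoc]
    rw [integral_sub (integrable_row_mul_spinor (E β) x (φ j) β)
      (integrable_finsetSum _ fun i _ => (h1 i β).const_mul _),
      integral_finsetSum _ fun i _ => (h1 i β).const_mul _]
    simp_rw [integral_const_mul]
  have h3 : ∀ i, ∑ β, ∫ y, (starRingEnd ℂ) (φ i y β) * φ j y β = if i = j then 1 else 0 :=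
    fun i => by
    rw [← hφ.bracket_eq, bracket, ← integral_finsetSum _ fun β _ => h1 i β]
    refine integral_congr_ae (Eventually.of_forall fun y => ?_)
    simp only [PiLp.inner_apply, RCLike.inner_apply]
    refine Finset.sum_congr rfl fun β _ => mul_comm _ _
  unfold rowApply at hκ ⊢
  simp_rw [h2]
  rw [Finset.sum_sub_distrib, hκ, Finset.sum_comm]
  simp_rw [← Finset.mul_sum, h3, mul_ite, mul_one, mul_zero]
  rw [Finset.sum_ite_eq']
  split_ifs <;> simp

/-- The expansion of a row of kernels converges in every weighted `L²` space. -/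
lemma IsSchwartzBasis.tendsto_rowRemainder (hφ : IsSchwartzBasis φ) {E : Fin 2 → 𝓢(Phase, ℂ)}
    {κ : ℕ → 𝓢(Plane, ℂ)} (hκ : ∀ i x, rowApply E (φ i) x = κ i x) (n : ℕ) (β : Fin 2) :
    Tendsto (fun I => ∫⁻ z : Phase, ‖z.1‖ₑ ^ n * ‖rowRemainder E κ φ I β z‖ₑ ^ 2) atTop (𝓝 0) := by
  -- The total of this series is a weighted norm of the kernel, hence finite, and the remainder over
  -- `I` is bounded by its tail outside `I`.
  set s : ℕ → ENNReal := fun i => ∫⁻ x : Plane, ‖x‖ₑ ^ n * ‖rowApply E (φ i) x‖ₑ ^ 2 with hs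
  have hfin : ∑' i, s i ≠ ⊤ := by
    rw [hs, ← hφ.lintegral_weight_row E n]
    exact (ENNReal.sum_lt_top.2 fun β _ => lintegral_weight_lt_top n (E β)).ne
  refine tendsto_of_tendsto_of_tendsto_of_le_of_le tendsto_const_nhds
    (ENNReal.tendsto_tsum_compl_atTop_zero hfin) (fun _ => zero_le) fun I => ?_
  calc ∫⁻ z : Phase, ‖z.1‖ₑ ^ n * ‖rowRemainder E κ φ I β z‖ₑ ^ 2
      ≤ ∑ β, ∫⁻ z : Phase, ‖z.1‖ₑ ^ n * ‖rowRemainder E κ φ I β z‖ₑ ^ 2 :=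
        Finset.single_le_sum (f := fun β => ∫⁻ z : Phase, ‖z.1‖ₑ ^ n *
          ‖rowRemainder E κ φ I β z‖ₑ ^ 2) (fun _ _ => zero_le) (Finset.mem_univ β)
    _ = ∑' i, ∫⁻ x : Plane, ‖x‖ₑ ^ n * ‖rowApply (rowRemainder E κ φ I) (φ i) x‖ₑ ^ 2 :=
        hφ.lintegral_weight_row _ n
    _ = ∑' i, Set.indicator {i | i ∉ I} s i := by
        refine tsum_congr fun i => ?_
        simp_rw [hφ.rowApply_rowRemainder hκ]
        by_cases hi : i ∈ I
        · simp [hi]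
        · simp [hi, hs, hκ]
    _ = _ := (tsum_subtype {i | i ∉ I} s).symm
    _ ≤ _ := le_rfl

end Graphene

/-! ### Eigenfunction expansion of a quantized symbol and the trace formula -/

namespace Graphene

open SchwartzMap FourierTransform

lemma partialFourierFst_tensor (u v : 𝓢(Plane, ℂ)) :
    partialFourierFst (tensor u v) = tensor (𝓕 u) v := by
  ext z
  rw [partialFourierFst_apply, tensor_apply, fourier_coe, Real.fourier_eq', ← integral_mul_const]
  refine integral_congr_ae (Eventually.of_forall fun x => ?_)
  simp only [tensor_apply, smul_eq_mul, mul_assoc]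

/-- The Fourier transform in the output variable commutes with applying the kernel. Thus the
expansion theorem also applies to the transformed kernel, with the same basis, and yields
convergence with frequency weights. -/
lemma rowApply_partialFourierFst {E : Fin 2 → 𝓢(Phase, ℂ)} {f : 𝓢(Plane, Spinor)}
    {κ : 𝓢(Plane, ℂ)} (hκ : ∀ x, rowApply E f x = κ x) (ξ : Plane) :
    rowApply (fun β => partialFourierFst (E β)) f ξ = 𝓕 κ ξ := by
  have hi : ∀ β, Integrable (fun z : Plane × Plane =>
      Complex.exp (↑(-2 * Real.pi * inner ℝ z.1 ξ) * Complex.I) * (E β z * f z.2 β)) := fun β => by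
    have h1 := (comp β f).continuous
    have := integrable_mul_schwartz (μ := (volume : Measure Phase))
      (a := fun z : Phase => Complex.exp (↑(-2 * Real.pi * inner ℝ z.1 ξ) * Complex.I) *
        comp β f z.2) (Continuous.aestronglyMeasurable (by fun_prop))
      ⟨SchwartzMap.seminorm ℝ 0 0 (comp β f), 0, by positivity, fun z => by
        rw [norm_mul, Complex.norm_exp_ofReal_mul_I, one_mul, pow_zero, mul_one]
        exact (comp β f).norm_le_seminorm ℝ z.2⟩ (E β)
    refine this.congr (Eventually.of_forall fun z => ?_)
    simp only [comp_apply]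
    ring
  rw [fourier_coe, Real.fourier_eq']
  simp_rw [← hκ, rowApply, Finset.smul_sum, smul_eq_mul, ← integral_const_mul]
  rw [integral_finsetSum _ fun β _ => (hi β).integral_prod_left]
  refine Finset.sum_congr rfl fun β _ => ?_
  have hsw := integral_integral_swap (f := fun x y =>
    Complex.exp (↑(-2 * Real.pi * inner ℝ x ξ) * Complex.I) * (E β (x, y) * f y β)) (hi β)
  rw [hsw]
  refine integral_congr_ae (Eventually.of_forall fun y => ?_)
  simp only [partialFourierFst_apply, ← integral_mul_const, mul_assoc]

lemma partialFourierFst_rowRemainder (E : Fin 2 → 𝓢(Phase, ℂ)) (κ : ℕ → 𝓢(Plane, ℂ))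
    (φ : ℕ → 𝓢(Plane, Spinor)) (I : Finset ℕ) (β : Fin 2) :
    partialFourierFst (rowRemainder E κ φ I β) =
      rowRemainder (fun β => partialFourierFst (E β)) (fun i => 𝓕 (κ i)) φ I β := by
  simp only [rowRemainder, map_sub, map_sum, partialFourierFst_tensor]

/-- The Fourier transforms of a kernel and of its adjoint. -/
lemma partialFourier_eq_of_hermitian {E E' : 𝓢(Phase, ℂ)}
    (h : ∀ x y, E (x, y) = (starRingEnd ℂ) (E' (y, x))) (z : Phase) :
    partialFourier E z = (starRingEnd ℂ) (partialFourierFst E' (-z.2, z.1)) := by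
  rw [partialFourier_apply, partialFourierFst_apply, ← integral_conj]
  refine integral_congr_ae (Eventually.of_forall fun y => ?_)
  simp only [h, map_mul, ← Complex.exp_conj, Complex.conj_I, Complex.conj_ofReal, inner_neg_right]
  push_cast
  ring_nf

lemma enorm_conj (z : ℂ) : ‖(starRingEnd ℂ) z‖ₑ = ‖z‖ₑ := by
  rw [← ofReal_norm, RCLike.norm_conj, ofReal_norm]

variable {φ : ℕ → 𝓢(Plane, Spinor)} {ε : ℝ} {c : ℝˣ} {g : WignerFun} {m : ℕ → ℝ}

/-- The remainder of the expansion of the kernel of a quantized symbol in eigenfunctions. -/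
def kernelRemainder (c : ℝˣ) (g : WignerFun) (φ : ℕ → 𝓢(Plane, Spinor)) (m : ℕ → ℝ)
    (I : Finset ℕ) (α β : Fin 2) : 𝓢(Phase, ℂ) :=
  rowRemainder (kernel c g α) (fun i => (m i : ℂ) • comp α (φ i)) φ I β

/-- Real Pauli components and real eigenvalues make the remainder Hermitian. Row-wise expansion only
controls weights in the first variable; this symmetry transfers them to the second. -/
lemma kernelRemainder_hermitian (I : Finset ℕ) (α β : Fin 2) (x y : Plane) :
    kernelRemainder c g φ m I α β (x, y) =
      (starRingEnd ℂ) (kernelRemainder c g φ m I β α (y, x)) := by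
  simp only [kernelRemainder, rowRemainder_apply, map_sub, map_sum, map_mul, conj_kernel,
    _root_.smul_apply, comp_apply, smul_eq_mul, Complex.conj_ofReal, Complex.conj_conj]
  congr 1
  refine Finset.sum_congr rfl fun i _ => ?_
  ring

lemma rowApply_kernel (hc : (c : ℝ) = 2 * Real.pi * ε) (f : 𝓢(Plane, Spinor)) (α : Fin 2)
    (x : Plane) : rowApply (kernel c g α) f x = weylOp ε g.toSymbol f x α :=
  (weylOp_toSymbol_apply hc g f x α).symm

section Expansion

variable (hφ : IsSchwartzBasis φ) (hc : (c : ℝ) = 2 * Real.pi * ε)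
  (hm : ∀ i x, weylOp ε g.toSymbol (φ i) x = (m i : ℂ) • φ i x)

include hc hm in
lemma rowApply_kernel_eigen (α : Fin 2) (i : ℕ) (x : Plane) :
    rowApply (kernel c g α) (φ i) x = ((m i : ℂ) • comp α (φ i)) x := by
  rw [rowApply_kernel hc, hm]
  rfl

include hφ hc hm in
lemma tendsto_fst_kernelRemainder (n : ℕ) (α β : Fin 2) :
    Tendsto (fun I => ∫⁻ z : Phase, ‖z.1‖ₑ ^ n * ‖kernelRemainder c g φ m I α β z‖ₑ ^ 2)
      atTop (𝓝 0) :=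
  hφ.tendsto_rowRemainder (rowApply_kernel_eigen hc hm α) n β

include hφ hc hm in
lemma tendsto_snd_kernelRemainder (n : ℕ) (α β : Fin 2) :
    Tendsto (fun I => ∫⁻ z : Phase, ‖z.2‖ₑ ^ n * ‖kernelRemainder c g φ m I α β z‖ₑ ^ 2)
      atTop (𝓝 0) := by
  refine (tendsto_fst_kernelRemainder hφ hc hm n β α).congr fun I => ?_
  rw [← lintegral_swap]
  refine lintegral_congr fun z => ?_
  rw [← Prod.mk.eta (p := z), kernelRemainder_hermitian, enorm_conj]
  rfl

include hφ hc hm in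
lemma tendsto_fst_partialFourierFst_kernelRemainder (n : ℕ) (α β : Fin 2) :
    Tendsto (fun I => ∫⁻ z : Phase, ‖z.1‖ₑ ^ n *
      ‖partialFourierFst (kernelRemainder c g φ m I α β) z‖ₑ ^ 2) atTop (𝓝 0) := by
  simp only [kernelRemainder, partialFourierFst_rowRemainder]
  exact hφ.tendsto_rowRemainder
    (fun i => rowApply_partialFourierFst (rowApply_kernel_eigen hc hm α i)) n β

include hφ hc hm in
lemma tendsto_snd_partialFourier_kernelRemainder (n : ℕ) (α β : Fin 2) :
    Tendsto (fun I => ∫⁻ z : Phase, ‖z.2‖ₑ ^ n *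
      ‖partialFourier (kernelRemainder c g φ m I α β) z‖ₑ ^ 2) atTop (𝓝 0) := by
  obtain ⟨C, hC, h⟩ := exists_lintegral_comp_equiv (swapEquiv.trans
    ((ContinuousLinearEquiv.neg ℝ (M := Plane)).prodCongr (ContinuousLinearEquiv.refl ℝ Plane)))
  have h1 := ENNReal.Tendsto.const_mul (a := C)
    (tendsto_fst_partialFourierFst_kernelRemainder hφ hc hm n β α) (Or.inr hC)
  rw [mul_zero] at h1
  refine h1.congr fun I => ?_
  rw [← h]
  refine lintegral_congr fun z => ?_
  rw [partialFourier_eq_of_hermitian (kernelRemainder_hermitian I α β), enorm_conj]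
  congr 2
  change ‖-z.2‖ₑ = _
  rw [enorm_neg]

-- The four weighted convergences, in position and in frequency for each kernel variable, are what
-- the two weighted bounds for the Wigner transform require.
include hφ hc hm in
lemma tendsto_integral_mul_wigner_kernelRemainder {a : Phase → ℂ} (ha : Measurable a)
    (hb : PolyBounded a) (α β : Fin 2) :
    Tendsto (fun I => ∫ z, a z * wigner c (kernelRemainder c g φ m I α β) z) atTop (𝓝 0) := by
  refine tendsto_integral_mul_of_tendsto_weights (fun n => ?_) (fun n => ?_) ha hb
  · obtain ⟨C, hC, h⟩ := exists_lintegral_fst_wigner_le c n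
    have h1 := ENNReal.Tendsto.const_mul (a := C) ((tendsto_fst_kernelRemainder hφ hc hm n α β).add
      (tendsto_snd_kernelRemainder hφ hc hm n α β)) (Or.inr hC)
    rw [add_zero, mul_zero] at h1
    exact tendsto_of_tendsto_of_tendsto_of_le_of_le tendsto_const_nhds h1 (fun _ => zero_le)
      fun I => h _
  · obtain ⟨C, hC, h⟩ := exists_lintegral_snd_wigner_le c n
    have h1 := ENNReal.Tendsto.const_mul (a := C)
      ((tendsto_fst_partialFourierFst_kernelRemainder hφ hc hm n α β).add
      (tendsto_snd_partialFourier_kernelRemainder hφ hc hm n α β)) (Or.inr hC)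
    rw [add_zero, mul_zero] at h1
    exact tendsto_of_tendsto_of_tendsto_of_le_of_le tendsto_const_nhds h1 (fun _ => zero_le)
      fun I => h _

lemma sum_wigner_kernelRemainder (I : Finset ℕ) (s : Fin 4) :
    ∑ α, ∑ β, pauli s α β • wigner c (kernelRemainder c g φ m I β α) =
      (2 : ℂ) • toComplex (g s) - ∑ i ∈ I, (m i : ℂ) • wignerSpinor c s (φ i) (φ i) := by
  have hsplit : ∀ α β, wigner c (kernelRemainder c g φ m I β α) =
      wigner c (kernel c g β α) -
        ∑ i ∈ I, (m i : ℂ) • wigner c (tensor (comp β (φ i)) (conj (comp α (φ i)))) := by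
    intro α β
    rw [kernelRemainder, rowRemainder, map_sub, map_sum]
    congr 1
    refine Finset.sum_congr rfl fun i _ => ?_
    rw [← (wigner c).map_smul]
    congr 1
    ext z
    simp only [tensor_apply, _root_.smul_apply, smul_eq_mul, mul_assoc]
  have h2 : (2 : ℂ) • toComplex (g s) = ∑ α, ∑ β, pauli s α β • wigner c (kernel c g β α) := by
    ext z
    simpa using (sum_wigner_kernel c g s z).symm
  simp only [hsplit, h2, wignerSpinor, smul_sub, Finset.sum_sub_distrib, Finset.smul_sum]
  congr 1
  symm
  refine Finset.sum_comm.trans (Finset.sum_congr rfl fun α _ => ?_)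
  refine Finset.sum_comm.trans (Finset.sum_congr rfl fun β _ => Finset.sum_congr rfl fun i _ => ?_)
  rw [smul_comm]

/-- Integration against a measurable function of polynomial growth. -/
def integralMul {a : Phase → ℂ} (ha : Measurable a) (hb : PolyBounded a) : 𝓢(Phase, ℂ) →ₗ[ℂ] ℂ where
  toFun u := ∫ z, a z * u z
  map_add' u v := by
    rw [← integral_add (integrable_mul_schwartz ha.aestronglyMeasurable hb u)
      (integrable_mul_schwartz ha.aestronglyMeasurable hb v)]
    simp only [_root_.add_apply, mul_add]
  map_smul' r u := by
    simp only [_root_.smul_apply, smul_eq_mul, RingHom.id_apply, ← integral_const_mul,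
      mul_left_comm (a _) r]

lemma integralMul_apply {a : Phase → ℂ} (ha : Measurable a) (hb : PolyBounded a)
    (u : 𝓢(Phase, ℂ)) : integralMul ha hb u = ∫ z, a z * u z := rfl

include hφ hc hm in
/-- The expansion of a symbol in the Wigner functions of the eigenfunctions of its quantization
converges weakly against functions of polynomial growth. -/
lemma hasSum_integral_mul_wignerSpinor {a : Phase → ℂ} (ha : Measurable a)
    (hb : PolyBounded a) (s : Fin 4) :
    HasSum (fun i => (m i : ℂ) * ∫ z, a z * wignerSpinor c s (φ i) (φ i) z)
      (2 * ∫ z, a z * (g s z : ℂ)) := by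
  have hlim : Tendsto (fun I : Finset ℕ => ∑ α, ∑ β, pauli s α β *
      integralMul ha hb (wigner c (kernelRemainder c g φ m I β α))) atTop (𝓝 0) := by
    have : (0 : ℂ) = ∑ α : Fin 2, ∑ β : Fin 2, pauli s α β * 0 := by simp
    rw [this]
    exact tendsto_finsetSum _ fun α _ => tendsto_finsetSum _ fun β _ =>
      (tendsto_integral_mul_wigner_kernelRemainder hφ hc hm ha hb β α).const_mul _
  rw [HasSum, SummationFilter.unconditional_filter]
  have h4 := (tendsto_const_nhds (x := 2 * ∫ z, a z * (g s z : ℂ))).sub hlim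
  rw [sub_zero] at h4
  refine h4.congr fun I => ?_
  have h5 := congrArg (integralMul ha hb) (sum_wigner_kernelRemainder (c := c) (g := g) (φ := φ)
    (m := m) I s)
  simp only [map_sum, map_sub, map_smul, smul_eq_mul] at h5
  rw [h5]
  simp only [integralMul_apply, toComplex_apply, sub_sub_cancel]

include hφ hc hm in
/-- The trace of the product of a quantized symbol and of a Schwartz one. -/
lemma hasSum_trace {a : Symbol} (ha : a.Admissible ε) :
    HasSum (fun i => (m i : ℂ) * bracket (φ i) (weylOp ε a (φ i)))
      (((2 * Real.pi * ε : ℂ) ^ 2)⁻¹ * ∑ s, (2 * ∫ z, (a s z : ℂ) * (g s z : ℂ))) := by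
  have h := (hasSum_sum fun s (_ : s ∈ Finset.univ) => hasSum_integral_mul_wignerSpinor hφ hc hm
    (ha s).measurable (ha s).polyBounded s).mul_left (((2 * Real.pi * ε : ℂ) ^ 2)⁻¹)
  convert! h using 2 with i
  rw [bracket, integral_inner_weylOp hc ha, ← Finset.mul_sum]
  ring

end Expansion

end Graphene

/-! ### Double series, a scalar inequality for exponentials, and Hilbert-Schmidt norms -/

namespace Graphene

open SchwartzMap FourierTransform

section Series

lemma hasSum_prod_of_nonneg {f : ℕ × ℕ → ℝ} {r : ℕ → ℝ} {S : ℝ} (hf : ∀ z, 0 ≤ f z)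
    (hr : ∀ i, HasSum (fun j => f (i, j)) (r i)) (hS : HasSum r S) : HasSum f S := by
  have hsum : Summable f := by
    rw [summable_prod_of_nonneg hf]
    refine ⟨fun i => (hr i).summable, ?_⟩
    simp_rw [(hr _).tsum_eq]
    exact hS.summable
  have h := hsum.hasSum.prod_fiberwise hr
  rw [← h.unique hS]
  exact hsum.hasSum

/-- The terms have no fixed sign, so summability over pairs is not automatic from the iterated sums.
Writing `μ - ν` as `(l - ν) - (l - μ)` with a common upper bound `l` gives two series of nonnegative
terms, which may be summed in any order. -/
lemma hasSum_relative_entropy {p : ℕ × ℕ → ℝ} (hp : ∀ z, 0 ≤ p z)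
    (hp1 : ∀ i, HasSum (fun j => p (i, j)) 1) {a μ ν q : ℕ → ℝ} {l S T : ℝ} (ha : ∀ i, 0 ≤ a i)
    (hμ : ∀ i, μ i ≤ l) (hν : ∀ j, ν j ≤ l) (hsa : Summable a)
    (hS : HasSum (fun i => a i * μ i) S)
    (hq : ∀ i, HasSum (fun j => ν j * p (i, j)) (q i)) (hT : HasSum (fun i => a i * q i) T) :
    HasSum (fun z : ℕ × ℕ => a z.1 * (μ z.1 - ν z.2) * p z) (S - T) := by
  have h1 : HasSum (fun z : ℕ × ℕ => a z.1 * (l - ν z.2) * p z) ((∑' i, a i) * l - T) := by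
    refine hasSum_prod_of_nonneg (r := fun i => a i * (l * 1 - q i)) (fun z => mul_nonneg
      (mul_nonneg (ha _) (sub_nonneg.2 (hν _))) (hp z)) (fun i => ?_) ?_
    · convert! (((hp1 i).mul_left l).sub (hq i)).mul_left (a i) using 2 with j
      ring
    · convert! (hsa.hasSum.mul_right l).sub hT using 2 with i
      ring
  have h2 : HasSum (fun z : ℕ × ℕ => a z.1 * (l - μ z.1) * p z) ((∑' i, a i) * l - S) := by
    refine hasSum_prod_of_nonneg (r := fun i => a i * (l - μ i) * 1) (fun z => mul_nonneg
      (mul_nonneg (ha _) (sub_nonneg.2 (hμ _))) (hp z)) (fun i => (hp1 i).mul_left _) ?_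
    convert! (hsa.hasSum.mul_right l).sub hS using 2 with i
    ring
  have h3 := h1.sub h2
  have h4 : (∑' i, a i) * l - T - ((∑' i, a i) * l - S) = S - T := by ring
  rw [h4] at h3
  convert! h3 using 2 with z
  ring

/-- Below `l` the exponential is increasing with slope at most `exp l`, so one factor of the square
can be traded for `exp l * (μ - ν)`. -/
lemma sq_exp_sub_exp_le {μ ν l : ℝ} (hμ : μ ≤ l) (hν : ν ≤ l) :
    (Real.exp μ - Real.exp ν) ^ 2 ≤ Real.exp l * ((Real.exp μ - Real.exp ν) * (μ - ν)) := by
  wlog h : ν ≤ μ generalizing μ ν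
  · have := this hν hμ (le_of_not_ge h)
    linarith
  have h1 : Real.exp μ - Real.exp ν ≤ Real.exp μ * (μ - ν) := by
    have h2 := Real.add_one_le_exp (ν - μ)
    have h3 : Real.exp ν = Real.exp μ * Real.exp (ν - μ) := by rw [← Real.exp_add]; ring_nf
    rw [h3]
    nlinarith [Real.exp_pos μ]
  have h2 : Real.exp μ ≤ Real.exp l := Real.exp_le_exp.2 hμ
  have h3 : 0 ≤ Real.exp μ - Real.exp ν := sub_nonneg.2 (Real.exp_le_exp.2 h)
  have h4 : 0 ≤ μ - ν := sub_nonneg.2 h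
  calc (Real.exp μ - Real.exp ν) ^ 2 ≤ (Real.exp μ - Real.exp ν) * (Real.exp l * (μ - ν)) := by
        rw [sq]
        exact mul_le_mul_of_nonneg_left (h1.trans (by gcongr)) h3
    _ = _ := by ring

end Series

section HilbertSchmidt

lemma exists_lintegral_weylKernel_le (c : ℝˣ) : ∃ C : ENNReal, C ≠ ⊤ ∧
    ∀ f : 𝓢(Phase, ℂ), ∫⁻ z : Phase, ‖weylKernel c f z‖ₑ ^ 2 = C * ∫⁻ z, ‖f z‖ₑ ^ 2 := by
  obtain ⟨C₁, hC₁, h₁⟩ := exists_lintegral_comp_equiv midEquiv.symm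
  obtain ⟨C₂, hC₂, h₂⟩ := exists_lintegral_comp_equiv (scaleEquiv c)
  refine ⟨C₁ * C₂, ENNReal.mul_ne_top hC₁ hC₂, fun f => ?_⟩
  have h3 := lintegral_weight_partialFourier (w := fun _ => 1) measurable_const
    (compCLMOfContinuousLinearEquiv ℂ (scaleEquiv c) f)
  simp only [one_mul] at h3
  calc ∫⁻ z : Phase, ‖weylKernel c f z‖ₑ ^ 2
      = C₁ * ∫⁻ z, ‖partialFourier (compCLMOfContinuousLinearEquiv ℂ (scaleEquiv c) f) z‖ₑ ^ 2 :=
        h₁ fun z => ‖partialFourier (compCLMOfContinuousLinearEquiv ℂ (scaleEquiv c) f) z‖ₑ ^ 2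
    _ = C₁ * ∫⁻ z, ‖f (scaleEquiv c z)‖ₑ ^ 2 := by rw [h3]; rfl
    _ = _ := by rw [h₂ fun z => ‖f z‖ₑ ^ 2, mul_assoc]

lemma enorm_sum_sq_le {ι : Type*} (s : Finset ι) (f : ι → ℂ) :
    ‖∑ i ∈ s, f i‖ₑ ^ 2 ≤ s.card * ∑ i ∈ s, ‖f i‖ₑ ^ 2 := by
  have h1 : ‖∑ i ∈ s, f i‖ ^ 2 ≤ s.card * ∑ i ∈ s, ‖f i‖ ^ 2 :=
    (pow_le_pow_left₀ (norm_nonneg _) (norm_sum_le _ _) 2).trans sq_sum_le_card_mul_sum_sq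
  have h2 := ENNReal.ofReal_le_ofReal h1
  rw [ENNReal.ofReal_pow (norm_nonneg _), ENNReal.ofReal_mul (by positivity),
    ENNReal.ofReal_sum_of_nonneg (fun i _ => by positivity), ofReal_norm, ENNReal.ofReal_natCast]
    at h2
  convert! h2 using 3 with i
  rw [ENNReal.ofReal_pow (norm_nonneg _), ofReal_norm]

lemma norm_pauli_le (s : Fin 4) (α β : Fin 2) : ‖pauli s α β‖ₑ ≤ 1 := by
  rw [← ofReal_norm, ← ENNReal.ofReal_one]
  refine ENNReal.ofReal_le_ofReal ?_
  fin_cases s <;> fin_cases α <;> fin_cases β <;> simp [pauli]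

/-- The Hilbert-Schmidt norm of a quantized symbol, squared. -/
def hsNorm (c : ℝˣ) (g : WignerFun) : ENNReal :=
  ∑ α, ∑ β, ∫⁻ z : Phase, ‖kernel c g α β z‖ₑ ^ 2

/-- By Plancherel the Hilbert-Schmidt norm of the operator is comparable to the `L²` norm of its
symbol. This direction turns Schwartz bounds into bounds on eigenvalues; the converse below brings
operator convergence back to symbols. -/
lemma exists_hsNorm_le (c : ℝˣ) : ∃ C : ENNReal, C ≠ ⊤ ∧
    ∀ g : WignerFun, hsNorm c g ≤ C * ∑ s, ∫⁻ z, ‖g s z‖ₑ ^ 2 := by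
  obtain ⟨C, hC, h⟩ := exists_lintegral_weylKernel_le c
  refine ⟨4 * (C * 4), by finiteness, fun g => ?_⟩
  have h1 : ∀ α β, ∫⁻ z : Phase, ‖kernel c g α β z‖ₑ ^ 2 ≤
      C * 4 * ∑ s, ∫⁻ z, ‖g s z‖ₑ ^ 2 := by
    intro α β
    have hg := fun s => (g s).continuous
    rw [kernel, h, mul_assoc, ← lintegral_finsetSum _ (fun s _ => by have := hg s; fun_prop),
      ← lintegral_const_mul _ (Finset.measurable_fun_sum _ fun s _ => by have := hg s; fun_prop)]
    refine mul_le_mul_right (lintegral_mono fun z => ?_) _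
    rw [entry_apply]
    refine (enorm_sum_sq_le _ _).trans ?_
    rw [Finset.card_univ, Fintype.card_fin]
    push_cast
    gcongr with s
    rw [enorm_mul]
    refine (mul_le_of_le_one_left' (norm_pauli_le s α β)).trans (le_of_eq ?_)
    rw [← ofReal_norm, Complex.norm_real, ofReal_norm]
  calc hsNorm c g ≤ ∑ α : Fin 2, ∑ β : Fin 2, C * 4 * ∑ s, ∫⁻ z, ‖g s z‖ₑ ^ 2 :=
        Finset.sum_le_sum fun α _ => Finset.sum_le_sum fun β _ => h1 α β
    _ = _ := by
      simp only [Finset.sum_const, Finset.card_univ, Fintype.card_fin, nsmul_eq_mul]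
      push_cast
      ring

lemma exists_lintegral_le_hsNorm (c : ℝˣ) : ∃ C : ENNReal, C ≠ ⊤ ∧
    ∀ (g : WignerFun) (s : Fin 4), ∫⁻ z, ‖g s z‖ₑ ^ 2 ≤ C * hsNorm c g := by
  -- The exponent `0` makes the weight trivial and leaves the plain `L²` bound for the Wigner
  -- transform.
  obtain ⟨C, hC, h⟩ := exists_lintegral_fst_wigner_le c 0
  refine ⟨4 * (C * 2), by finiteness, fun g s => ?_⟩
  simp only [pow_zero, one_mul, ← two_mul] at h
  have hw := fun α β => (wigner c (kernel c g β α)).continuous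
  have h1 : ∀ z, ‖g s z‖ₑ ^ 2 ≤ 4 * ∑ α, ∑ β, ‖wigner c (kernel c g β α) z‖ₑ ^ 2 := by
    intro z
    have h2 := sum_wigner_kernel c g s z
    have h3 : ‖g s z‖ₑ ^ 2 ≤ ‖(2 : ℂ) * (g s z : ℂ)‖ₑ ^ 2 := by
      gcongr
      rw [enorm_mul, ← ofReal_norm (g s z : ℂ), Complex.norm_real, ofReal_norm]
      refine le_mul_of_one_le_left' ?_
      rw [← ofReal_norm, ← ENNReal.ofReal_one]
      exact ENNReal.ofReal_le_ofReal (by simp)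
    refine h3.trans ?_
    rw [← h2]
    refine (enorm_sum_sq_le _ _).trans ?_
    have h4 : (4 : ENNReal) = 2 * 2 := by norm_num
    rw [Finset.card_univ, Fintype.card_fin, h4, mul_assoc, Finset.mul_sum _ _ (2 : ENNReal)]
    push_cast
    gcongr with α
    refine (enorm_sum_sq_le _ _).trans ?_
    rw [Finset.card_univ, Fintype.card_fin]
    push_cast
    gcongr with β
    rw [enorm_mul]
    exact mul_le_of_le_one_left' (norm_pauli_le s α β)
  calc ∫⁻ z, ‖g s z‖ₑ ^ 2 ≤ ∫⁻ z, 4 * ∑ α, ∑ β, ‖wigner c (kernel c g β α) z‖ₑ ^ 2 :=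
        lintegral_mono h1
    _ = 4 * ∑ α, ∑ β, ∫⁻ z, ‖wigner c (kernel c g β α) z‖ₑ ^ 2 := by
        rw [lintegral_const_mul _ (Finset.measurable_fun_sum _ fun α _ =>
          Finset.measurable_fun_sum _ fun β _ => by have := hw α β; fun_prop),
          lintegral_finsetSum _ fun α _ => Finset.measurable_fun_sum _ fun β _ => by
            have := hw α β; fun_prop]
        congr 1
        refine Finset.sum_congr rfl fun α _ => ?_
        rw [lintegral_finsetSum _ fun β _ => by have := hw α β; fun_prop]
    _ ≤ 4 * ∑ α, ∑ β, C * (2 * ∫⁻ z, ‖kernel c g β α z‖ₑ ^ 2) := by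
        refine mul_le_mul_right (Finset.sum_le_sum fun α _ => Finset.sum_le_sum fun β _ => h _) _
    _ = _ := by
        rw [hsNorm, Finset.sum_comm]
        simp_rw [← mul_assoc C 2, ← Finset.mul_sum, mul_assoc]

lemma hsNorm_lt_top (c : ℝˣ) (g : WignerFun) : hsNorm c g < ⊤ := by
  refine ENNReal.sum_lt_top.2 fun α _ => ENNReal.sum_lt_top.2 fun β _ => ?_
  simpa using lintegral_weight_lt_top 0 (kernel c g α β)

variable {φ : ℕ → 𝓢(Plane, Spinor)} {ε : ℝ} {c : ℝˣ}

lemma measurable_weylOp_toSymbol (hc : (c : ℝ) = 2 * Real.pi * ε) (g : WignerFun)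
    (f : 𝓢(Plane, Spinor)) (α : Fin 2) : Measurable fun x => weylOp ε g.toSymbol f x α := by
  simp only [← rowApply_kernel hc]
  exact (continuous_rowApply _ _).measurable

/-- The right-hand side does not involve the basis, so the norm of a difference of two exponentials
may be computed in the eigenbasis of either one. -/
lemma IsSchwartzBasis.tsum_lintegral_weylOp (hφ : IsSchwartzBasis φ)
    (hc : (c : ℝ) = 2 * Real.pi * ε) (g : WignerFun) :
    ∑' i, ∫⁻ x, ‖weylOp ε g.toSymbol (φ i) x‖ₑ ^ 2 = hsNorm c g := by
  have hm := fun i α => (measurable_weylOp_toSymbol hc g (φ i) α).enorm.pow_const 2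
  have h1 : ∀ α, ∑ β, ∫⁻ z : Phase, ‖kernel c g α β z‖ₑ ^ 2 =
      ∑' i, ∫⁻ x, ‖weylOp ε g.toSymbol (φ i) x α‖ₑ ^ 2 := fun α => by
    have h := hφ.lintegral_weight_row (kernel c g α) 0
    simpa only [pow_zero, one_mul, rowApply_kernel hc] using h
  have h2 : ∀ i, ∫⁻ x, ‖weylOp ε g.toSymbol (φ i) x‖ₑ ^ 2 =
      ∑ α, ∫⁻ x, ‖weylOp ε g.toSymbol (φ i) x α‖ₑ ^ 2 := fun i => by
    rw [← lintegral_finsetSum _ fun α _ => hm i α]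
    exact lintegral_congr fun x => enorm_sq_spinor _
  rw [hsNorm, Finset.sum_congr rfl fun α _ => h1 α, tsum_congr h2]
  exact Summable.tsum_finsetSum fun α _ => ENNReal.summable

/-- Quantized Schwartz symbols map Schwartz functions to square-integrable ones. -/
lemma IsSchwartzBasis.memLp_weylOp (hφ : IsSchwartzBasis φ) (hc : (c : ℝ) = 2 * Real.pi * ε)
    (g : WignerFun) (i : ℕ) : MemLp (weylOp ε g.toSymbol (φ i)) 2 volume := by
  have h1 : ∫⁻ x, ‖weylOp ε g.toSymbol (φ i) x‖ₑ ^ 2 < ⊤ := by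
    refine lt_of_le_of_lt ?_ (hsNorm_lt_top c g)
    rw [← hφ.tsum_lintegral_weylOp hc g]
    exact ENNReal.le_tsum i
  have hm : AEStronglyMeasurable (weylOp ε g.toSymbol (φ i)) volume := by
    have h2 : Measurable fun x => (weylOp ε g.toSymbol (φ i) x).ofLp :=
      measurable_pi_iff.2 fun α => measurable_weylOp_toSymbol hc g (φ i) α
    exact ((PiLp.continuous_toLp 2 (fun _ : Fin 2 => ℂ)).measurable.comp h2).aestronglyMeasurable
  refine ⟨hm, ?_⟩
  rw [eLpNorm_lt_top_iff_lintegral_rpow_enorm_lt_top (by norm_num) (by norm_num)]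
  simpa using h1

end HilbertSchmidt

end Graphene

/-! ### The entropy estimate for quantum exponentials -/

namespace Graphene

open SchwartzMap FourierTransform

/-- The eigenvalues and eigenfunctions of a quantum exponential. -/
structure IsEigenExp (ε : ℝ) (a : Symbol) (g : WignerFun) (φ : ℕ → 𝓢(Plane, Spinor)) (μ : ℕ → ℝ) :
    Prop where
  memLp : ∀ ψ : 𝓢(Plane, Spinor), MemLp (weylOp ε a ψ) 2 volume
  basis : IsSchwartzBasis φ
  eigen : ∀ i x, weylOp ε a (φ i) x = (μ i : ℂ) • φ i x
  eigen_exp : ∀ i x, weylOp ε g.toSymbol (φ i) x = (Real.exp (μ i) : ℂ) • φ i x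

lemma IsQuantumExp.exists_isEigenExp {ε : ℝ} {a : Symbol} {g : WignerFun}
    (h : IsQuantumExp ε a g) : ∃ φ μ, IsEigenExp ε a g φ μ := by
  obtain ⟨h1, φ, μ, b, hb, h2, h3⟩ := h
  exact ⟨φ, μ, h1, isSchwartzBasis_of_hilbertBasis b hb, h2, h3⟩

lemma weylAdmissible_const {ε : ℝ} (hε : 0 < ε) (r : ℂ) : WeylAdmissible ε (fun _ => r) := by
  have hc0 : 2 * Real.pi * ε ≠ 0 := by positivity
  have h1 := weylAdmissible_fst_mul_snd (c := Units.mk0 _ hc0) rfl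
    (Function.HasTemperateGrowth.const r) (q := fun _ : Plane => (1 : ℂ))
      measurable_const ⟨1, 0, zero_le_one, fun p => by simp⟩
  simpa using h1

/-- The symbol of the identity. -/
def oneSymbol : Symbol := Fin.cons (fun _ => 1) fun _ _ => 0

lemma admissible_oneSymbol {ε : ℝ} (hε : 0 < ε) : oneSymbol.Admissible ε :=
  Fin.cases (by simpa [oneSymbol] using weylAdmissible_const hε 1)
    fun s => by simpa [oneSymbol] using weylAdmissible_const hε 0

/-- The integral of a Wigner transform. -/
lemma integral_wigner (c : ℝˣ) (E : 𝓢(Phase, ℂ)) :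
    ∫ z, wigner c E z = ((c : ℝ) : ℂ) ^ 2 * ∫ r, E (r, r) := by
  rw [Measure.volume_eq_prod, integral_prod _ ((wigner c E).integrable (μ := volume)),
    ← integral_const_mul]
  refine integral_congr_ae (Eventually.of_forall fun r => ?_)
  set F := compCLMOfContinuousLinearEquiv ℂ midEquiv E with hF
  have h1 := Measure.integral_comp_smul (volume : Measure Plane)
    (fun p => partialFourierInv F (r, p)) ((c⁻¹ : ℝˣ) : ℝ)
  have h2 : ∫ p, partialFourierInv F (r, p) = F (r, 0) := by
    conv_rhs => rw [← partialFourier_partialFourierInv F, partialFourier_apply]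
    simp
  have hc2 : |(((c⁻¹ : ℝˣ) : ℝ) ^ Module.finrank ℝ Plane)⁻¹| = (c : ℝ) ^ 2 := by
    rw [finrank_euclideanSpace, Fintype.card_fin, abs_of_nonneg (by positivity),
      Units.val_inv_eq_inv_val]
    simp
  rw [hc2, h2] at h1
  change ∫ p, partialFourierInv F (r, ((c⁻¹ : ℝˣ) : ℝ) • p) = _
  rw [h1, Complex.real_smul, Complex.ofReal_pow]
  congr 1
  change E (midEquiv (r, 0)) = _
  simp

/-- Serves to apply the trace formula to the identity symbol, which makes the eigenvalues of the
exponential summable. -/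
lemma bracket_weylOp_one {ε : ℝ} (hε : 0 < ε) (f : 𝓢(Plane, Spinor)) :
    bracket f (weylOp ε oneSymbol f) = bracket f f := by
  have hc0 : 2 * Real.pi * ε ≠ 0 := by positivity
  have hc : ((Units.mk0 _ hc0 : ℝˣ) : ℝ) = 2 * Real.pi * ε := rfl
  set c := Units.mk0 _ hc0
  have hi : ∀ β, Integrable fun x => f x β * (starRingEnd ℂ) (f x β) := fun β =>
    integrable_mul_schwartz (comp β f).continuous.aestronglyMeasurable
      ⟨SchwartzMap.seminorm ℝ 0 0 (comp β f), 0, by positivity, fun z => by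
        simpa using (comp β f).norm_le_seminorm ℝ z⟩ (conj (comp β f))
  have hw : ∀ z, wignerSpinor c 0 f f z =
      ∑ β, wigner c (tensor (comp β f) (conj (comp β f))) z := fun z => by
    rw [wignerSpinor_apply]
    simp [pauli, Matrix.one_apply]
  rw [bracket, integral_inner_weylOp hc (admissible_oneSymbol hε), Fin.sum_univ_succ]
  simp only [oneSymbol, Fin.cons_zero, Fin.cons_succ, Complex.ofReal_zero, zero_mul, integral_zero,
    Finset.sum_const_zero, add_zero, Complex.ofReal_one, one_mul, hw]
  rw [integral_finsetSum _ fun β _ => (wigner c _).integrable (μ := volume)]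
  simp only [integral_wigner, tensor_apply, conj_apply, comp_apply]
  rw [← Finset.mul_sum, ← integral_finsetSum _ fun β _ => hi β, hc]
  push_cast
  rw [inv_mul_cancel_left₀ (by exact_mod_cast pow_ne_zero 2 hc0), bracket]
  refine integral_congr_ae (Eventually.of_forall fun x => ?_)
  simp only [PiLp.inner_apply, RCLike.inner_apply]

/-- The pairing of a symbol and of a Schwartz symbol, which is the trace of the product of their
quantizations. -/
def tracePairing (ε : ℝ) (a : Symbol) (g : WignerFun) : ℝ :=
  ((2 * Real.pi * ε) ^ 2)⁻¹ * ∑ s, (2 * ∫ z, a s z * g s z)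

section

variable {ε : ℝ} {c : ℝˣ} {a a₁ a₂ : Symbol} {g g₁ g₂ : WignerFun}
  {φ ψ : ℕ → 𝓢(Plane, Spinor)} {μ ν : ℕ → ℝ}

lemma IsSchwartzBasis.hasSum_trace_re (hφ : IsSchwartzBasis φ) (hc : (c : ℝ) = 2 * Real.pi * ε)
    {m : ℕ → ℝ} (hm : ∀ i x, weylOp ε g.toSymbol (φ i) x = (m i : ℂ) • φ i x)
    (ha : a.Admissible ε) :
    HasSum (fun i => m i * (bracket (φ i) (weylOp ε a (φ i))).re) (tracePairing ε a g) := by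
  have h := (Complex.hasSum_iff _ _).1 (hasSum_trace hφ hc hm ha) |>.1
  convert! h using 2 with i
  · rw [Complex.re_ofReal_mul]
  · have h1 : (((2 * Real.pi * ε : ℂ) ^ 2)⁻¹ * ∑ s, (2 * ∫ z, (a s z : ℂ) * (g s z : ℂ))) =
        ((tracePairing ε a g : ℝ) : ℂ) := by
      simp only [tracePairing, ← Complex.ofReal_mul, integral_complex_ofReal]
      push_cast
      rfl
    rw [h1, Complex.ofReal_re]

lemma bracket_weylOp_symm (hε : 0 < ε) (ha : a.Admissible ε) (f h : 𝓢(Plane, Spinor)) :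
    bracket h (weylOp ε a f) = bracket (weylOp ε a h) f :=
  integral_inner_weylOp_symm hε ha f h

/-- Self-adjointness of the unbounded operator is not needed. Since it maps Schwartz functions into
`L²`, Parseval applies to the pairing of `f` with its image, and symmetry moves the operator onto
the Schwartz eigenfunctions. -/
lemma IsEigenExp.hasSum_re (h : IsEigenExp ε a g ψ ν) (hε : 0 < ε) (ha : a.Admissible ε)
    (f : 𝓢(Plane, Spinor)) :
    HasSum (fun j => ν j * ‖bracket f (ψ j)‖ ^ 2) (bracket f (weylOp ε a f)).re := by
  have h1 := h.basis.hasSum_bracket (f.memLp 2 volume) (h.memLp f)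
  have h2 := ((Complex.hasSum_iff _ _).1 h1).1
  convert! h2 using 2 with j
  have h3 : weylOp ε a (ψ j) = fun x => (ν j : ℂ) • ψ j x := funext (h.eigen j)
  rw [bracket_weylOp_symm hε ha, h3, bracket_smul_left, Complex.conj_ofReal, ← conj_bracket f,
    mul_left_comm, Complex.mul_conj, Complex.re_ofReal_mul, Complex.ofReal_re,
    Complex.normSq_eq_norm_sq]

lemma IsEigenExp.re_bracket (h : IsEigenExp ε a g φ μ) (i : ℕ) :
    (bracket (φ i) (weylOp ε a (φ i))).re = μ i := by
  have h3 : weylOp ε a (φ i) = fun x => (μ i : ℂ) • φ i x := funext (h.eigen i)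
  rw [h3, bracket_smul_right, h.basis.bracket_eq]
  simp

lemma IsEigenExp.hasSum_exp_mul (h : IsEigenExp ε a g φ μ) (hc : (c : ℝ) = 2 * Real.pi * ε)
    (ha : a.Admissible ε) :
    HasSum (fun i => Real.exp (μ i) * μ i) (tracePairing ε a g) := by
  have h1 := h.basis.hasSum_trace_re hc h.eigen_exp ha
  simpa only [h.re_bracket] using h1

lemma IsSchwartzBasis.hasSum_norm_bracket (hψ : IsSchwartzBasis ψ) (hφ : IsSchwartzBasis φ) (i : ℕ) :
    HasSum (fun j => ‖bracket (φ i) (ψ j)‖ ^ 2) 1 := by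
  have h1 := hψ.hasSum_sq ((φ i).memLp 2 volume)
  have h2 := hφ.bracket_eq i i
  rw [bracket_self_eq, if_pos rfl] at h2
  simp_rw [norm_bracket_symm (φ i)]
  have h3 : ∫ x, ‖φ i x‖ ^ 2 = 1 := by exact_mod_cast h2
  rwa [h3] at h1

lemma IsEigenExp.summable_exp (h : IsEigenExp ε a g φ μ) (hε : 0 < ε)
    (hc : (c : ℝ) = 2 * Real.pi * ε) : Summable fun i => Real.exp (μ i) := by
  have h1 := h.basis.hasSum_trace_re hc h.eigen_exp (admissible_oneSymbol hε)
  simp only [bracket_weylOp_one hε, h.basis.bracket_eq, if_true, Complex.one_re, mul_one] at h1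
  exact h1.summable

lemma IsEigenExp.exp_sq_le (h : IsEigenExp ε a g φ μ) (hc : (c : ℝ) = 2 * Real.pi * ε) (i : ℕ) :
    ENNReal.ofReal (Real.exp (μ i) ^ 2) ≤ hsNorm c g := by
  rw [← h.basis.tsum_lintegral_weylOp hc g]
  refine le_trans (le_of_eq ?_) (ENNReal.le_tsum i)
  simp_rw [h.eigen_exp, enorm_smul, mul_pow]
  have h2 := h.basis.bracket_eq i i
  rw [bracket_self_eq, if_pos rfl] at h2
  have h3 : ∫ x, ‖φ i x‖ ^ 2 = 1 := by exact_mod_cast h2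
  have hφ := (φ i).continuous
  rw [lintegral_const_mul _ (by fun_prop), lintegral_enorm_sq_eq ((φ i).memLp 2 volume), h3,
    ENNReal.ofReal_one, mul_one, ENNReal.ofReal_pow (Real.exp_pos _).le, ← ofReal_norm,
    Complex.norm_real, Real.norm_of_nonneg (Real.exp_pos _).le]

lemma kernel_sub (α β : Fin 2) : kernel c (g₁ - g₂) α β = kernel c g₁ α β - kernel c g₂ α β := by
  have : entry (g₁ - g₂) α β = entry g₁ α β - entry g₂ α β := by
    simp only [entry, Pi.sub_apply, map_sub, smul_sub, Finset.sum_sub_distrib]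
  rw [kernel, this, map_sub]
  rfl

lemma weylOp_sub (hc : (c : ℝ) = 2 * Real.pi * ε) (f : 𝓢(Plane, Spinor)) (x : Plane) :
    weylOp ε (g₁ - g₂).toSymbol f x = weylOp ε g₁.toSymbol f x - weylOp ε g₂.toSymbol f x := by
  ext α
  rw [PiLp.sub_apply]
  simp only [weylOp_toSymbol_apply hc, kernel_sub, _root_.sub_apply, sub_mul]
  rw [← Finset.sum_sub_distrib]
  refine Finset.sum_congr rfl fun β _ => ?_
  exact integral_sub (integrable_row_mul_spinor _ x f β) (integrable_row_mul_spinor _ x f β)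

lemma integrable_mul_toSymbol (ha : a.Admissible ε) (g : WignerFun) (s : Fin 4) :
    Integrable fun z => a s z * g s z := by
  have h := (integrable_mul_schwartz (μ := volume) (ha s).measurable.aestronglyMeasurable
    (ha s).polyBounded (toComplex (g s))).re
  simpa using h

lemma tracePairing_sub_sub (h₁ : a₁.Admissible ε) (h₂ : a₂.Admissible ε) :
    tracePairing ε a₁ g₁ - tracePairing ε a₂ g₁ + (tracePairing ε a₂ g₂ - tracePairing ε a₁ g₂) =
      ((2 * Real.pi * ε) ^ 2)⁻¹ * (2 * ∑ s, ∫ z, (a₁ s z - a₂ s z) * (g₁ s z - g₂ s z)) := by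
  have h3 : ∀ s, ∫ z, (a₁ s z - a₂ s z) * (g₁ s z - g₂ s z) =
      (∫ z, a₁ s z * g₁ s z) - (∫ z, a₂ s z * g₁ s z) +
        ((∫ z, a₂ s z * g₂ s z) - ∫ z, a₁ s z * g₂ s z) := by
    intro s
    have i1 := integrable_mul_toSymbol h₁ g₁ s
    have i2 := integrable_mul_toSymbol h₂ g₁ s
    have i3 := integrable_mul_toSymbol h₂ g₂ s
    have i4 := integrable_mul_toSymbol h₁ g₂ s
    have i5 : Integrable fun z => a₁ s z * g₁ s z - a₂ s z * g₁ s z := i1.sub i2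
    have i6 : Integrable fun z => a₂ s z * g₂ s z - a₁ s z * g₂ s z := i3.sub i4
    rw [← integral_sub i1 i2, ← integral_sub i3 i4, ← integral_add i5 i6]
    refine integral_congr_ae (Eventually.of_forall fun z => ?_)
    simp only []
    ring
  simp only [tracePairing, h3, ← Finset.mul_sum, Finset.sum_add_distrib, Finset.sum_sub_distrib]
  ring

/-- The Hilbert-Schmidt distance of two quantum exponentials is controlled by the pairing of the
differences of the exponents and of the exponentials. -/
theorem hsNorm_sub_le (hε : 0 < ε) (hc : (c : ℝ) = 2 * Real.pi * ε) (ha₁ : a₁.Admissible ε)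
    (ha₂ : a₂.Admissible ε) (h₁ : IsEigenExp ε a₁ g₁ φ μ) (h₂ : IsEigenExp ε a₂ g₂ ψ ν) {l : ℝ}
    (hμ : ∀ i, μ i ≤ l) (hν : ∀ j, ν j ≤ l) :
    hsNorm c (g₁ - g₂) ≤ ENNReal.ofReal (Real.exp l * (((2 * Real.pi * ε) ^ 2)⁻¹ *
      (2 * ∑ s, ∫ z, (a₁ s z - a₂ s z) * (g₁ s z - g₂ s z)))) := by
  -- The overlaps of the two eigenbases have unit row and column sums. This series is the trace of
  -- `exp H₁ (H₁ - H₂)` and the next one that of `exp H₂ (H₂ - H₁)`; in their sum the terms `(exp μ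
  -- - exp ν)(μ - ν)` are nonnegative.
  have hp := hasSum_relative_entropy (p := fun z => ‖bracket (φ z.1) (ψ z.2)‖ ^ 2)
    (fun z => by positivity) (h₂.basis.hasSum_norm_bracket h₁.basis) (fun i => (Real.exp_pos _).le)
    hμ hν (h₁.summable_exp hε hc) (h₁.hasSum_exp_mul hc ha₁)
    (fun i => h₂.hasSum_re hε ha₂ (φ i)) (h₁.basis.hasSum_trace_re hc h₁.eigen_exp ha₂)
  have hq := hasSum_relative_entropy (p := fun z => ‖bracket (ψ z.1) (φ z.2)‖ ^ 2)
    (fun z => by positivity) (h₁.basis.hasSum_norm_bracket h₂.basis) (fun i => (Real.exp_pos _).le)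
    hν hμ (h₂.summable_exp hε hc) (h₂.hasSum_exp_mul hc ha₂)
    (fun i => h₁.hasSum_re hε ha₁ (ψ i)) (h₂.basis.hasSum_trace_re hc h₂.eigen_exp ha₁)
  have hD := hp.add ((Equiv.prodComm ℕ ℕ).hasSum_iff.2 hq)
  rw [tracePairing_sub_sub ha₁ ha₂] at hD
  set D := ((2 * Real.pi * ε) ^ 2)⁻¹ *
      (2 * ∑ s, ∫ z, (a₁ s z - a₂ s z) * (g₁ s z - g₂ s z))
  set F : ℕ × ℕ → ℝ := fun z => Real.exp l * ((Real.exp (μ z.1) - Real.exp (ν z.2)) *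
    (μ z.1 - ν z.2) * ‖bracket (φ z.1) (ψ z.2)‖ ^ 2) with hF
  have hFs : HasSum F (Real.exp l * D) := by
    convert! hD.mul_left (Real.exp l) using 2 with z
    simp only [hF, Function.comp_apply, Equiv.prodComm_apply, Prod.fst_swap, Prod.snd_swap,
      norm_bracket_symm (ψ z.2)]
    ring
  -- The matrix entry of `exp H₁ - exp H₂` between the two eigenbases is `(exp μ - exp ν)` times the
  -- overlap: the first exponential acts on the left vector by symmetry, the second on the right
  -- one.
  have hle : ∀ z : ℕ × ℕ, ‖bracket (φ z.1) (weylOp ε (g₁ - g₂).toSymbol (ψ z.2))‖ ^ 2 ≤ F z := by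
    intro z
    have e1 : bracket (φ z.1) (weylOp ε (g₁ - g₂).toSymbol (ψ z.2)) =
        ((Real.exp (μ z.1) - Real.exp (ν z.2) : ℝ) : ℂ) * bracket (φ z.1) (ψ z.2) := by
      have e2 : weylOp ε (g₁ - g₂).toSymbol (ψ z.2) = fun x =>
          weylOp ε g₁.toSymbol (ψ z.2) x - weylOp ε g₂.toSymbol (ψ z.2) x :=
        funext (weylOp_sub hc (ψ z.2))
      have m1 := h₂.basis.memLp_weylOp hc g₁ z.2
      have m2 := h₂.basis.memLp_weylOp hc g₂ z.2
      have e3 : weylOp ε g₂.toSymbol (ψ z.2) = fun x => (Real.exp (ν z.2) : ℂ) • ψ z.2 x :=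
        funext (h₂.eigen_exp z.2)
      have e4 : weylOp ε g₁.toSymbol (φ z.1) = fun x => (Real.exp (μ z.1) : ℂ) • φ z.1 x :=
        funext (h₁.eigen_exp z.1)
      have e5 : bracket (φ z.1) (weylOp ε (g₁ - g₂).toSymbol (ψ z.2)) =
          bracket (φ z.1) (weylOp ε g₁.toSymbol (ψ z.2)) -
            bracket (φ z.1) (weylOp ε g₂.toSymbol (ψ z.2)) := by
        rw [e2]
        simp only [bracket, inner_sub_right]
        exact integral_sub (integrable_inner ((φ z.1).memLp 2 volume) m1)
          (integrable_inner ((φ z.1).memLp 2 volume) m2)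
      rw [e5, bracket_weylOp_symm hε (admissible_toSymbol ε g₁), e4, e3, bracket_smul_left,
        bracket_smul_right, Complex.conj_ofReal]
      push_cast
      ring
    rw [e1, norm_mul, mul_pow, Complex.norm_real, Real.norm_eq_abs, sq_abs]
    simp only [hF]
    rw [← mul_assoc]
    gcongr
    exact sq_exp_sub_exp_le (hμ _) (hν _)
  have hF0 : ∀ z, 0 ≤ F z := fun z => le_trans (by positivity) (hle z)
  calc hsNorm c (g₁ - g₂) = ∑' j, ∫⁻ x, ‖weylOp ε (g₁ - g₂).toSymbol (ψ j) x‖ₑ ^ 2 :=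
        (h₂.basis.tsum_lintegral_weylOp hc _).symm
    _ = ∑' j, ∑' i, ‖bracket (φ i) (weylOp ε (g₁ - g₂).toSymbol (ψ j))‖ₑ ^ 2 :=
        tsum_congr fun j => h₁.basis.lintegral_eq_tsum (h₂.basis.memLp_weylOp hc _ j)
    _ ≤ ∑' j, ∑' i, ENNReal.ofReal (F (i, j)) := by
        refine ENNReal.tsum_le_tsum fun j => ENNReal.tsum_le_tsum fun i => ?_
        rw [← ofReal_norm, ← ENNReal.ofReal_pow (norm_nonneg _)]
        exact ENNReal.ofReal_le_ofReal (hle (i, j))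
    _ = ∑' z, ENNReal.ofReal (F z) := by rw [ENNReal.tsum_comm, ENNReal.tsum_prod']
    _ = _ := by rw [← ENNReal.ofReal_tsum_of_nonneg hF0 hFs.summable, hFs.tsum_eq]

end

end Graphene

/-! ### Time reversal and the symmetry of equilibria -/

namespace Graphene

open SchwartzMap FourierTransform

/-- Time reversal of spinors, `(v₀, v₁) ↦ (-conj v₁, conj v₀)`. -/
def timeReversal : Spinor ≃ₗᵢ[ℝ] Spinor where
  toFun v := WithLp.toLp 2 ![-(starRingEnd ℂ) (v 1), (starRingEnd ℂ) (v 0)]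
  invFun v := WithLp.toLp 2 ![(starRingEnd ℂ) (v 1), -(starRingEnd ℂ) (v 0)]
  map_add' v w := by
    ext i
    fin_cases i <;> simp
    ring
  map_smul' r v := by
    ext i
    fin_cases i <;> simp
  left_inv v := by
    ext i
    fin_cases i <;> simp
  right_inv v := by
    ext i
    fin_cases i <;> simp
  norm_map' v := by
    simp [EuclideanSpace.norm_eq, add_comm]

lemma timeReversal_zero (v : Spinor) : timeReversal v 0 = -(starRingEnd ℂ) (v 1) := rfl

lemma timeReversal_one (v : Spinor) : timeReversal v 1 = (starRingEnd ℂ) (v 0) := rfl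

lemma timeReversal_smul (r : ℂ) (v : Spinor) :
    timeReversal (r • v) = (starRingEnd ℂ) r • timeReversal v := by
  ext i
  fin_cases i
  · simp [timeReversal_zero]
  · simp [timeReversal_one]

lemma inner_timeReversal (v w : Spinor) :
    inner ℂ (timeReversal v) (timeReversal w) = inner ℂ w v := by
  simp only [PiLp.inner_apply, RCLike.inner_apply, Fin.sum_univ_two, timeReversal_zero,
    timeReversal_one, map_neg, Complex.conj_conj]
  ring

lemma inner_timeReversal_right (v w : Spinor) :
    inner ℂ v (timeReversal w) = inner ℂ w (timeReversal.symm v) := by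
  rw [← inner_timeReversal (timeReversal.symm v) w, LinearIsometryEquiv.apply_symm_apply]

lemma inner_timeReversal_left (v w : Spinor) :
    inner ℂ (timeReversal v) w = inner ℂ (timeReversal.symm w) v := by
  rw [← inner_timeReversal v (timeReversal.symm w), LinearIsometryEquiv.apply_symm_apply]

/-- Time reversal of Schwartz spinors. -/
def timeReversalCLM : 𝓢(Plane, Spinor) →L[ℝ] 𝓢(Plane, Spinor) :=
  postcompCLM (𝕜 := ℝ) (timeReversal.toContinuousLinearEquiv : Spinor →L[ℝ] Spinor)

lemma timeReversalCLM_apply (φ : 𝓢(Plane, Spinor)) (x : Plane) :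
    timeReversalCLM φ x = timeReversal (φ x) := rfl

lemma memLp_timeReversal_symm {f : Plane → Spinor} (hf : MemLp f 2 volume) :
    MemLp (fun x => timeReversal.symm (f x)) 2 volume :=
  (timeReversal.symm.toContinuousLinearEquiv : Spinor →L[ℝ] Spinor).comp_memLp' hf

/-- Time reversal is antiunitary: it exchanges the two arguments of an inner product, so the
expansion is the old one with the roles of `f` and `g` interchanged. -/
lemma IsSchwartzBasis.timeReversal {φ : ℕ → 𝓢(Plane, Spinor)} (hφ : IsSchwartzBasis φ) :
    IsSchwartzBasis fun i => timeReversalCLM (φ i) where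
  hasSum_bracket {f g} hf hg := by
    have h := hφ.hasSum_bracket (memLp_timeReversal_symm hg) (memLp_timeReversal_symm hf)
    have h1 : ∀ i, bracket f (timeReversalCLM (φ i)) =
        bracket (φ i) (fun x => Graphene.timeReversal.symm (f x)) := fun i => by
      simp only [bracket, timeReversalCLM_apply, inner_timeReversal_right]
    have h2 : ∀ i, bracket (timeReversalCLM (φ i)) g =
        bracket (fun x => Graphene.timeReversal.symm (g x)) (φ i) := fun i => by
      simp only [bracket, timeReversalCLM_apply, inner_timeReversal_left]
    have h3 : bracket f g = bracket (fun x => Graphene.timeReversal.symm (g x))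
        (fun x => Graphene.timeReversal.symm (f x)) := by
      simp only [bracket]
      refine integral_congr_ae (Eventually.of_forall fun x => ?_)
      simp only []
      rw [← inner_timeReversal (Graphene.timeReversal.symm (f x)),
        LinearIsometryEquiv.apply_symm_apply, LinearIsometryEquiv.apply_symm_apply]
    simp only [h1, h2, h3]
    simpa only [mul_comm] using h
  bracket_eq i j := by
    have h := hφ.bracket_eq j i
    simp only [bracket, timeReversalCLM_apply, inner_timeReversal] at h ⊢
    rw [h]
    simp only [eq_comm]

/-- The sign by which time reversal multiplies a Pauli matrix. -/
def pauliSign (s : Fin 4) : ℝ := if s = 0 then 1 else -1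

lemma pauliSign_mul_self (s : Fin 4) : pauliSign s * pauliSign s = 1 := by
  unfold pauliSign
  split_ifs <;> norm_num

/-- Time reversal of symbols, `(a₀, a⃗)(r, p) ↦ (a₀, -a⃗)(r, -p)`. -/
def Symbol.reverse (a : Symbol) : Symbol := fun s z => pauliSign s * a s (z.1, -z.2)

/-- The reflection `(r, p) ↦ (r, -p)`. -/
def reflectEquiv : Phase ≃L[ℝ] Phase :=
  (ContinuousLinearEquiv.refl ℝ Plane).prodCongr (ContinuousLinearEquiv.neg ℝ)

/-- Time reversal of Schwartz symbols. -/
def WignerFun.reverse (g : WignerFun) : WignerFun := fun s =>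
  pauliSign s • compCLMOfContinuousLinearEquiv ℝ reflectEquiv (g s)

lemma WignerFun.reverse_apply (g : WignerFun) (s : Fin 4) (z : Phase) :
    g.reverse s z = pauliSign s * g s (z.1, -z.2) := rfl

lemma WignerFun.toSymbol_reverse (g : WignerFun) : g.reverse.toSymbol.reverse = g.toSymbol := by
  funext s z
  simp only [Symbol.reverse, WignerFun.toSymbol, WignerFun.reverse_apply, neg_neg, ← mul_assoc,
    pauliSign_mul_self, one_mul]

/-- Time reversal is complex conjugation followed by `-iσ₂`; it commutes with the identity and
anticommutes with each of `σ₁, σ₂, σ₃`. -/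
lemma toMatrix_mulVec_timeReversal (a : Symbol) (z : Phase) (v : Spinor) :
    WithLp.toLp 2 (a.toMatrix z *ᵥ (timeReversal v).ofLp) =
      timeReversal (WithLp.toLp 2 (a.reverse.toMatrix (z.1, -z.2) *ᵥ v.ofLp)) := by
  ext i
  fin_cases i
  · simp only [Fin.zero_eta, timeReversal_zero]
    simp [Symbol.toMatrix, Symbol.reverse, pauliSign, Fin.sum_univ_four, pauli, Matrix.mulVec,
      dotProduct, timeReversal_zero, timeReversal_one, Matrix.smul_apply]
    ring
  · simp only [Fin.mk_one, timeReversal_one]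
    simp [Symbol.toMatrix, Symbol.reverse, pauliSign, Fin.sum_univ_four, pauli, Matrix.mulVec,
      dotProduct, timeReversal_zero, timeReversal_one, Matrix.smul_apply]
    ring

/-- Antilinearity conjugates the oscillating phase, and the substitution `p ↦ -p` restores it; this
is why the symbol is reflected in momentum. -/
lemma weylOp_timeReversal (ε : ℝ) (a : Symbol) (f : Plane → Spinor) (x : Plane) :
    weylOp ε a (fun y => timeReversal (f y)) x = timeReversal (weylOp ε a.reverse f x) := by
  have h1 : ∀ p y : Plane, Complex.exp (Complex.I * (inner ℝ (x - y) p / ε : ℝ)) •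
        WithLp.toLp 2 (a.toMatrix ((1 / 2 : ℝ) • (x + y), p) *ᵥ (timeReversal (f y)).ofLp) =
      timeReversal (Complex.exp (Complex.I * (inner ℝ (x - y) (-p) / ε : ℝ)) •
        WithLp.toLp 2 (a.reverse.toMatrix ((1 / 2 : ℝ) • (x + y), -p) *ᵥ (f y).ofLp)) := by
    intro p y
    rw [toMatrix_mulVec_timeReversal, timeReversal_smul, ← Complex.exp_conj]
    congr 2
    simp only [map_mul, Complex.conj_I, Complex.conj_ofReal, inner_neg_right]
    push_cast
    ring
  unfold weylOp
  simp only [h1]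
  rw [timeReversal_smul]
  congr 1
  · simp only [map_inv₀, map_pow, map_mul, Complex.conj_ofReal, map_ofNat]
  · have h2 : ∀ p : Plane, ∫ y, timeReversal
        (Complex.exp (Complex.I * (inner ℝ (x - y) (-p) / ε : ℝ)) •
        WithLp.toLp 2 (a.reverse.toMatrix ((1 / 2 : ℝ) • (x + y), -p) *ᵥ (f y).ofLp)) =
        timeReversal (∫ y, Complex.exp (Complex.I * (inner ℝ (x - y) (-p) / ε : ℝ)) •
        WithLp.toLp 2 (a.reverse.toMatrix ((1 / 2 : ℝ) • (x + y), -p) *ᵥ (f y).ofLp)) := fun p =>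
      timeReversal.toContinuousLinearEquiv.integral_comp_comm _
    simp only [h2]
    rw [integral_neg_eq_self (fun p : Plane => timeReversal (∫ y,
      Complex.exp (Complex.I * (inner ℝ (x - y) p / ε : ℝ)) •
        WithLp.toLp 2 (a.reverse.toMatrix ((1 / 2 : ℝ) • (x + y), p) *ᵥ (f y).ofLp)))]
    exact timeReversal.toContinuousLinearEquiv.integral_comp_comm _

lemma IsEigenExp.timeReversal {ε : ℝ} {a : Symbol} {g : WignerFun} {φ : ℕ → 𝓢(Plane, Spinor)}
    {μ : ℕ → ℝ} (h : IsEigenExp ε a g φ μ) (ha : a.reverse = a) :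
    IsEigenExp ε a g.reverse (fun i => timeReversalCLM (φ i)) μ where
  memLp := h.memLp
  basis := h.basis.timeReversal
  eigen i x := by
    refine (weylOp_timeReversal ε a (φ i) x).trans ?_
    rw [ha, h.eigen, timeReversal_smul, Complex.conj_ofReal]
    rfl
  eigen_exp i x := by
    refine (weylOp_timeReversal ε _ (φ i) x).trans ?_
    rw [WignerFun.toSymbol_reverse, h.eigen_exp, timeReversal_smul, Complex.conj_ofReal]
    rfl

lemma IsEigenExp.le_log {ε : ℝ} {c : ℝˣ} (hc : (c : ℝ) = 2 * Real.pi * ε) {a : Symbol}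
    {g : WignerFun} {φ : ℕ → 𝓢(Plane, Spinor)} {μ : ℕ → ℝ} (h : IsEigenExp ε a g φ μ) {H : ℝ}
    (hH : 0 ≤ H) (hg : hsNorm c g ≤ ENNReal.ofReal H) (i : ℕ) : μ i ≤ Real.log (1 + H) := by
  have h1 := (ENNReal.ofReal_le_ofReal_iff hH).1 ((h.exp_sq_le hc i).trans hg)
  rw [Real.le_log_iff_exp_le (by positivity)]
  nlinarith [sq_nonneg (Real.exp (μ i) - 1), Real.exp_pos (μ i)]

lemma eq_zero_of_hsNorm_eq_zero {c : ℝˣ} {g : WignerFun} (h : hsNorm c g = 0) : g = 0 := by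
  obtain ⟨C, hC, hle⟩ := exists_lintegral_le_hsNorm c
  funext s
  have h1 := hle g s
  rw [h, mul_zero, nonpos_iff_eq_zero, lintegral_eq_zero_iff (by
    have := (g s).continuous
    fun_prop)] at h1
  have h2 : (g s : Phase → ℝ) =ᵐ[volume] fun _ => 0 := by
    filter_upwards [h1] with z hz
    simpa using hz
  have h3 := ((g s).continuous.ae_eq_iff_eq volume continuous_const).1 h2
  ext z
  exact congrFun h3 z

/-- The quantum exponential of a symbol that is invariant under time reversal is invariant. -/
theorem IsQuantumExp.reverse_eq {ε : ℝ} (hε : 0 < ε) {a : Symbol} (ha : a.Admissible ε)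
    (har : a.reverse = a) {g : WignerFun} (h : IsQuantumExp ε a g) : g.reverse = g := by
  have hc0 : 2 * Real.pi * ε ≠ 0 := by positivity
  have hc : ((Units.mk0 _ hc0 : ℝˣ) : ℝ) = 2 * Real.pi * ε := rfl
  set c := Units.mk0 _ hc0
  obtain ⟨φ, μ, hφ⟩ := h.exists_isEigenExp
  have hl := hφ.le_log hc ENNReal.toReal_nonneg (ENNReal.ofReal_toReal (hsNorm_lt_top c g).ne).ge
  -- Both symbols are exponentials of the same `a`. The exponents in the estimate therefore cancel
  -- and the Hilbert-Schmidt distance is zero.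
  have h1 := hsNorm_sub_le hε hc ha ha (hφ.timeReversal har) hφ hl hl
  simp only [sub_self, zero_mul, integral_zero, Finset.sum_const_zero, mul_zero,
    ENNReal.ofReal_zero, nonpos_iff_eq_zero] at h1
  exact sub_eq_zero.1 (eq_zero_of_hsNorm_eq_zero h1)

lemma vec3_neg (p : Plane) (s : Fin 3) : vec3 (-p) s = -vec3 p s := by
  fin_cases s <;> simp [vec3]

/-- The vector part is odd in `p`, so its change of sign under reversal compensates the reflection
of the momentum, whatever the multipliers are. -/
lemma reverse_neg_modHamiltonian (c : ℝ) (A B : Plane → ℝ) :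
    (-modHamiltonian c A B).reverse = -modHamiltonian c A B := by
  funext s z
  refine Fin.cases ?_ (fun s => ?_) s
  · simp [Symbol.reverse, pauliSign, modHamiltonian]
  · simp [Symbol.reverse, pauliSign, modHamiltonian, vec3_neg, neg_div]

end Graphene

/-! ### Band moments as continuous linear forms -/

namespace Graphene

open SchwartzMap

/-- The exponent of an integrable power of the norm on the plane. -/
def planePower : ℕ := (volume : Measure Plane).integrablePower

lemma integrable_planePower : Integrable fun p : Plane => (1 + ‖p‖) ^ (-(planePower : ℝ)) :=
  Measure.integrable_pow_neg_integrablePower _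

/-- A decay bound in both variables. -/
lemma abs_le_rpow_mul_rpow (f : 𝓢(Phase, ℝ)) (M N : ℕ) (r p : Plane) :
    |f (r, p)| ≤ 2 ^ (M + N) * (SchwartzMap.seminorm ℝ 0 0 f + SchwartzMap.seminorm ℝ (M + N) 0 f) *
      ((1 + ‖r‖) ^ (-(M : ℝ)) * (1 + ‖p‖) ^ (-(N : ℝ))) := by
  have h := f.norm_le_one_add_rpow (M + N) (r, p) (norm_nonneg _) le_rfl
  rw [Real.norm_eq_abs] at h
  refine h.trans (mul_le_mul_of_nonneg_left ?_ (by positivity))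
  have h1 : (0 : ℝ) < 1 + ‖r‖ := by positivity
  have h2 : (0 : ℝ) < 1 + ‖p‖ := by positivity
  push_cast
  rw [neg_add, Real.rpow_add (by positivity)]
  refine mul_le_mul ?_ ?_ (by positivity) (by positivity)
  · exact Real.rpow_le_rpow_of_nonpos h1 (by gcongr; exact norm_fst_le (r, p)) (by simp)
  · exact Real.rpow_le_rpow_of_nonpos h2 (by gcongr; exact norm_snd_le (r, p)) (by simp)

lemma integrable_mul_slice {q : Plane → ℝ} (hq : Measurable q) (hq1 : ∀ p, |q p| ≤ 1)
    (f : 𝓢(Phase, ℝ)) (r : Plane) : Integrable fun p => q p * f (r, p) := by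
  refine Integrable.mono' ((f.slice r).integrable (μ := volume)).norm
    (hq.aestronglyMeasurable.mul (f.slice r).continuous.aestronglyMeasurable)
    (Eventually.of_forall fun p => ?_)
  rw [norm_mul]
  exact mul_le_of_le_one_left (norm_nonneg _) (hq1 p)

lemma abs_integral_mul_slice_le {q : Plane → ℝ} (hq1 : ∀ p, |q p| ≤ 1)
    (f : 𝓢(Phase, ℝ)) (r : Plane) (M : ℕ) : |∫ p, q p * f (r, p)| ≤
      2 ^ (M + planePower) * (SchwartzMap.seminorm ℝ 0 0 f +
        SchwartzMap.seminorm ℝ (M + planePower) 0 f) * (1 + ‖r‖) ^ (-(M : ℝ)) *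
        ∫ p : Plane, (1 + ‖p‖) ^ (-(planePower : ℝ)) := by
  rw [← integral_const_mul]
  refine norm_integral_le_of_norm_le (f := fun p => q p * f (r, p))
    (integrable_planePower.const_mul _)
    (Eventually.of_forall fun p => ?_)
  rw [norm_mul, mul_assoc _ ((1 + ‖r‖) ^ (-(M : ℝ)))]
  exact (mul_le_of_le_one_left (norm_nonneg _) (hq1 p)).trans (abs_le_rpow_mul_rpow f M _ r p)

/-- The moment of a Schwartz function of the phase space variables, with a bounded weight. -/
def sliceIntegral {q : Plane → ℝ} (hq : Measurable q) (hq1 : ∀ p, |q p| ≤ 1) (r : Plane) :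
    𝓢(Phase, ℝ) →L[ℝ] ℝ :=
  mkCLMtoNormedSpace (𝕜 := ℝ) (fun f => ∫ p, q p * f (r, p))
    (fun f g => by
      rw [← integral_add (integrable_mul_slice hq hq1 f r) (integrable_mul_slice hq hq1 g r)]
      simp only [_root_.add_apply, mul_add])
    (fun a f => by
      simp only [_root_.smul_apply, smul_eq_mul, RingHom.id_apply, ← integral_const_mul,
        mul_left_comm (q _) a])
    (by
      set D := ∫ p : Plane, (1 + ‖p‖) ^ (-(planePower : ℝ)) with hD
      have hD0 : 0 ≤ D := integral_nonneg fun p => by positivity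
      refine ⟨{(0, 0), (0 + planePower, 0)}, 2 ^ (0 + planePower) * 2 * D, by positivity,
        fun f => ?_⟩
      refine (abs_integral_mul_slice_le hq1 f r 0).trans ?_
      have e1 : SchwartzMap.seminorm ℝ 0 0 f ≤
          (({(0, 0), (0 + planePower, 0)} : Finset (ℕ × ℕ)).sup (schwartzSeminormFamily ℝ Phase ℝ)) f :=
        Seminorm.le_def.1 (Finset.le_sup (f := schwartzSeminormFamily ℝ Phase ℝ)
          (b := (0, 0)) (by simp)) f
      have e2 : SchwartzMap.seminorm ℝ (0 + planePower) 0 f ≤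
          (({(0, 0), (0 + planePower, 0)} : Finset (ℕ × ℕ)).sup (schwartzSeminormFamily ℝ Phase ℝ)) f :=
        Seminorm.le_def.1 (Finset.le_sup (f := schwartzSeminormFamily ℝ Phase ℝ)
          (b := (0 + planePower, 0)) (by simp)) f
      rw [Nat.cast_zero, neg_zero, Real.rpow_zero, mul_one, ← hD]
      set S := (({(0, 0), (0 + planePower, 0)} : Finset (ℕ × ℕ)).sup
        (schwartzSeminormFamily ℝ Phase ℝ)) f
      calc _ ≤ 2 ^ (0 + planePower) * (S + S) * D := by gcongr
        _ = _ := by ring)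

@[simp] lemma sliceIntegral_apply {q : Plane → ℝ} (hq : Measurable q) (hq1 : ∀ p, |q p| ≤ 1)
    (r : Plane) (f : 𝓢(Phase, ℝ)) : sliceIntegral hq hq1 r f = ∫ p, q p * f (r, p) := rfl

/-- The components of `p / |p|`. -/
def direction (s : Fin 3) (p : Plane) : ℝ := vec3 p s / ‖p‖

lemma measurable_direction (s : Fin 3) : Measurable (direction s) :=
  (measurable_vec3 s).div measurable_norm

lemma band_toSymbol (σ : ℤˣ) (w : WignerFun) (z : Phase) : band σ w.toSymbol z =
    1 * w 0 z + ((σ : ℤ) : ℝ) * ∑ s : Fin 3, direction s z.2 * w s.succ z := by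
  simp only [band, WignerFun.toSymbol, dotProduct, vecPart, direction, Finset.sum_div, one_mul]
  congr 2
  refine Finset.sum_congr rfl fun s _ => ?_
  ring

lemma abs_one_le (_ : Plane) : |(1 : ℝ)| ≤ 1 := by simp

lemma integrable_band (σ : ℤˣ) (w : WignerFun) (r : Plane) :
    Integrable fun p => band σ w.toSymbol (r, p) := by
  simp only [band_toSymbol]
  exact (integrable_mul_slice measurable_const abs_one_le (w 0) r).add
    ((integrable_finsetSum _ fun s _ => integrable_mul_slice (measurable_direction s)
      (fun p => abs_vec3_div_le p s) (w s.succ) r).const_mul _)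

/-- The band moments as continuous linear forms. -/
def bandMomentCLM (σ : ℤˣ) (r : Plane) : WignerFun →L[ℝ] ℝ :=
  sliceIntegral measurable_const abs_one_le r ∘L ContinuousLinearMap.proj (R := ℝ) 0 +
    ((σ : ℤ) : ℝ) • ∑ s : Fin 3, sliceIntegral (measurable_direction s)
      (fun p => abs_vec3_div_le p s) r ∘L ContinuousLinearMap.proj (R := ℝ) s.succ

lemma bandMomentCLM_apply (σ : ℤˣ) (r : Plane) (w : WignerFun) :
    bandMomentCLM σ r w = bandMoment σ w.toSymbol r := by
  have h : ∀ s : Fin 3, Integrable fun p => direction s p * w s.succ (r, p) := fun s =>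
    integrable_mul_slice (measurable_direction s) (fun p => abs_vec3_div_le p s) (w s.succ) r
  simp only [bandMoment, band_toSymbol]
  rw [integral_add (integrable_mul_slice measurable_const abs_one_le (w 0) r)
    ((integrable_finsetSum _ fun s _ => h s).const_mul _), integral_const_mul ((σ : ℤ) : ℝ),
    integral_finsetSum _ fun s _ => h s]
  simp [bandMomentCLM]
  rfl

/-- Decay of arbitrary order in `r`, explicit in the seminorms, will outweigh the polynomial growth
of the multipliers uniformly along a family. -/
lemma abs_bandMoment_le (σ : ℤˣ) (w : WignerFun) (r : Plane) (M : ℕ) {K : ℝ}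
    (hK : ∀ s, SchwartzMap.seminorm ℝ 0 0 (w s) ≤ K)
    (hK' : ∀ s, SchwartzMap.seminorm ℝ (M + planePower) 0 (w s) ≤ K) :
    |bandMoment σ w.toSymbol r| ≤ 2 ^ (M + planePower) * (K + K) *
      (∫ p : Plane, (1 + ‖p‖) ^ (-(planePower : ℝ))) * 4 * (1 + ‖r‖) ^ (-(M : ℝ)) := by
  set D := ∫ p : Plane, (1 + ‖p‖) ^ (-(planePower : ℝ)) with hD
  have hD0 : 0 ≤ D := integral_nonneg fun p => by positivity
  have h1 : ∀ {q : Plane → ℝ} (_ : ∀ p, |q p| ≤ 1) s, |∫ p, q p * w s (r, p)| ≤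
      2 ^ (M + planePower) * (K + K) * (1 + ‖r‖) ^ (-(M : ℝ)) * D := fun hq1 s => by
    refine (abs_integral_mul_slice_le hq1 (w s) r M).trans ?_
    gcongr
    exacts [hK s, hK' s]
  rw [← bandMomentCLM_apply]
  simp only [bandMomentCLM, _root_.add_apply, ContinuousLinearMap.comp_apply,
    ContinuousLinearMap.proj_apply, sliceIntegral_apply, _root_.smul_apply, _root_.sum_apply,
    smul_eq_mul]
  refine (abs_add_le _ _).trans ?_
  have h2 : |((σ : ℤ) : ℝ)| = 1 := by
    rcases Int.units_eq_one_or σ with rfl | rfl <;> simp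
  rw [abs_mul, h2, one_mul]
  have h3 := (Finset.abs_sum_le_sum_abs (fun s : Fin 3 => ∫ p, direction s p * w s.succ (r, p))
    Finset.univ).trans (Finset.sum_le_sum fun s _ => h1 (fun p => abs_vec3_div_le p s) s.succ)
  rw [Finset.sum_const, Finset.card_univ, Fintype.card_fin, nsmul_eq_mul] at h3
  have h4 := h1 (q := fun _ => 1) abs_one_le 0
  push_cast at h3
  have h5 : |∑ s : Fin 3, sliceIntegral (measurable_direction s)
      (fun p => abs_vec3_div_le p s) r (w s.succ)| ≤
      3 * (2 ^ (M + planePower) * (K + K) * (1 + ‖r‖) ^ (-(M : ℝ)) * D) := h3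
  linarith

end Graphene

/-! ### From `L²` convergence to pointwise convergence -/

namespace SchwartzMap

open Graphene

variable {ι : Type*}

lemma BoundedOn.exists_lintegral_le {f : ι → 𝓢(Phase, ℝ)} {S : Set ι} (h : BoundedOn f S) :
    ∃ K : ENNReal, K ≠ ⊤ ∧ ∀ i ∈ S, ∫⁻ z, ‖f i z‖ₑ ^ 2 ≤ K := by
  set N := (volume : Measure Phase).integrablePower with hN
  obtain ⟨C, hC, h0⟩ := h.exists_nonneg 0 0
  obtain ⟨D, hD, h1⟩ := h.exists_nonneg N 0
  have hint := (Measure.integrable_pow_neg_integrablePower (volume : Measure Phase)).lintegral_lt_top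
  refine ⟨ENNReal.ofReal (C * (2 ^ N * (C + D))) *
    ∫⁻ z : Phase, ENNReal.ofReal ((1 + ‖z‖) ^ (-(N : ℝ))), ENNReal.mul_ne_top ENNReal.ofReal_ne_top
      hint.ne, fun i hi => ?_⟩
  rw [← lintegral_const_mul _ (by fun_prop)]
  refine lintegral_mono fun z => ?_
  rw [← ENNReal.ofReal_mul (by positivity), ← ofReal_norm, ← ENNReal.ofReal_pow (norm_nonneg _)]
  refine ENNReal.ofReal_le_ofReal ?_
  have e1 : ‖f i z‖ ≤ C := ((f i).norm_le_seminorm ℝ z).trans (h0 i hi)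
  have e2 : ‖f i z‖ ≤ 2 ^ N * (C + D) * (1 + ‖z‖) ^ (-(N : ℝ)) := by
    refine ((f i).norm_le_one_add_rpow N z (norm_nonneg z) le_rfl).trans ?_
    gcongr
    exacts [h0 i hi, h1 i hi]
  calc ‖f i z‖ ^ 2 = ‖f i z‖ * ‖f i z‖ := sq _
    _ ≤ C * (2 ^ N * (C + D) * (1 + ‖z‖) ^ (-(N : ℝ))) := by gcongr
    _ = _ := by ring

/-- Convergence to zero in `L²` implies pointwise convergence for bounded families of Schwartz
functions. -/
lemma tendsto_apply_of_tendsto_lintegral {f : ι → 𝓢(Phase, ℝ)} {S : Set ι} (h : BoundedOn f S)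
    {l : Filter ι} (hS : ∀ᶠ i in l, i ∈ S)
    (hlim : Tendsto (fun i => ∫⁻ z, ‖f i z‖ₑ ^ 2) l (𝓝 0)) (z : Phase) :
    Tendsto (fun i => f i z) l (𝓝 0) := by
  obtain ⟨L, hL, h1⟩ := h.exists_nonneg 0 1
  rw [Metric.tendsto_nhds]
  intro δ hδ
  -- On a ball of this radius the uniform Lipschitz bound allows a variation of at most `δ / 2`. A
  -- value of size at least `δ` at `z` would thus force a fixed amount of `L²` mass.
  set ρ := δ / (2 * (L + 1)) with hρ
  have hρ0 : 0 < ρ := by positivity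
  set η : ENNReal := ENNReal.ofReal ((δ / 2) ^ 2) * volume (Metric.ball z ρ) with hη
  have hη0 : 0 < η := by
    refine ENNReal.mul_pos ?_ (Metric.measure_ball_pos _ _ hρ0).ne'
    rw [ne_eq, ENNReal.ofReal_eq_zero, not_le]
    positivity
  filter_upwards [hS, hlim.eventually_lt_const hη0] with i hi hlt
  by_contra hcon
  rw [dist_zero_right, not_lt] at hcon
  refine absurd hlt (not_lt.2 ?_)
  calc η = ∫⁻ _ in Metric.ball z ρ, ENNReal.ofReal ((δ / 2) ^ 2) := by
        rw [setLIntegral_const]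
    _ ≤ ∫⁻ y in Metric.ball z ρ, ‖f i y‖ₑ ^ 2 := by
        refine setLIntegral_mono' Metric.isOpen_ball.measurableSet fun y hy => ?_
        rw [← ofReal_norm, ← ENNReal.ofReal_pow (norm_nonneg _)]
        refine ENNReal.ofReal_le_ofReal ?_
        have e1 : ‖f i z - f i y‖ ≤ L * ρ := by
          refine ((f i).norm_sub_le_seminorm_mul z y).trans ?_
          have : ‖z - y‖ ≤ ρ := by
            rw [← dist_eq_norm, dist_comm]
            exact (Metric.mem_ball.1 hy).le
          gcongr
          exact h1 i hi
        have e2 : L * ρ ≤ δ / 2 := by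
          rw [hρ, mul_div_assoc', div_le_div_iff₀ (by positivity) (by norm_num)]
          nlinarith
        have e3 : δ / 2 ≤ ‖f i y‖ := by
          have := norm_sub_norm_le (f i z) (f i y)
          linarith
        gcongr
    _ ≤ ∫⁻ y, ‖f i y‖ₑ ^ 2 := setLIntegral_le_lintegral _ _

end SchwartzMap

/-! ### Stability of equilibria under convergence of their band densities -/

namespace Graphene

open SchwartzMap

lemma measurable_bandMoment (σ : ℤˣ) (w : WignerFun) : Measurable (bandMoment σ w.toSymbol) := by
  have h : Measurable (band σ w.toSymbol) := by
    have h1 := fun s => (w s).continuous.measurable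
    have h2 : ∀ s, Measurable fun z : Phase => direction s z.2 := fun s => by
      have := measurable_direction s
      fun_prop
    have h3 : band σ w.toSymbol = fun z => 1 * w 0 z +
      ((σ : ℤ) : ℝ) * ∑ s : Fin 3, direction s z.2 * w s.succ z := funext (band_toSymbol σ w)
    rw [h3]
    refine Measurable.add ((h1 0).const_mul _) (Measurable.const_mul
      (Finset.measurable_fun_sum _ fun s _ => (h2 s).mul (h1 s.succ)) _)
  exact (h.stronglyMeasurable.integral_prod_right' (ν := (volume : Measure Plane))).measurable

/-- The pairing of a difference of Hamiltonians and of a Schwartz symbol only involves the band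
moments of the latter. -/
lemma sum_integral_modHamiltonian_sub {ε : ℝ} (hε : 0 < ε) (c : ℝ) {A₁ A₂ B₁ B₂ : Plane → ℝ}
    (hA₁ : A₁.HasTemperateGrowth) (hA₂ : A₂.HasTemperateGrowth) (hB₁ : B₁.HasTemperateGrowth)
    (hB₂ : B₂.HasTemperateGrowth) (d : WignerFun) :
    ∑ s, ∫ z, ((-modHamiltonian c A₁ B₁) s z - (-modHamiltonian c A₂ B₂) s z) * d s z =
      ∫ r, -((A₁ r - A₂ r) * ((bandMoment 1 d.toSymbol r + bandMoment (-1) d.toSymbol r) / 2) +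
        (B₁ r - B₂ r) * ((bandMoment 1 d.toSymbol r - bandMoment (-1) d.toSymbol r) / 2)) := by
  have hi : ∀ s, Integrable fun z =>
      ((-modHamiltonian c A₁ B₁) s z - (-modHamiltonian c A₂ B₂) s z) * d s z := fun s => by
    have h := (integrable_mul_toSymbol (admissible_neg_modHamiltonian hε c hA₁ hB₁) d s).sub
      (integrable_mul_toSymbol (admissible_neg_modHamiltonian hε c hA₂ hB₂) d s)
    refine h.congr (Eventually.of_forall fun z => ?_)
    simp only [Pi.sub_apply]
    ring
  rw [← integral_finsetSum _ fun s _ => hi s, Measure.volume_eq_prod, integral_prod _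
    (integrable_finsetSum _ fun s _ => hi s)]
  refine integral_congr_ae (Eventually.of_forall fun r => ?_)
  set I₀ := ∫ p, 1 * d 0 (r, p) with hI₀
  set I₁ := ∑ s : Fin 3, ∫ p, direction s p * d s.succ (r, p) with hI₁
  have hm : ∀ σ : ℤˣ, bandMoment σ d.toSymbol r = I₀ + ((σ : ℤ) : ℝ) * I₁ := fun σ => by
    rw [← bandMomentCLM_apply]
    rfl
  have h1 := fun s : Fin 3 => integrable_mul_slice (measurable_direction s)
    (fun p => abs_vec3_div_le p s) (d s.succ) r
  simp only [hm]
  -- The terms `|p|²/2` and `c|p|` are common to both Hamiltonians and drop out; only functions of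
  -- `r` remain in front of the moments.
  have h2 : ∀ p, ∑ s, ((-modHamiltonian c A₁ B₁) s (r, p) - (-modHamiltonian c A₂ B₂) s (r, p)) *
      d s (r, p) = -(A₁ r - A₂ r) * (1 * d 0 (r, p)) +
        -(B₁ r - B₂ r) * ∑ s : Fin 3, direction s p * d s.succ (r, p) := fun p => by
    rw [Fin.sum_univ_succ, Finset.mul_sum]
    congr 1
    · simp only [modHamiltonian, Pi.neg_apply, Fin.cons_zero]
      ring
    · refine Finset.sum_congr rfl fun s _ => ?_
      simp [modHamiltonian, direction]
      ring
  simp only [h2]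
  rw [integral_add ((integrable_mul_slice measurable_const abs_one_le (d 0) r).const_mul _)
    ((integrable_finsetSum _ fun s _ => h1 s).const_mul _),
    integral_const_mul (-(A₁ r - A₂ r)), integral_const_mul (-(B₁ r - B₂ r)),
    integral_finsetSum _ fun s _ => h1 s, ← hI₀, ← hI₁]
  push_cast
  ring

lemma polyBounded_of_hasTemperateGrowth {A : Plane → ℝ} (hA : A.HasTemperateGrowth) :
    PolyBounded A := by
  obtain ⟨k, C, h⟩ := hA.2 0
  refine ⟨C, k, ?_, fun z => by simpa using h z⟩
  simpa using (norm_nonneg _).trans (h 0)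

section Stability

variable {ι : Type*} {l : Filter ι}

/-- Dominated convergence. The moments decay with order `k + planePower`: the part `k` absorbs the
growth of the multipliers and `planePower` leaves an integrable majorant. -/
lemma tendsto_integral_bandMoment [l.IsCountablyGenerated] {d : ι → WignerFun}
    {A B : ι → Plane → ℝ} {S : Set ι} (hS : ∀ᶠ i in l, i ∈ S)
    (hA : ∀ i ∈ S, Measurable (A i)) (hB : ∀ i ∈ S, Measurable (B i))
    (hd : ∀ s, BoundedOn (fun i => d i s) S) {C : ℝ} {k : ℕ} (hC : 0 ≤ C)
    (hAB : ∀ i ∈ S, ∀ r, |A i r| ≤ C * (1 + ‖r‖) ^ k ∧ |B i r| ≤ C * (1 + ‖r‖) ^ k)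
    (hlim : ∀ σ r, Tendsto (fun i => bandMoment σ (d i).toSymbol r) l (𝓝 0)) :
    Tendsto (fun i => ∫ r, -(A i r * ((bandMoment 1 (d i).toSymbol r +
        bandMoment (-1) (d i).toSymbol r) / 2) + B i r * ((bandMoment 1 (d i).toSymbol r -
        bandMoment (-1) (d i).toSymbol r) / 2))) l (𝓝 0) := by
  have hK : ∃ K : ℝ, 0 ≤ K ∧ ∀ i ∈ S, ∀ s, SchwartzMap.seminorm ℝ 0 0 (d i s) ≤ K ∧
      SchwartzMap.seminorm ℝ (k + planePower + planePower) 0 (d i s) ≤ K := by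
    choose K₁ hK₁ h₁ using fun s => (hd s).exists_nonneg 0 0
    choose K₂ hK₂ h₂ using fun s => (hd s).exists_nonneg (k + planePower + planePower) 0
    refine ⟨∑ s, (K₁ s + K₂ s), Finset.sum_nonneg fun s _ => add_nonneg (hK₁ s) (hK₂ s),
      fun i hi s => ?_⟩
    have h3 : K₁ s + K₂ s ≤ ∑ s, (K₁ s + K₂ s) := Finset.single_le_sum
      (f := fun s => K₁ s + K₂ s) (fun s _ => add_nonneg (hK₁ s) (hK₂ s)) (Finset.mem_univ s)
    have := h₁ s i hi
    have := h₂ s i hi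
    have := hK₁ s
    have := hK₂ s
    exact ⟨by linarith, by linarith⟩
  obtain ⟨K, hK0, hK⟩ := hK
  set M := 2 ^ (k + planePower + planePower) * (K + K) *
      (∫ p : Plane, (1 + ‖p‖) ^ (-(planePower : ℝ))) * 4 with hM
  have hD0 : 0 ≤ ∫ p : Plane, (1 + ‖p‖) ^ (-(planePower : ℝ)) :=
    integral_nonneg fun p => by positivity
  have hM0 : 0 ≤ M := by positivity
  have hbd : ∀ i ∈ S, ∀ σ r, |bandMoment σ (d i).toSymbol r| ≤
      M * (1 + ‖r‖) ^ (-((k + planePower : ℕ) : ℝ)) := fun i hi σ r =>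
    abs_bandMoment_le σ (d i) r (k + planePower) (fun s => (hK i hi s).1) fun s => (hK i hi s).2
  have h0 : (0 : ℝ) = ∫ _ : Plane, (0 : ℝ) := by simp
  rw [h0]
  refine tendsto_integral_filter_of_dominated_convergence
    (fun r => 2 * (C * M) * (1 + ‖r‖) ^ (-(planePower : ℝ))) ?_ ?_
    (integrable_planePower.const_mul _) ?_
  · filter_upwards [hS] with i hi
    have h1 := hA i hi
    have h2 := hB i hi
    have h3 := measurable_bandMoment 1 (d i)
    have h4 := measurable_bandMoment (-1) (d i)
    exact Measurable.aestronglyMeasurable (by fun_prop)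
  · filter_upwards [hS] with i hi
    refine Eventually.of_forall fun r => ?_
    obtain ⟨a1, a2⟩ := hAB i hi r
    have b1 := hbd i hi 1 r
    have b2 := hbd i hi (-1) r
    set Q := M * (1 + ‖r‖) ^ (-((k + planePower : ℕ) : ℝ)) with hQ
    have hr : (0 : ℝ) < 1 + ‖r‖ := by positivity
    have e1 : C * (1 + ‖r‖) ^ k * Q = C * M * (1 + ‖r‖) ^ (-(planePower : ℝ)) := by
      rw [hQ]
      push_cast
      rw [neg_add, Real.rpow_add hr, Real.rpow_neg hr.le (k : ℝ), Real.rpow_natCast]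
      field_simp
    rw [Real.norm_eq_abs, abs_neg]
    have b3 : |(bandMoment 1 (d i).toSymbol r + bandMoment (-1) (d i).toSymbol r) / 2| ≤ Q := by
      rw [abs_le] at b1 b2 ⊢
      constructor <;> linarith
    have b4 : |(bandMoment 1 (d i).toSymbol r - bandMoment (-1) (d i).toSymbol r) / 2| ≤ Q := by
      rw [abs_le] at b1 b2 ⊢
      constructor <;> linarith
    refine (abs_add_le _ _).trans ?_
    rw [abs_mul, abs_mul]
    have c1 := mul_le_mul a1 b3 (abs_nonneg _) (by positivity)
    have c2 := mul_le_mul a2 b4 (abs_nonneg _) (by positivity)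
    rw [e1] at c1 c2
    linarith
  · refine Eventually.of_forall fun r => ?_
    have t1 : Tendsto (fun i => C * (1 + ‖r‖) ^ k * (|bandMoment 1 (d i).toSymbol r| +
        |bandMoment (-1) (d i).toSymbol r|)) l (𝓝 0) := by
      have := ((hlim 1 r).abs.add (hlim (-1) r).abs).const_mul (C * (1 + ‖r‖) ^ k)
      simpa using this
    refine squeeze_zero_norm' ?_ t1
    filter_upwards [hS] with i hi
    obtain ⟨a1, a2⟩ := hAB i hi r
    rw [Real.norm_eq_abs, abs_neg]
    set x := bandMoment 1 (d i).toSymbol r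
    set y := bandMoment (-1) (d i).toSymbol r
    have b3 : |(x + y) / 2| ≤ (|x| + |y|) / 2 := by
      rw [abs_div, abs_two]
      gcongr
      exact abs_add_le _ _
    have b4 : |(x - y) / 2| ≤ (|x| + |y|) / 2 := by
      rw [abs_div, abs_two]
      gcongr
      exact abs_sub _ _
    refine (abs_add_le _ _).trans ?_
    rw [abs_mul, abs_mul]
    have c1 := mul_le_mul a1 b3 (abs_nonneg _) (by positivity)
    have c2 := mul_le_mul a2 b4 (abs_nonneg _) (by positivity)
    linarith

/-- Convergence of the band moments of quantum exponentials implies their convergence as Schwartz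
functions, provided that all objects are uniformly bounded. -/
theorem tendsto_of_tendsto_bandMoment [l.IsCountablyGenerated] {ε : ℝ} (hε : 0 < ε) (v : ℝ)
    {g : ι → WignerFun} {A B : ι → Plane → ℝ} {g₀ : WignerFun} {A₀ B₀ : Plane → ℝ} {S : Set ι}
    (hS : ∀ᶠ i in l, i ∈ S) (hA : ∀ i ∈ S, (A i).HasTemperateGrowth)
    (hB : ∀ i ∈ S, (B i).HasTemperateGrowth) (hA₀ : A₀.HasTemperateGrowth)
    (hB₀ : B₀.HasTemperateGrowth)
    (hexp : ∀ i ∈ S, IsQuantumExp ε (-modHamiltonian v (A i) (B i)) (g i))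
    (hexp₀ : IsQuantumExp ε (-modHamiltonian v A₀ B₀) g₀)
    (hbdd : ∀ s, BoundedOn (fun i => g i s) S) {C : ℝ} {k : ℕ}
    (hmult : ∀ i ∈ S, ∀ r, |A i r| ≤ C * (1 + ‖r‖) ^ k ∧ |B i r| ≤ C * (1 + ‖r‖) ^ k)
    (hlim : ∀ σ r, Tendsto (fun i => bandMoment σ (g i).toSymbol r) l
      (𝓝 (bandMoment σ g₀.toSymbol r))) (s : Fin 4) :
    Tendsto (fun i => g i s) l (𝓝 (g₀ s)) := by
  have hc0 : 2 * Real.pi * ε ≠ 0 := by positivity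
  have hc : ((Units.mk0 _ hc0 : ℝˣ) : ℝ) = 2 * Real.pi * ε := rfl
  set c := Units.mk0 _ hc0
  have hdb : ∀ s, BoundedOn (fun i => (g i - g₀) s) S := fun s =>
    (hbdd s).sub (boundedOn_const (g₀ s) S)
  obtain ⟨Ca, ka, hCa, ha⟩ := polyBounded_of_hasTemperateGrowth hA₀
  obtain ⟨Cb, kb, hCb, hb⟩ := polyBounded_of_hasTemperateGrowth hB₀
  -- uniform bounds for the differences of the multipliers
  have hdiff : ∀ i ∈ S, ∀ r,
      |A i r - A₀ r| ≤ (|C| + Ca + Cb) * (1 + ‖r‖) ^ (k + ka + kb) ∧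
      |B i r - B₀ r| ≤ (|C| + Ca + Cb) * (1 + ‖r‖) ^ (k + ka + kb) := by
    intro i hi r
    obtain ⟨a1, a2⟩ := hmult i hi r
    have a3 := ha r
    have a4 := hb r
    rw [Real.norm_eq_abs] at a3 a4
    have hr : 1 ≤ 1 + ‖r‖ := by simp
    have p1 : C * (1 + ‖r‖) ^ k ≤ |C| * (1 + ‖r‖) ^ (k + ka + kb) := by
      gcongr
      exacts [le_abs_self C, by omega]
    have p2 : Ca * (1 + ‖r‖) ^ ka ≤ Ca * (1 + ‖r‖) ^ (k + ka + kb) := by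
      gcongr
      omega
    have p3 : Cb * (1 + ‖r‖) ^ kb ≤ Cb * (1 + ‖r‖) ^ (k + ka + kb) := by
      gcongr
      omega
    have q2 : 0 ≤ Ca * (1 + ‖r‖) ^ (k + ka + kb) := by positivity
    have q3 : 0 ≤ Cb * (1 + ‖r‖) ^ (k + ka + kb) := by positivity
    have s1 := abs_sub (A i r) (A₀ r)
    have s2 := abs_sub (B i r) (B₀ r)
    constructor <;> linarith
  have hmom : ∀ σ r, Tendsto (fun i => bandMoment σ (g i - g₀).toSymbol r) l (𝓝 0) := by
    intro σ r
    have h1 := (hlim σ r).sub_const (bandMoment σ g₀.toSymbol r)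
    rw [sub_self] at h1
    refine h1.congr fun i => ?_
    rw [← bandMomentCLM_apply, ← bandMomentCLM_apply, ← bandMomentCLM_apply, map_sub]
  -- This integral controls the upper bound in the entropy estimate. The multipliers need not
  -- converge: they are only bounded, and the moments they multiply tend to zero.
  have hI := tendsto_integral_bandMoment hS
    (fun i hi => ((hA i hi).1.continuous.sub hA₀.1.continuous).measurable)
    (fun i hi => ((hB i hi).1.continuous.sub hB₀.1.continuous).measurable) hdb (by positivity)
    hdiff hmom
  -- uniform bound for the eigenvalues
  obtain ⟨K, hK, hKle⟩ := exists_hsNorm_le c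
  choose L hL hLle using fun s => (hbdd s).exists_lintegral_le
  set H : ℝ := (K * ∑ s, L s).toReal + (hsNorm c g₀).toReal with hH
  have hH0 : 0 ≤ H := by positivity
  have hKL : K * ∑ s, L s ≠ ⊤ := ENNReal.mul_ne_top hK (ENNReal.sum_ne_top.2 fun s _ => hL s)
  have hHi : ∀ i ∈ S, hsNorm c (g i) ≤ ENNReal.ofReal H := fun i hi => by
    refine (hKle _).trans (le_trans (mul_le_mul_right (Finset.sum_le_sum fun s _ => hLle s i hi) _) ?_)
    rw [← ENNReal.ofReal_toReal hKL]
    exact ENNReal.ofReal_le_ofReal (le_add_of_nonneg_right ENNReal.toReal_nonneg)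
  have hH₀ : hsNorm c g₀ ≤ ENNReal.ofReal H := by
    rw [← ENNReal.ofReal_toReal (hsNorm_lt_top c g₀).ne]
    exact ENNReal.ofReal_le_ofReal (le_add_of_nonneg_left ENNReal.toReal_nonneg)
  have hns : Tendsto (fun i => hsNorm c (g i - g₀)) l (𝓝 0) := by
    have h1 := ((hI.const_mul 2).const_mul (((2 * Real.pi * ε) ^ 2)⁻¹)).const_mul
      (Real.exp (Real.log (1 + H)))
    have h2 := ENNReal.tendsto_ofReal h1
    simp only [mul_zero, ENNReal.ofReal_zero] at h2
    refine tendsto_of_tendsto_of_tendsto_of_le_of_le' tendsto_const_nhds h2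
      (Eventually.of_forall fun _ => zero_le) ?_
    filter_upwards [hS] with i hi
    -- The eigenbasis is chosen afresh for each index. No convergence of eigenvalues or
    -- eigenfunctions is involved, only their common upper bound.
    obtain ⟨φ, μ, hφ⟩ := (hexp i hi).exists_isEigenExp
    obtain ⟨ψ, ν, hψ⟩ := hexp₀.exists_isEigenExp
    have h3 := hsNorm_sub_le hε hc (admissible_neg_modHamiltonian hε v (hA i hi) (hB i hi))
      (admissible_neg_modHamiltonian hε v hA₀ hB₀) hφ hψ (hφ.le_log hc hH0 (hHi i hi))
      (hψ.le_log hc hH0 hH₀)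
    have h4 := sum_integral_modHamiltonian_sub hε v (hA i hi) hA₀ (hB i hi) hB₀ (g i - g₀)
    exact h3.trans_eq (congrArg (fun x => ENNReal.ofReal (Real.exp (Real.log (1 + H)) *
      (((2 * Real.pi * ε) ^ 2)⁻¹ * (2 * x)))) h4)
  obtain ⟨K', hK', hK'le⟩ := exists_lintegral_le_hsNorm c
  -- Hilbert-Schmidt convergence gives `L²` convergence of symbols; the Schwartz bounds improve it
  -- to pointwise convergence and then to convergence in the Schwartz space.
  refine tendsto_of_boundedOn hS (hbdd s) fun z => ?_
  have h5 : Tendsto (fun i => ∫⁻ z, ‖(g i - g₀) s z‖ₑ ^ 2) l (𝓝 0) := by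
    have h6 := ENNReal.Tendsto.const_mul (a := K') hns (Or.inr hK')
    rw [mul_zero] at h6
    exact tendsto_of_tendsto_of_tendsto_of_le_of_le tendsto_const_nhds h6 (fun _ => zero_le)
      fun i => hK'le _ s
  have h7 := (tendsto_apply_of_tendsto_lintegral (hdb s) hS h5 z).add_const (g₀ s z)
  rw [zero_add] at h7
  refine h7.congr fun i => ?_
  exact sub_add_cancel (g i s z) (g₀ s z)

end Stability

end Graphene

/-! ### The transport operator: parity under time reversal and continuity on Schwartz symbols -/

namespace Graphene

open SchwartzMap LineDeriv

section Reverse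

lemma lineDeriv_reverse (f : Phase → ℝ) (a : ℝ) (z : Phase) (v : Plane) :
    lineDeriv ℝ (fun z : Phase => a * f (z.1, -z.2)) z (v, 0) =
      a * lineDeriv ℝ f (z.1, -z.2) (v, 0) := by
  simp only [lineDeriv]
  rw [← deriv_const_mul_field]
  congr 1
  funext t
  simp

lemma grad3_reverse (f : Phase → ℝ) (a : ℝ) (z : Phase) :
    grad3 (fun z : Phase => a * f (z.1, -z.2)) z = a • grad3 f (z.1, -z.2) := by
  ext s
  fin_cases s <;> simp [grad3, lineDeriv_reverse]

/-- Changing the signs of `ξ` and `p'` matches the reflected phase, while the potential difference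
is odd in `ξ`; this produces the minus sign. -/
lemma thetaC_reverse (ε : ℝ) (V : Plane → ℝ) (f : Phase → ℝ) (a : ℝ) (z : Phase) :
    thetaC ε V (fun z : Phase => a * f (z.1, -z.2)) z = -(a * thetaC ε V f (z.1, -z.2)) := by
  unfold thetaC
  rw [mul_left_comm (a : ℂ), ← mul_neg]
  congr 1
  rw [← integral_const_mul, ← integral_neg_eq_self, ← integral_neg]
  refine integral_congr_ae (Eventually.of_forall fun ξ => ?_)
  simp only []
  rw [← integral_const_mul, ← integral_neg_eq_self, ← integral_neg]
  refine integral_congr_ae (Eventually.of_forall fun p' => ?_)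
  have h1 : deltaV ε V z.1 (-ξ) = -deltaV ε V z.1 ξ := by
    simp [deltaV, sub_eq_add_neg, add_comm]
  have h2 : (inner ℝ (z.2 - -p') (-ξ) : ℝ) = inner ℝ (-z.2 - p') ξ := by
    rw [inner_neg_right, ← inner_neg_left]
    congr 1
    abel
  simp only [h1, h2, neg_neg]
  push_cast
  ring

lemma theta_reverse (ε : ℝ) (V : Plane → ℝ) (f : Phase → ℝ) (a : ℝ) (z : Phase) :
    theta ε V (fun z : Phase => a * f (z.1, -z.2)) z = -(a * theta ε V f (z.1, -z.2)) := by
  simp only [theta, thetaC_reverse, Complex.neg_re, Complex.re_ofReal_mul]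

lemma vec3_neg' (p : Plane) : vec3 (-p) = -vec3 p := funext (vec3_neg p)

/-- Transport anticommutes with time reversal. -/
lemma transport_reverse (ε γ : ℝ) (V : Plane → ℝ) (w : Symbol) (s : Fin 4) (z : Phase) :
    transport ε γ V w.reverse s z = -(transport ε γ V w).reverse s z := by
  have h0 : w.reverse 0 = fun z => 1 * w 0 (z.1, -z.2) := by
    funext z; simp [Symbol.reverse, pauliSign]
  have hs : ∀ s : Fin 3, w.reverse s.succ = fun z => (-1) * w s.succ (z.1, -z.2) := by
    intro s; funext z; simp [Symbol.reverse, pauliSign]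
  refine Fin.cases ?_ (fun s => ?_) s
  · have h1 : ∀ s : Fin 3, (fun z' => vecPart w.reverse z' s) =
        fun z => (-1) * (fun z' => vecPart w z' s) (z.1, -z.2) := fun s => hs s
    have h2 : ∀ s : Fin 3, grad3 (fun z' => vecPart w.reverse z' s) z s =
        -grad3 (fun z' => vecPart w z' s) (z.1, -z.2) s := fun s => by
      rw [h1 s]
      refine (congrFun (grad3_reverse (fun z' => vecPart w z' s) (-1) z) s).trans ?_
      rw [Pi.smul_apply, smul_eq_mul, neg_one_mul]
    simp only [transport, Fin.cons_zero, h2, Finset.sum_neg_distrib]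
    simp only [h0, grad3_reverse, theta_reverse, Symbol.reverse, pauliSign, if_true, vec3_neg',
      one_smul, neg_dotProduct, Fin.cons_zero]
    ring
  · have h1 : vecPart w.reverse z = -vecPart w (z.1, -z.2) := by
      funext s; simp [vecPart, hs s]
    simp only [transport, Fin.cons_succ, h0, h1, hs s, grad3_reverse, theta_reverse,
      Symbol.reverse, pauliSign, vec3_neg', Pi.smul_apply, smul_eq_mul, one_smul,
      Fin.succ_ne_zero, if_false, neg_dotProduct, dotProduct_smul, map_neg, LinearMap.neg_apply,
      Pi.neg_apply]
    ring

lemma bandMoment_reverse (σ : ℤˣ) (w : Symbol) (r : Plane) :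
    bandMoment σ w.reverse r = bandMoment σ w r := by
  rw [bandMoment, bandMoment, ← integral_neg_eq_self]
  refine integral_congr_ae (Eventually.of_forall fun p => ?_)
  have h1 : vecPart w.reverse (r, -p) = -vecPart w (r, p) := by
    funext s; simp [vecPart, Symbol.reverse, pauliSign]
  have h0 : w.reverse 0 (r, -p) = w 0 (r, p) := by simp [Symbol.reverse, pauliSign]
  simp only [band, h0, h1, vec3_neg', neg_dotProduct, dotProduct_neg, neg_neg, norm_neg]

/-- The first moments of the transport of a time reversal invariant symbol vanish. -/
lemma bandMoment_transport_eq_zero (ε γ : ℝ) (V : Plane → ℝ) {w : Symbol} (hw : w.reverse = w)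
    (σ : ℤˣ) (r : Plane) : bandMoment σ (transport ε γ V w) r = 0 := by
  have h1 : transport ε γ V w = -(transport ε γ V w).reverse := by
    funext s z
    have := transport_reverse ε γ V w s z
    rwa [hw] at this
  have h2 : bandMoment σ (-(transport ε γ V w).reverse) r =
      -bandMoment σ (transport ε γ V w).reverse r := by
    simp only [bandMoment]
    rw [← integral_neg]
    refine integral_congr_ae (Eventually.of_forall fun p => ?_)
    have h3 : ∀ w : Symbol, ∀ z, vecPart (-w) z = -vecPart w z := fun _ _ => rfl
    simp only [band, h3, dotProduct_neg, Pi.neg_apply]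
    ring
  rw [← h1, bandMoment_reverse] at h2
  linarith

end Reverse

section Transport

/-- Multiplication by a component of the momentum. -/
def mulMomentum (j : Fin 2) : 𝓢(Phase, ℝ) →L[ℝ] 𝓢(Phase, ℝ) :=
  smulLeftCLM ℝ fun z : Phase => z.2 j

lemma mulMomentum_apply (j : Fin 2) (f : 𝓢(Phase, ℝ)) (z : Phase) :
    mulMomentum j f z = z.2 j * f z :=
  smulLeftCLM_apply_apply ((EuclideanSpace.proj j : Plane →L[ℝ] ℝ) ∘L
    ContinuousLinearMap.snd ℝ Plane Plane).hasTemperateGrowth f z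

/-- The derivative with respect to a component of the position. -/
def derivPosition (j : Fin 2) : 𝓢(Phase, ℝ) →L[ℝ] 𝓢(Phase, ℝ) :=
  lineDerivOpCLM ℝ 𝓢(Phase, ℝ) ((EuclideanSpace.single j 1, 0) : Phase)

lemma derivPosition_apply (j : Fin 2) (f : 𝓢(Phase, ℝ)) (z : Phase) :
    derivPosition j f z = lineDeriv ℝ f z (EuclideanSpace.single j 1, 0) :=
  SchwartzMap.lineDerivOp_apply _ f z

variable {V : Plane → ℝ}

lemma hasTemperateGrowth_deltaV (hV : V.HasTemperateGrowth) (ε : ℝ) :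
    (fun z : Phase => ((deltaV ε V z.1 ((2 * Real.pi) • z.2) : ℝ) : ℂ)).HasTemperateGrowth := by
  refine Function.Complex.hasTemperateGrowth_ofReal.comp ?_
  have h1 : (fun z : Phase => V (z.1 + (ε / 2) • (2 * Real.pi) • z.2)).HasTemperateGrowth :=
    hV.comp (ContinuousLinearMap.fst ℝ Plane Plane + (ε / 2) • (2 * Real.pi) •
      ContinuousLinearMap.snd ℝ Plane Plane).hasTemperateGrowth
  have h2 : (fun z : Phase => V (z.1 - (ε / 2) • (2 * Real.pi) • z.2)).HasTemperateGrowth :=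
    hV.comp (ContinuousLinearMap.fst ℝ Plane Plane - (ε / 2) • (2 * Real.pi) •
      ContinuousLinearMap.snd ℝ Plane Plane).hasTemperateGrowth
  exact h1.sub h2

/-- The complex-valued pseudo-differential operator on Schwartz functions. -/
def thetaComplexCLM (ε : ℝ) (V : Plane → ℝ) : 𝓢(Phase, ℂ) →L[ℂ] 𝓢(Phase, ℂ) :=
  (Complex.I / ε) • (partialFourier ∘L
    smulLeftCLM ℂ (fun z : Phase => ((deltaV ε V z.1 ((2 * Real.pi) • z.2) : ℝ) : ℂ)) ∘L
    partialFourierInv)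

lemma thetaComplexCLM_apply (hV : V.HasTemperateGrowth) (ε : ℝ) (f : 𝓢(Phase, ℝ)) (z : Phase) :
    thetaComplexCLM ε V (toComplex f) z = thetaC ε V f z := by
  have h1 : thetaComplexCLM ε V (toComplex f) z = (Complex.I / ε) *
      partialFourier (smulLeftCLM ℂ (fun z : Phase =>
        ((deltaV ε V z.1 ((2 * Real.pi) • z.2) : ℝ) : ℂ)) (partialFourierInv (toComplex f))) z := rfl
  rw [h1, thetaC, mul_assoc, partialFourier_apply]
  congr 1
  -- The substitution `ξ = 2π ζ` passes to Fourier transforms with `2π` in the exponent, and its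
  -- Jacobian is the prefactor `(2π)⁻²`.
  have h2 := Measure.integral_comp_smul (volume : Measure Plane) (fun ξ => ∫ p' : Plane,
      (deltaV ε V z.1 ξ : ℂ) * (f (z.1, p') : ℂ) *
        Complex.exp (-Complex.I * (inner ℝ (z.2 - p') ξ : ℝ))) (2 * Real.pi)
  have h3 : |((2 * Real.pi) ^ Module.finrank ℝ Plane)⁻¹| = ((2 * Real.pi) ^ 2)⁻¹ := by
    rw [finrank_euclideanSpace, Fintype.card_fin, abs_of_nonneg (by positivity)]
  rw [h3, Complex.real_smul] at h2
  push_cast at h2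
  rw [← h2]
  refine integral_congr_ae (Eventually.of_forall fun ζ => ?_)
  simp only []
  rw [smulLeftCLM_apply_apply (hasTemperateGrowth_deltaV hV ε), partialFourierInv_apply, smul_eq_mul,
    ← mul_assoc, ← integral_const_mul]
  refine integral_congr_ae (Eventually.of_forall fun p' => ?_)
  simp only [toComplex_apply]
  have h4 : Complex.exp (-Complex.I * ((inner ℝ (z.2 - p') ((2 * Real.pi) • ζ) : ℝ) : ℂ)) =
      Complex.exp (((-2 * Real.pi * inner ℝ ζ z.2 : ℝ) : ℂ) * Complex.I) *
        Complex.exp (((2 * Real.pi * inner ℝ p' ζ : ℝ) : ℂ) * Complex.I) := by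
    rw [← Complex.exp_add]
    congr 1
    rw [inner_smul_right, inner_sub_left, real_inner_comm ζ z.2]
    push_cast
    ring
  rw [h4]
  ring

/-- The pseudo-differential operator `Θ` on Schwartz functions. -/
def thetaCLM (ε : ℝ) (V : Plane → ℝ) : 𝓢(Phase, ℝ) →L[ℝ] 𝓢(Phase, ℝ) :=
  postcompCLM (𝕜 := ℝ) Complex.reCLM ∘L (thetaComplexCLM ε V).restrictScalars ℝ ∘L toComplex

lemma thetaCLM_apply (hV : V.HasTemperateGrowth) (ε : ℝ) (f : 𝓢(Phase, ℝ)) (z : Phase) :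
    thetaCLM ε V f z = theta ε V f z := by
  rw [theta, ← thetaComplexCLM_apply hV]
  rfl

/-- Free transport. -/
def freeTransport : 𝓢(Phase, ℝ) →L[ℝ] 𝓢(Phase, ℝ) :=
  mulMomentum 0 ∘L derivPosition 0 + mulMomentum 1 ∘L derivPosition 1

lemma freeTransport_apply (f : 𝓢(Phase, ℝ)) (z : Phase) :
    freeTransport f z = vec3 z.2 ⬝ᵥ grad3 f z := by
  simp [freeTransport, mulMomentum_apply, derivPosition_apply, vec3, grad3, dotProduct,
    Fin.sum_univ_three]

/-- The derivatives that occur in the transport operator. -/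
def gradientCLM : Fin 3 → 𝓢(Phase, ℝ) →L[ℝ] 𝓢(Phase, ℝ) :=
  ![derivPosition 0, derivPosition 1, 0]

lemma gradientCLM_apply (s : Fin 3) (f : 𝓢(Phase, ℝ)) (z : Phase) :
    gradientCLM s f z = grad3 f z s := by
  fin_cases s <;> simp [gradientCLM, grad3, derivPosition_apply]

/-- The cross product with the momentum. -/
def crossCLM : Fin 3 → WignerFun →L[ℝ] 𝓢(Phase, ℝ) :=
  ![-(mulMomentum 1 ∘L ContinuousLinearMap.proj (R := ℝ) 3),
    mulMomentum 0 ∘L ContinuousLinearMap.proj (R := ℝ) 3,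
    mulMomentum 1 ∘L ContinuousLinearMap.proj (R := ℝ) 1 -
      mulMomentum 0 ∘L ContinuousLinearMap.proj (R := ℝ) 2]

lemma crossCLM_apply (s : Fin 3) (w : WignerFun) (z : Phase) :
    crossCLM s w z = crossProduct (vecPart w.toSymbol z) (vec3 z.2) s := by
  fin_cases s <;> simp [crossCLM, cross_apply, vecPart, vec3, WignerFun.toSymbol,
    mulMomentum_apply] <;> ring

/-- The transport operator on Schwartz symbols. -/
def transportCLM (ε γ : ℝ) (V : Plane → ℝ) : WignerFun →L[ℝ] WignerFun :=
  ContinuousLinearMap.pi (Fin.cons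
    ((2 * γ)⁻¹ • freeTransport ∘L ContinuousLinearMap.proj (R := ℝ) 0 +
      (ε / 2) • ∑ s : Fin 3, gradientCLM s ∘L ContinuousLinearMap.proj (R := ℝ) s.succ +
      thetaCLM ε V ∘L ContinuousLinearMap.proj (R := ℝ) 0)
    fun s : Fin 3 =>
      (2 * γ)⁻¹ • freeTransport ∘L ContinuousLinearMap.proj (R := ℝ) s.succ +
      (ε / 2) • gradientCLM s ∘L ContinuousLinearMap.proj (R := ℝ) 0 +
      thetaCLM ε V ∘L ContinuousLinearMap.proj (R := ℝ) s.succ + crossCLM s)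

/-- Through this identification transport can be iterated on Schwartz symbols, preserves bounded
families and commutes with limits. -/
lemma toSymbol_transportCLM (hV : V.HasTemperateGrowth) (ε γ : ℝ) (w : WignerFun) :
    (transportCLM ε γ V w).toSymbol = transport ε γ V w.toSymbol := by
  funext s z
  refine Fin.cases ?_ (fun s => ?_) s
  · have h : (transportCLM ε γ V w).toSymbol 0 z = (2 * γ)⁻¹ * freeTransport (w 0) z +
        ε / 2 * (∑ s : Fin 3, gradientCLM s (w s.succ)) z + thetaCLM ε V (w 0) z := by
      simp [transportCLM, WignerFun.toSymbol]
    rw [h, freeTransport_apply, thetaCLM_apply hV, _root_.sum_apply]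
    simp only [gradientCLM_apply, inv_mul_eq_div]
    rfl
  · have h : (transportCLM ε γ V w).toSymbol s.succ z = (2 * γ)⁻¹ * freeTransport (w s.succ) z +
        ε / 2 * gradientCLM s (w 0) z + thetaCLM ε V (w s.succ) z + crossCLM s w z := by
      simp [transportCLM, WignerFun.toSymbol]
    rw [h, freeTransport_apply, thetaCLM_apply hV, gradientCLM_apply, crossCLM_apply, inv_mul_eq_div]
    rfl

end Transport

end Graphene

/-! ### Evolution of the corrected density -/

namespace Graphene

open SchwartzMap

lemma _root_.SchwartzMap.BoundedOn.const_smul {ι : Type*} {f : ι → 𝓢(Phase, ℝ)} {S : Set ι}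
    (h : BoundedOn f S) (c : ℝ) : BoundedOn (fun i => c • f i) S := fun k l => by
  obtain ⟨C, hC⟩ := h k l
  refine ⟨‖c‖ * C, fun i hi => ?_⟩
  rw [map_smul_eq_mul]
  exact mul_le_mul_of_nonneg_left (hC i hi) (norm_nonneg c)

lemma isVonNBounded_image {ι : Type*} {w : ι → WignerFun} {S : Set ι}
    (h : ∀ s, BoundedOn (fun i => w i s) S) : Bornology.IsVonNBounded ℝ (w '' S) := by
  rw [Bornology.isVonNBounded_pi_iff]
  intro s
  rw [Set.image_image]
  exact boundedOn_iff.1 (h s)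

lemma boundedOn_map {ι : Type*} {w : ι → WignerFun} {S : Set ι}
    (h : ∀ s, BoundedOn (fun i => w i s) S) (L : WignerFun →L[ℝ] WignerFun) (s : Fin 4) :
    BoundedOn (fun i => L (w i) s) S := by
  rw [boundedOn_iff]
  have := (isVonNBounded_image h).image (ContinuousLinearMap.proj (R := ℝ) s ∘L L)
  rwa [Set.image_image] at this

lemma exists_abs_map_le {ι : Type*} {w : ι → WignerFun} {S : Set ι}
    (h : ∀ s, BoundedOn (fun i => w i s) S) (L : WignerFun →L[ℝ] ℝ) :
    ∃ C, 0 ≤ C ∧ ∀ i ∈ S, |L (w i)| ≤ C := by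
  have := (isVonNBounded_image h).image L
  rw [Set.image_image, NormedSpace.isVonNBounded_iff'] at this
  obtain ⟨C, hC⟩ := this
  exact ⟨max C 0, le_max_right _ _, fun i hi =>
    (hC _ (Set.mem_image_of_mem _ hi)).trans (le_max_left _ _)⟩

/-- Continuous linear forms can be differentiated along pointwise differentiable curves. -/
lemma hasDerivAt_map {w w' : ℝ → WignerFun} {U : Set ℝ} (hU : IsOpen U) (hc : Convex ℝ U)
    (h : ∀ s, PointwiseDeriv (fun t => w t s) (fun t => w' t s) U) (L : WignerFun →L[ℝ] ℝ)
    {t : ℝ} (ht : t ∈ U) : HasDerivAt (fun t => L (w t)) (L (w' t)) t := by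
  rw [hasDerivAt_iff_tendsto_slope]
  have h1 : Tendsto (fun s => (s - t)⁻¹ • (w s - w t)) (𝓝[≠] t) (𝓝 (w' t)) :=
    tendsto_pi_nhds.2 fun s => (h s).tendsto_slope hU hc ht
  refine ((L.continuous.tendsto _).comp h1).congr fun s => ?_
  simp [slope]

variable {ε γ τ : ℝ} {V : Plane → ℝ} {A B : ℝ → Plane → ℝ} {g w : ℝ → WignerFun}

/-- The time derivative prescribed by the scaled system. -/
def velocity (ε γ : ℝ) (V : Plane → ℝ) (τ : ℝ) (g w : WignerFun) : WignerFun :=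
  τ⁻¹ • (τ⁻¹ • (g - w) - transportCLM ε γ V w)

/-- The equation expresses the time derivative through bounded Schwartz symbols. The bound may
degenerate as `τ → 0`, which is harmless: it only justifies differentiation of moments at a fixed
`τ`. -/
lemma IsSolution.pointwiseDeriv (hV : V.HasTemperateGrowth) (hτ : 0 < τ)
    (h : IsSolution ε γ V τ A B g w) {U : Set ℝ} (hU : ∀ t ∈ U, 0 < t)
    (hg : ∀ s, BoundedOn (fun t => g t s) U) (hw : ∀ s, BoundedOn (fun t => w t s) U) (s : Fin 4) :
    PointwiseDeriv (fun t => w t s) (fun t => velocity ε γ V τ (g t) (w t) s) U := by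
  constructor
  · intro t ht z
    have h1 := (h.differentiable t (hU t ht) s z).hasDerivAt
    have h2 := h.equation t (hU t ht) s z
    have h3 : velocity ε γ V τ (g t) (w t) s z = deriv (fun t' => w t' s z) t := by
      have h4 : velocity ε γ V τ (g t) (w t) s z =
          τ⁻¹ * (τ⁻¹ * (g t s z - w t s z) - transport ε γ V (w t).toSymbol s z) := by
        rw [← toSymbol_transportCLM hV]; rfl
      rw [h4, inv_mul_eq_div τ (g t s z - w t s z), ← h2]
      field_simp
      ring
    rw [h3]
    exact h1
  · have h1 : BoundedOn (fun t => g t s - w t s) U := (hg s).sub (hw s)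
    exact ((h1.const_smul τ⁻¹).sub (boundedOn_map hw (transportCLM ε γ V) s)).const_smul τ⁻¹

/-- The first moments of the transport of an equilibrium vanish. -/
lemma IsEquilibrium.bandMoment_transport (hε : 0 < ε) (hV : V.HasTemperateGrowth)
    {c : ℝ} {n : ℤˣ → Plane → ℝ} {A B : Plane → ℝ} {g : WignerFun} (h : IsEquilibrium ε c n A B g)
    (σ : ℤˣ) (r : Plane) : bandMomentCLM σ r (transportCLM ε γ V g) = 0 := by
  rw [bandMomentCLM_apply, toSymbol_transportCLM hV]
  refine bandMoment_transport_eq_zero ε γ V ?_ σ r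
  have := IsQuantumExp.reverse_eq hε (admissible_neg_modHamiltonian hε c h.temperate_A h.temperate_B)
    (reverse_neg_modHamiltonian c A B) h.exp_eq
  conv_rhs => rw [← this]
  rfl

/-- The band density with the corrections that remove the singular terms from its time
derivative. -/
def correctedDensity (ε γ : ℝ) (V : Plane → ℝ) (σ : ℤˣ) (r : Plane) (τ : ℝ) (w : WignerFun) : ℝ :=
  bandMomentCLM σ r w - τ * bandMomentCLM σ r (transportCLM ε γ V w) +
    τ ^ 2 * bandMomentCLM σ r (transportCLM ε γ V (transportCLM ε γ V w))

/-- By `m g = m w`, the first term contributes `-τ⁻¹ m(T w)`. By `m(T g) = 0`, the second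
contributes `τ⁻¹ m(T w) + m(T T w)`. The third contributes `m(T T g) - m(T T w) - τ m(T T T w)`, and
the sum is regular in `τ`. -/
lemma IsSolution.hasDerivAt_correctedDensity (hε : 0 < ε) (hV : V.HasTemperateGrowth) (hτ : 0 < τ)
    (h : IsSolution ε γ V τ A B g w) {U : Set ℝ} (hUo : IsOpen U) (hUc : Convex ℝ U)
    (hU : ∀ t ∈ U, 0 < t)
    (hg : ∀ s, BoundedOn (fun t => g t s) U) (hw : ∀ s, BoundedOn (fun t => w t s) U)
    (σ : ℤˣ) (r : Plane) {t : ℝ} (ht : t ∈ U) :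
    HasDerivAt (fun t => correctedDensity ε γ V σ r τ (w t))
      (bandMomentCLM σ r (transportCLM ε γ V (transportCLM ε γ V (g t))) -
        τ * bandMomentCLM σ r (transportCLM ε γ V (transportCLM ε γ V (transportCLM ε γ V (w t)))))
      t := by
  set m := bandMomentCLM σ r
  set T := transportCLM ε γ V with hT
  have hd := fun L => hasDerivAt_map hUo hUc (h.pointwiseDeriv hV hτ hU hg hw) L ht
  have h1 := ((hd m).sub ((hd (m ∘L T)).const_mul τ)).add ((hd (m ∘L T ∘L T)).const_mul (τ ^ 2))
  refine h1.congr_deriv ?_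
  have e1 : m (g t) = m (w t) := by
    rw [bandMomentCLM_apply, bandMomentCLM_apply]
    exact (h.equilibrium t (hU t ht)).moments σ r
  have e2 : m (T (g t)) = 0 := (h.equilibrium t (hU t ht)).bandMoment_transport hε hV σ r
  simp only [velocity, ContinuousLinearMap.comp_apply, map_smul, map_sub, smul_eq_mul, ← hT, e1, e2]
  field_simp
  ring

end Graphene

/-! ### Passage to the diffusive limit -/

open Graphene SchwartzMap

theorem theorem1
    (ε γ : ℝ) (hε : 0 < ε) (hγ : 0 < γ)
    (V : Graphene.Plane → ℝ) (hV : Function.HasTemperateGrowth V)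
    (τ₀ : ℝ) (hτ₀ : 0 < τ₀)
    -- solutions `w τ` of the scaled system, with their equilibria and multipliers
    (w g : ℝ → ℝ → Graphene.WignerFun) (A B : ℝ → ℝ → Graphene.Plane → ℝ)
    (hsol : ∀ τ ∈ Set.Ioo 0 τ₀, Graphene.IsSolution ε γ V τ (A τ) (B τ) (g τ) (w τ))
    -- bounds that are uniform in `τ`, locally in time
    (hbound : ∀ a b : ℝ, 0 < a → ∀ k l : ℕ, ∃ C : ℝ, ∀ τ ∈ Set.Ioo 0 τ₀, ∀ t ∈ Set.Icc a b,
      ∀ s, SchwartzMap.seminorm ℝ k l (w τ t s) ≤ C ∧ SchwartzMap.seminorm ℝ k l (g τ t s) ≤ C)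
    (hmult : ∀ a b : ℝ, 0 < a → ∃ (C : ℝ) (k : ℕ), ∀ τ ∈ Set.Ioo 0 τ₀, ∀ t ∈ Set.Icc a b,
      ∀ r, |A τ t r| ≤ C * (1 + ‖r‖) ^ k ∧ |B τ t r| ≤ C * (1 + ‖r‖) ^ k)
    -- the limit densities and their equilibrium
    (n : ℤˣ → ℝ → Graphene.Plane → ℝ)
    (G : ℝ → Graphene.WignerFun) (A₀ B₀ : ℝ → Graphene.Plane → ℝ)
    (hG : ∀ t, 0 < t →
      Graphene.IsEquilibrium ε (ε * γ) (fun σ => n σ t) (A₀ t) (B₀ t) (G t))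
    (hlim : ∀ σ t r, 0 < t →
      Tendsto (fun τ => Graphene.bandMoment σ (w τ t).toSymbol r) (𝓝[>] 0) (𝓝 (n σ t r))) :
    ∀ σ t r, 0 < t →
      Integrable (fun p => Graphene.band σ
        (Graphene.transport ε γ V (Graphene.transport ε γ V (G t).toSymbol)) (r, p)) ∧
      HasDerivAt (fun t' => n σ t' r)
        (Graphene.bandMoment σ
          (Graphene.transport ε γ V (Graphene.transport ε γ V (G t).toSymbol)) r) t := by
  intro σ t r ht
  set T := transportCLM ε γ V with hT
  rw [← toSymbol_transportCLM hV, ← toSymbol_transportCLM hV, ← bandMomentCLM_apply]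
  refine ⟨integrable_band σ _ r, ?_⟩
  -- A neighbourhood of `t` whose closure is compact in the positive half-line, where the uniform
  -- bounds apply.
  set a := t / 2 with ha
  set b := 2 * t with hb
  have ha0 : 0 < a := by positivity
  have htU : t ∈ Set.Ioo a b := ⟨by linarith, by linarith⟩
  have hUpos : ∀ s ∈ Set.Ioo a b, 0 < s := fun s hs => ha0.trans hs.1
  set S : Set (ℝ × ℝ) := Set.Ioo 0 τ₀ ×ˢ Set.Ioo a b with hS
  have hτev : Set.Ioo 0 τ₀ ∈ 𝓝[>] (0 : ℝ) := Ioo_mem_nhdsGT hτ₀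
  have hUev : Set.Ioo a b ∈ 𝓝 t := isOpen_Ioo.mem_nhds htU
  have hSev : ∀ᶠ i in 𝓝[>] (0 : ℝ) ×ˢ 𝓝 t, i ∈ S := prod_mem_prod hτev hUev
  have hwS : ∀ s, BoundedOn (fun i : ℝ × ℝ => w i.1 i.2 s) S := fun s k l => by
    obtain ⟨C, hC⟩ := hbound a b ha0 k l
    exact ⟨C, fun i hi => (hC i.1 hi.1 i.2 (Set.Ioo_subset_Icc_self hi.2) s).1⟩
  have hgS : ∀ s, BoundedOn (fun i : ℝ × ℝ => g i.1 i.2 s) S := fun s k l => by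
    obtain ⟨C, hC⟩ := hbound a b ha0 k l
    exact ⟨C, fun i hi => (hC i.1 hi.1 i.2 (Set.Ioo_subset_Icc_self hi.2) s).2⟩
  have slice : ∀ {f : ℝ → ℝ → WignerFun}, (∀ s, BoundedOn (fun i : ℝ × ℝ => f i.1 i.2 s) S) →
      ∀ τ ∈ Set.Ioo 0 τ₀, ∀ s, BoundedOn (fun t => f τ t s) (Set.Ioo a b) :=
    fun hf τ hτ s k l => by
      obtain ⟨C, hC⟩ := hf s k l
      exact ⟨C, fun t ht => hC (τ, t) ⟨hτ, ht⟩⟩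
  have hderiv : ∀ σ r, ∀ τ ∈ Set.Ioo 0 τ₀, ∀ s ∈ Set.Ioo a b,
      HasDerivAt (fun t => correctedDensity ε γ V σ r τ (w τ t))
        (bandMomentCLM σ r (T (T (g τ s))) - τ * bandMomentCLM σ r (T (T (T (w τ s))))) s :=
    fun σ r τ hτ s hs => (hsol τ hτ).hasDerivAt_correctedDensity hε hV hτ.1 isOpen_Ioo
      (convex_Ioo a b) hUpos (slice hgS τ hτ) (slice hwS τ hτ) σ r hs
  -- The corrections are of order `τ`, uniformly in time, because continuous linear forms are
  -- bounded on the bounded family `w`.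
  have hcorr : ∀ σ r, ∃ e : ℝ → ℝ, Tendsto e (𝓝[>] 0) (𝓝 0) ∧ ∀ τ ∈ Set.Ioo 0 τ₀,
      ∀ s ∈ Set.Ioo a b,
        |correctedDensity ε γ V σ r τ (w τ s) - bandMomentCLM σ r (w τ s)| ≤ e τ := by
    intro σ r
    obtain ⟨C₁, hC₁0, hC₁⟩ := exists_abs_map_le hwS (bandMomentCLM σ r ∘L T)
    obtain ⟨C₂, hC₂0, hC₂⟩ := exists_abs_map_le hwS (bandMomentCLM σ r ∘L T ∘L T)
    refine ⟨fun τ => τ * C₁ + τ ^ 2 * C₂, ?_, fun τ hτ s hs => ?_⟩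
    · have : Tendsto (fun τ : ℝ => τ * C₁ + τ ^ 2 * C₂) (𝓝 0) (𝓝 (0 * C₁ + 0 ^ 2 * C₂)) :=
        Continuous.tendsto (by fun_prop) 0
      simpa using this.mono_left nhdsWithin_le_nhds
    · have h1 := hC₁ (τ, s) ⟨hτ, hs⟩
      have h2 := hC₂ (τ, s) ⟨hτ, hs⟩
      simp only [ContinuousLinearMap.comp_apply] at h1 h2
      have h3 : correctedDensity ε γ V σ r τ (w τ s) - bandMomentCLM σ r (w τ s) =
          τ ^ 2 * bandMomentCLM σ r (T (T (w τ s))) - τ * bandMomentCLM σ r (T (w τ s)) := by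
        rw [correctedDensity]; ring
      have h4 := hτ.1
      rw [h3]
      show _ ≤ τ * C₁ + τ ^ 2 * C₂
      rw [add_comm]
      refine (abs_sub _ _).trans (add_le_add ?_ ?_)
      · rw [abs_mul, abs_of_nonneg (sq_nonneg τ)]
        gcongr
      · rw [abs_mul, abs_of_pos h4]
        gcongr
  -- The densities are assumed to converge at each time separately. The corrected densities are
  -- Lipschitz in time uniformly in `τ`, so the convergence is joint in `(τ, s)` as `s → t`, up to
  -- the vanishing corrections.
  have hjoint : ∀ σ r, Tendsto (fun i : ℝ × ℝ => bandMomentCLM σ r (w i.1 i.2))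
      (𝓝[>] 0 ×ˢ 𝓝 t) (𝓝 (n σ t r)) := by
    intro σ r
    obtain ⟨e, he, hwe⟩ := hcorr σ r
    obtain ⟨C₃, hC₃0, hC₃⟩ := exists_abs_map_le hwS (bandMomentCLM σ r ∘L T ∘L T ∘L T)
    obtain ⟨C₄, hC₄0, hC₄⟩ := exists_abs_map_le hgS (bandMomentCLM σ r ∘L T ∘L T)
    simp only [ContinuousLinearMap.comp_apply] at hC₃ hC₄
    have hslope : ∀ τ ∈ Set.Ioo 0 τ₀, ∀ s ∈ Set.Ioo a b, ‖bandMomentCLM σ r (T (T (g τ s))) -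
        τ * bandMomentCLM σ r (T (T (T (w τ s))))‖ ≤ C₄ + τ₀ * C₃ := fun τ hτ s hs => by
      refine (norm_sub_le _ _).trans (add_le_add (hC₄ (τ, s) ⟨hτ, hs⟩) ?_)
      rw [norm_mul, Real.norm_of_nonneg hτ.1.le]
      exact mul_le_mul hτ.2.le (hC₃ (τ, s) ⟨hτ, hs⟩) (norm_nonneg _) hτ₀.le
    have h1 : ∀ i ∈ S, ‖bandMomentCLM σ r (w i.1 i.2) - bandMomentCLM σ r (w i.1 t)‖ ≤
        (C₄ + τ₀ * C₃) * |i.2 - t| + (e i.1 + e i.1) := by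
      rintro ⟨τ, s⟩ ⟨hτ, hs⟩
      have h2 := (convex_Ioo a b).norm_image_sub_le_of_norm_hasDerivWithin_le
        (C := C₄ + τ₀ * C₃)
        (fun x hx => (hderiv σ r τ hτ x hx).hasDerivWithinAt) (hslope τ hτ) htU hs
      have h3 := hwe τ hτ s hs
      have h4 := hwe τ hτ t htU
      rw [Real.norm_eq_abs, Real.norm_eq_abs] at h2
      rw [Real.norm_eq_abs]
      simp only [abs_le] at h2 h3 h4 ⊢
      constructor <;> linarith [h2.1, h2.2, h3.1, h3.2, h4.1, h4.2]
    have h5 : Tendsto (fun i : ℝ × ℝ => (C₄ + τ₀ * C₃) * |i.2 - t| + (e i.1 + e i.1))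
        (𝓝[>] 0 ×ˢ 𝓝 t) (𝓝 0) := by
      have h6 : Tendsto (fun s : ℝ => (C₄ + τ₀ * C₃) * |s - t|) (𝓝 t)
          (𝓝 ((C₄ + τ₀ * C₃) * |t - t|)) := Continuous.tendsto (by fun_prop) t
      have h7 := he.comp (tendsto_fst (f := 𝓝[>] (0 : ℝ)) (g := 𝓝 t))
      simpa using (h6.comp (tendsto_snd (f := 𝓝[>] (0 : ℝ)))).add (h7.add h7)
    have h8 := squeeze_zero_norm' (hSev.mono h1) h5
    have h9 : Tendsto (fun τ => bandMomentCLM σ r (w τ t)) (𝓝[>] 0) (𝓝 (n σ t r)) := by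
      simpa only [bandMomentCLM_apply] using hlim σ t r ht
    simpa using h8.add (h9.comp (tendsto_fst (g := 𝓝 t)))
  obtain ⟨C, k, hCk⟩ := hmult a b ha0
  have hequil : ∀ i ∈ S, IsEquilibrium ε (ε * γ)
      (fun σ => bandMoment σ (w i.1 i.2).toSymbol) (A i.1 i.2) (B i.1 i.2) (g i.1 i.2) :=
    fun i hi => (hsol i.1 hi.1).equilibrium i.2 (hUpos i.2 hi.2)
  -- Stability is applied along the product filter, with pairs `(τ, s)` as indices. Only the
  -- equilibrium at the single time `t` appears in the limit, so no continuity of `G` in time is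
  -- needed.
  have hg : Tendsto (fun i : ℝ × ℝ => g i.1 i.2) (𝓝[>] 0 ×ˢ 𝓝 t) (𝓝 (G t)) := by
    refine tendsto_pi_nhds.2 fun s => tendsto_of_tendsto_bandMoment hε (ε * γ) hSev
      (fun i hi => (hequil i hi).temperate_A) (fun i hi => (hequil i hi).temperate_B)
      (hG t ht).temperate_A (hG t ht).temperate_B (fun i hi => (hequil i hi).exp_eq)
      (hG t ht).exp_eq hgS
      (fun i hi => hCk i.1 hi.1 i.2 (Set.Ioo_subset_Icc_self hi.2)) (fun σ r => ?_) s
    rw [(hG t ht).moments σ r]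
    refine (hjoint σ r).congr' (hSev.mono fun i hi => ?_)
    rw [bandMomentCLM_apply]
    exact ((hequil i hi).moments σ r).symm
  -- Uniform convergence is needed only along the filter at `t`, so the candidate limit of the
  -- derivatives may be constant in `s`, equal to its value at `t`; the joint limit of `g` gives
  -- exactly this.
  refine hasDerivAt_of_tendstoUniformlyOnFilter (l := 𝓝[>] (0 : ℝ))
    (f := fun τ s => correctedDensity ε γ V σ r τ (w τ s))
    (f' := fun τ s => bandMomentCLM σ r (T (T (g τ s))) -
      τ * bandMomentCLM σ r (T (T (T (w τ s)))))
    (g' := fun _ => bandMomentCLM σ r (T (T (G t)))) ?_ ?_ ?_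
  · rw [Metric.tendstoUniformlyOnFilter_iff]
    obtain ⟨C₃, hC₃0, hC₃⟩ := exists_abs_map_le hwS (bandMomentCLM σ r ∘L T ∘L T ∘L T)
    have h1 := (((bandMomentCLM σ r ∘L T ∘L T).continuous.tendsto _).comp hg)
    have h2 : Tendsto (fun i : ℝ × ℝ => i.1 * bandMomentCLM σ r (T (T (T (w i.1 i.2)))))
        (𝓝[>] 0 ×ˢ 𝓝 t) (𝓝 0) := by
      have h3 : Tendsto (fun i : ℝ × ℝ => i.1 * C₃) (𝓝[>] (0 : ℝ) ×ˢ 𝓝 t) (𝓝 0) := by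
        have h4 : Tendsto (fun τ : ℝ => τ * C₃) (𝓝 0) (𝓝 (0 * C₃)) :=
          Continuous.tendsto (by fun_prop) 0
        rw [zero_mul] at h4
        exact (h4.mono_left nhdsWithin_le_nhds).comp tendsto_fst
      refine squeeze_zero_norm' (hSev.mono fun i hi => ?_) h3
      rw [norm_mul, Real.norm_of_nonneg hi.1.1.le]
      exact mul_le_mul_of_nonneg_left (hC₃ i hi) hi.1.1.le
    have h5 := h1.sub h2
    rw [sub_zero] at h5
    intro η hη
    filter_upwards [Metric.tendsto_nhds.1 h5 η hη] with i hi
    rwa [dist_comm]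
  · exact hSev.mono fun i hi => hderiv σ r i.1 hi.1 i.2 hi.2
  · filter_upwards [hUev] with s hs
    obtain ⟨e, he, hwe⟩ := hcorr σ r
    have h1 : Tendsto (fun τ => correctedDensity ε γ V σ r τ (w τ s) -
        bandMomentCLM σ r (w τ s)) (𝓝[>] 0) (𝓝 0) :=
      squeeze_zero_norm' (by filter_upwards [hτev] with τ hτ using hwe τ hτ s hs) he
    have h2 : Tendsto (fun τ => bandMomentCLM σ r (w τ s)) (𝓝[>] 0) (𝓝 (n σ s r)) := by
      simpa only [bandMomentCLM_apply] using hlim σ s r (hUpos s hs)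
    simpa using h1.add h2

end
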